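/- Let $n\ge 2$. For $0\le l\le n$ let $P_l(X,Y)$ be a homogeneous polynomial of degree $l$ with complex coefficients in two non-commuting variables $X,Y$. Assume that, for a complex variable $z$, $P_n(iz,0)=z^n$ and that $P_n(iz,1)$ has $n$ distinct complex roots $\gamma_1,\dots,\gamma_n$. For $\gamma\in\mathbb C\setminus\{0\}$ let $$\mathcal L_\gamma=\sum_{l=0}^n\gamma^{-(n-l)}P_l(i\partial_t,t),$$ a linear differential operator of order $n$ acting on $C^\infty(\mathbb R;\mathbb C)$. *The exponents.* Write each $P_l(i\partial_t,t)$ with powers of $t$ to the left of powers of $\partial_t$. Let $d_{l,j}$ be the coefficient of $t^{l-j}\partial_t^j$ in $P_l(i\partial_t,t)$ ($0$ if $j>l$), and let $e_{j}$ be the coefficient of $t^{n-j-2}\partial_t^j$ in $P_n(i\partial_t,t)$ ($0$ if $j+2>n$). Let $V=(\gamma_j^{\,i-1})_{1\le i,j\le n}$ and $\Lambda=\operatorname{diag}(\gamma_1,\dots,\gamma_n)$. Let $E_1$ and $E_2$ be the $n\times n$ matrices whose only non-zero row is the last one, with $j$-th entries $-d_{n-1,j-1}/\gamma$ and $-(e_{j-1}+d_{n-2,j-1}/\gamma^2)$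 respectively. Put $D_i=V^{-1}E_iV$ for $i=1,2$ and $U=V^{-1}\big((i-1)\gamma_j^{\,i-1}\big)_{1\le i,j\le n}$. Let $A$ be the matrix with zero diagonal such that $[A,\Lambda]=A\Lambda-\Lambda A$ equals $D_1$ off the diagonal. Define $$\beta_{\gamma,k}=[D_1]_{k,k},\qquad \rho_{\gamma,k}=\big[D_2+[D_1,A]+A[A,\Lambda]-U\big]_{k,k},$$ $$\Phi_k(t,\gamma)=\gamma_k\frac{t^2}{2}+\beta_{\gamma,k}\,t+\rho_{\gamma,k}\ln|t|\qquad(t\in\mathbb R\setminus\{0\}).$$ *Claim.* For each choice of sign $\pm$ there are functions $\psi_k^{\pm}(t,\gamma)$, $1\le k\le n$, defined for $t\in\mathbb R$ and $\operatorname{Re}\gamma>0$, which are $C^\infty$ on $\mathbb R$ as functions of $t$ and holomorphic on $\{\operatorname{Re}\gamma>0\}$ as functions of $\gamma$, such that for every $\gamma$ with $\operatorname{Re}\gamma>0$ the functions $\psi_1^\pm(\cdot,\gamma),\dots,\psi_n^\pm(\cdot,\gamma)$ form a basis of $\ker\mathcal L_\gamma\subset C^\infty(\mathbb R;\mathbb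 C)$, and such that for all $\gamma_0>0$, $t_0>0$ and every integer $j\ge 0$ there is a constant $C>0$ with the following two properties for all $1\le k\le n$ and all $\gamma$ with $\operatorname{Re}\gamma>0$, $|\gamma|\ge\gamma_0$: $$|\partial_t^j\psi_k^{\pm}(t,\gamma)|\le C\,(1+|t|)^j\,\big|e^{\Phi_k(t,\gamma)}\big|\quad\text{whenever }\pm t\ge t_0\ \text{(resp.)},$$ $$|\partial_t^j\psi_k^{\pm}(t,\gamma)|\le C\quad\text{whenever } |t|\le t_0 .$$ -/

import Mathlib

open scoped ContDiff Polynomial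

noncomputable section

namespace HeisenbergODE

/-- Non-commutative complex polynomials `P(X, Y)`; `X` and `Y` are the generators `0` and `1`. -/
abbrev NCPoly : Type := FreeAlgebra ℂ (Fin 2)

/-- `p` is homogeneous of degree `l`: a linear combination of words of length `l` in `X, Y`. -/
def IsHomog (l : ℕ) (p : NCPoly) : Prop :=
  p ∈ (Submodule.span ℂ (Set.range (FreeAlgebra.ι ℂ : Fin 2 → NCPoly))) ^ l

/-- The complex vector space of smooth functions `ℝ → ℂ`. -/
def Smooth : Submodule ℂ (ℝ → ℂ) where
  carrier := {f | ContDiff ℝ ∞ f}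
  add_mem' hf hg := by
    rw [Set.mem_ofPred_eq] at *
    exact hf.add hg
  zero_mem' := by
    rw [Set.mem_ofPred_eq]
    exact contDiff_const
  smul_mem' c f hf := by
    rw [Set.mem_ofPred_eq] at *
    exact contDiff_const.smul hf

/-- The operator `i ∂_t` on smooth functions. -/
def opD : Module.End ℂ Smooth where
  toFun f := ⟨fun t => Complex.I * deriv f.1 t,
    contDiff_const.mul (contDiff_infty_iff_deriv.1 f.2).2⟩
  map_add' f g := by
    ext t
    have hf : DifferentiableAt ℝ f.1 t := (contDiff_infty_iff_deriv.1 f.2).1 t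
    have hg : DifferentiableAt ℝ g.1 t := (contDiff_infty_iff_deriv.1 g.2).1 t
    change Complex.I * deriv (f.1 + g.1) t = Complex.I * deriv f.1 t + Complex.I * deriv g.1 t
    rw [deriv_add hf hg]
    ring
  map_smul' c f := by
    ext t
    have hf : DifferentiableAt ℝ f.1 t := (contDiff_infty_iff_deriv.1 f.2).1 t
    change Complex.I * deriv (c • f.1) t = c * (Complex.I * deriv f.1 t)
    rw [deriv_const_smul c hf, smul_eq_mul]
    ring

/-- The operator of multiplication by `t` on smooth functions. -/
def opM : Module.End ℂ Smooth where
  toFun f := ⟨fun t => (t : ℂ) * f.1 t, by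
    have hf : ContDiff ℝ ∞ f.1 := f.2
    exact Complex.ofRealCLM.contDiff.mul hf⟩
  map_add' f g := by
    ext t
    exact mul_add _ _ _
  map_smul' c f := by
    ext t
    exact mul_left_comm _ _ _

/-- The differential operator `P(i ∂_t, t)`. -/
def quantize (p : NCPoly) : Module.End ℂ Smooth := FreeAlgebra.lift ℂ ![opD, opM] p

/-- The operator `𝓛_γ = ∑_{l ≤ n} γ^{-(n-l)} P_l(i ∂_t, t)`. -/
def opL (n : ℕ) (P : ℕ → NCPoly) (γ : ℂ) : Module.End ℂ Smooth :=
  ∑ l ∈ Finset.range (n + 1), (γ ^ (n - l))⁻¹ • quantize (P l)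

/-- The polynomial `P(i z, 0)` in the commuting variable `z`. -/
def evalAtZero (p : NCPoly) : ℂ[X] :=
  FreeAlgebra.lift ℂ ![Polynomial.C Complex.I * Polynomial.X, 0] p

/-- The polynomial `P(i z, 1)` in the commuting variable `z`. -/
def evalAtOne (p : NCPoly) : ℂ[X] :=
  FreeAlgebra.lift ℂ ![Polynomial.C Complex.I * Polynomial.X, 1] p

/-- The operator `i (∂_t + ξ)` on polynomials in `t = X 0` and `ξ = X 1`. -/
def symD : Module.End ℂ (MvPolynomial (Fin 2) ℂ) :=
  Complex.I • ((MvPolynomial.pderiv (R := ℂ) (0 : Fin 2)).toLinearMap +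
    LinearMap.mulLeft ℂ (MvPolynomial.X 1))

/-- The operator of multiplication by `t = X 0` on polynomials in `t` and `ξ`. -/
def symM : Module.End ℂ (MvPolynomial (Fin 2) ℂ) :=
  LinearMap.mulLeft ℂ (MvPolynomial.X 0)

/-- The full symbol `e^{-tξ} P(i ∂_t, t) e^{tξ}` of `P(i ∂_t, t)`: the coefficient of `t^a ξ^j` in
it is the coefficient of `t^a ∂_t^j` when `P(i ∂_t, t)` is written with the powers of `t` to the
left of the derivatives. -/
def fullSymbol (p : NCPoly) : MvPolynomial (Fin 2) ℂ := FreeAlgebra.lift ℂ ![symD, symM] p 1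

/-- The coefficient of `t^a ∂_t^j` in `P(i ∂_t, t)`. -/
def coefTD (p : NCPoly) (a j : ℕ) : ℂ :=
  (fullSymbol p).coeff (Finsupp.single 0 a + Finsupp.single 1 j)

/-- `d_{l,j}`: the coefficient of `t^{l-j} ∂_t^j` in `P_l(i ∂_t, t)`, zero for `j > l`. -/
def coefd (P : ℕ → NCPoly) (l j : ℕ) : ℂ := if j ≤ l then coefTD (P l) (l - j) j else 0

/-- `e_{l,j,1}`: the coefficient of `t^{l-j-2} ∂_t^j` in `P_l(i ∂_t, t)`, zero for `j + 2 > l`. -/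
def coefe (P : ℕ → NCPoly) (l j : ℕ) : ℂ := if j + 2 ≤ l then coefTD (P l) (l - j - 2) j else 0

/-! The matrices of the diagonalization of the first order system of `𝓛_γ y = 0`, taken at `t = 1`
(rows and columns are counted from `0`). As functions of `t`, `D₁` is constant and
`D₂`, `A`, `S₀⁻¹ S₀'` are `t⁻¹` times, and `Λ₀` is `t` times, the matrices below. -/

/-- `S₀(1)`, with entries `r_j ^ i`. -/
def matS (n : ℕ) (r : Fin n → ℂ) : Matrix (Fin n) (Fin n) ℂ := (Matrix.vandermonde r).transpose

/-- The matrix with last row `c` and all other rows zero. -/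
def lastRow (n : ℕ) (c : Fin n → ℂ) : Matrix (Fin n) (Fin n) ℂ :=
  Matrix.of fun i j => if (i : ℕ) + 1 = n then c j else 0

/-- `D₁ = S₀⁻¹ E₁ S₀`, where `E₁` has the last row `- d_{n-1,j} / γ`. -/
def matD1 (n : ℕ) (P : ℕ → NCPoly) (r : Fin n → ℂ) (γ : ℂ) : Matrix (Fin n) (Fin n) ℂ :=
  (matS n r)⁻¹ * lastRow n (fun j => -(coefd P (n - 1) j / γ)) * matS n r

/-- `D₂ = S₀⁻¹ E₂ S₀`, where `E₂` has the last row `- (e_{n,j,1} + d_{n-2,j} / γ²)`. -/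
def matD2 (n : ℕ) (P : ℕ → NCPoly) (r : Fin n → ℂ) (γ : ℂ) : Matrix (Fin n) (Fin n) ℂ :=
  (matS n r)⁻¹ * lastRow n (fun j => -(coefe P n j + coefd P (n - 2) j / γ ^ 2)) * matS n r

/-- `Λ₀`, the diagonal matrix of the roots. -/
def matLam (n : ℕ) (r : Fin n → ℂ) : Matrix (Fin n) (Fin n) ℂ := Matrix.diagonal r

/-- `A`: zero on the diagonal, and `A Λ₀ - Λ₀ A = D₁` off the diagonal. -/
def matA (n : ℕ) (P : ℕ → NCPoly) (r : Fin n → ℂ) (γ : ℂ) : Matrix (Fin n) (Fin n) ℂ :=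
  Matrix.of fun i j => if i = j then 0 else matD1 n P r γ i j / (r j - r i)

/-- `S₀⁻¹ S₀'`; the entries of `S₀'` are `i r_j ^ i` (at `t = 1`). -/
def matU (n : ℕ) (r : Fin n → ℂ) : Matrix (Fin n) (Fin n) ℂ :=
  (matS n r)⁻¹ * Matrix.of fun i j : Fin n => ((i : ℕ) : ℂ) * r j ^ (i : ℕ)

/-- `β_{γ,k}`, the `k`-th diagonal entry of `D₁`. -/
def betaCoef (n : ℕ) (P : ℕ → NCPoly) (r : Fin n → ℂ) (γ : ℂ) (k : Fin n) : ℂ :=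
  matD1 n P r γ k k

/-- `ρ_{γ,k}`, the `k`-th diagonal entry of `D₂ + [D₁, A] + A [A, Λ₀] - S₀⁻¹ S₀'`. -/
def rhoCoef (n : ℕ) (P : ℕ → NCPoly) (r : Fin n → ℂ) (γ : ℂ) (k : Fin n) : ℂ :=
  (matD2 n P r γ + (matD1 n P r γ * matA n P r γ - matA n P r γ * matD1 n P r γ)
    + matA n P r γ * (matA n P r γ * matLam n r - matLam n r * matA n P r γ)
    - matU n r) k k

/-- The phase `Φ_k(t, γ) = r_k t² / 2 + β_{γ,k} t + ρ_{γ,k} ln |t|`. -/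
def phase (n : ℕ) (P : ℕ → NCPoly) (r : Fin n → ℂ) (k : Fin n) (t : ℝ) (γ : ℂ) : ℂ :=
  r k * (t : ℂ) ^ 2 / 2 + betaCoef n P r γ k * (t : ℂ) + rhoCoef n P r γ k * (Real.log |t| : ℂ)

end HeisenbergODE

end

/-!
Put `w = γ⁻¹`. The equation `𝓛_γ y = 0` has coefficients that are polynomial in `t` and in `w`, and
a normal ordering argument (`quantize_eq_symbolOp`, `IsHomog.isHomogSymbol`) identifies them with
the coefficients of the full symbols. The companion system therefore has a fundamental solution
which is entire in `(t, w)` (`exists_entire_solution`, `exists_fundamental_solution`), and a basis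
of the kernel which is holomorphic in `γ` amounts to a basis of Cauchy data at `t = 0` which is
entire in `w` (`kernel_basis_of_cauchyData`). The point is to choose these data such that the
solutions are of the size of `exp Φ_k`, uniformly in `w` on bounded sets.

In the unknowns `t ^ (-i) ∂_t ^ i y` and in powers of `s = t⁻¹` the system has the leading
matrix `t Λ₀` in the eigenbasis of the roots. The substitution `1 + s A + s² B` diagonalises it up
to terms of relative order `s³` (`matN_mul_matT`), and the diagonal terms which are left are the
derivative of `Φ_k`.

The diagonalised system is not solved on the real axis, because there the real parts of
`Φ_j - Φ_k` may change sign with `γ` or vanish. It is solved in the variable `v = (t / α) ^ 2`, for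
a complex `α` with `(α² / 2 (r_j - r_k)).im ≠ 0` for all `j ≠ k`: along vertical lines the leading
parts of all `exp (Φ_j - Φ_k)` then grow or decay exponentially. For each `j` one of the two
vertical directions makes the exponential in the `j`-th component of the integral equation decay;
for `j = k` the perturbation is `O(|v| ^ (-3 / 2))`, which is integrable. As all components are integrated from infinity, no
initial point enters and the Neumann series is holomorphic in `w`
(`exists_solution_near_unit_vector`, `exists_halfPlane_solutions`). The domain is `H m < v.re` for
`‖w‖ < m`; the constructed solutions do not depend on `m`, so that `w` ranges over all of `ℂ` and
the Cauchy data are entire (`exists_systemSolutions`, `exists_cauchyData`).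

For `α = σ μ` with `μ.re > 0` and `(μ²)⁻¹.re > 0`, the half-line `σ t > 0` and discs of radius
`(1 + |t|)⁻¹` about its points are mapped to these half-planes once `|t|` is large, and the phase
varies by a bounded amount on the discs (`halfPlane_shift`). Cauchy's inequalities then give
the bounds of the derivatives (`exists_iteratedDeriv_bound`); for bounded `t` they follow from the
bounds of entire functions on compact sets.
-/

noncomputable section

namespace HeisenbergODE

/-! ### Linear differential equations with polynomial coefficients -/

section EntireODE

variable {E : Type*} [NormedAddCommGroup E] [NormedSpace ℂ E]

/-- The Taylor coefficients at `0` of the solution of `y' = ∑ i, t ^ i • M i y`, `y 0 = y₀`. -/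
def taylorCoeff (M : ℕ → E →L[ℂ] E) (y₀ : E) : ℕ → E
  | 0 => y₀
  | m + 1 => ((m : ℂ) + 1)⁻¹ • ∑ i : Fin (m + 1), M i (taylorCoeff M y₀ (m - i))

lemma taylorCoeff_succ (M : ℕ → E →L[ℂ] E) (y₀ : E) (m : ℕ) :
    taylorCoeff M y₀ (m + 1) =
      ((m : ℂ) + 1)⁻¹ • ∑ i ∈ Finset.range (m + 1), M i (taylorCoeff M y₀ (m - i)) := by
  rw [taylorCoeff, ← Fin.sum_univ_eq_sum_range (fun i => M i (taylorCoeff M y₀ (m - i)))]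

/-- The Taylor coefficients decay faster than every geometric sequence. The recursion gains the
factor `L / (m + 1)` at step `m`, which exceeds one at most `⌈L⌉` times. -/
lemma norm_taylorCoeff_le {M : ℕ → E →L[ℂ] E} (y₀ : E) {d : ℕ} (hd : ∀ i, d ≤ i → M i = 0)
    {θ B L : ℝ} (hθ : 0 < θ) (hθ1 : θ ≤ 1) (hB : ∀ i, ‖M i‖ ≤ B) (hL : d * B / θ ^ d ≤ L)
    (hL1 : 1 ≤ L) (m : ℕ) :
    ‖taylorCoeff M y₀ m‖ ≤ ‖y₀‖ * L ^ (min m ⌈L⌉₊) * θ ^ m := by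
  induction m using Nat.strong_induction_on with
  | _ m ih =>
  rcases m with _ | m
  · simp [taylorCoeff]
  have hB0 : 0 ≤ B := (norm_nonneg _).trans (hB 0)
  set c : ℝ := B * (‖y₀‖ * L ^ (min m ⌈L⌉₊) * (θ ^ (m + 1) / θ ^ d)) with hc
  have hc0 : 0 ≤ c := by positivity
  have hterm : ∀ i ∈ Finset.range (m + 1), ‖M i (taylorCoeff M y₀ (m - i))‖ ≤
      if i < d then c else 0 := by
    intro i hi
    rw [Finset.mem_range] at hi
    split_ifs with h
    · refine (ContinuousLinearMap.le_opNorm _ _).trans ?_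
      refine mul_le_mul (hB i) ((ih (m - i) (by omega)).trans ?_) (norm_nonneg _) hB0
      have h1 : L ^ (min (m - i) ⌈L⌉₊) ≤ L ^ (min m ⌈L⌉₊) :=
        pow_le_pow_right₀ hL1 (by omega)
      have h2 : θ ^ (m - i) ≤ θ ^ (m + 1) / θ ^ d := by
        rw [le_div_iff₀ (by positivity), ← pow_add]
        exact pow_le_pow_of_le_one hθ.le hθ1 (by omega)
      gcongr
    · rw [hd i (by omega)]
      simp
  have hsum : ‖∑ i ∈ Finset.range (m + 1), M i (taylorCoeff M y₀ (m - i))‖ ≤ d * c := by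
    refine (norm_sum_le_of_le _ hterm).trans ?_
    rw [← Finset.sum_filter, Finset.sum_const, nsmul_eq_mul]
    have : ((Finset.range (m + 1)).filter (· < d)).card ≤ d := by
      calc _ ≤ (Finset.range d).card := Finset.card_le_card fun i hi => by
            simp only [Finset.mem_filter] at hi
            exact Finset.mem_range.2 hi.2
        _ = d := Finset.card_range d
    gcongr
  rw [taylorCoeff_succ, norm_smul, norm_inv]
  have hm : ‖(m : ℂ) + 1‖ = (m : ℝ) + 1 := by
    rw [← Nat.cast_succ, Complex.norm_natCast, Nat.cast_succ]
  rw [hm, inv_mul_le_iff₀ (by positivity)]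
  refine hsum.trans ?_
  have h3 : (d : ℝ) * c = (d * B / θ ^ d) * (‖y₀‖ * L ^ (min m ⌈L⌉₊) * θ ^ (m + 1)) := by
    rw [hc]; ring
  rw [h3]
  have h4 : L * L ^ (min m ⌈L⌉₊) ≤ ((m : ℝ) + 1) * L ^ (min (m + 1) ⌈L⌉₊) := by
    by_cases hmN : m + 1 ≤ ⌈L⌉₊
    · rw [min_eq_left hmN, min_eq_left (by omega), ← pow_succ']
      exact le_mul_of_one_le_left (by positivity) (by linarith [(Nat.cast_nonneg m : (0 : ℝ) ≤ m)])
    · rw [min_eq_right (by omega), min_eq_right (by omega)]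
      have : L ≤ (m : ℝ) + 1 := by
        refine (Nat.le_ceil L).trans ?_
        exact_mod_cast (not_le.1 hmN).le
      gcongr
  calc (d * B / θ ^ d) * (‖y₀‖ * L ^ (min m ⌈L⌉₊) * θ ^ (m + 1))
      ≤ L * (‖y₀‖ * L ^ (min m ⌈L⌉₊) * θ ^ (m + 1)) := by gcongr
    _ = (L * L ^ (min m ⌈L⌉₊)) * (‖y₀‖ * θ ^ (m + 1)) := by ring
    _ ≤ (((m : ℝ) + 1) * L ^ (min (m + 1) ⌈L⌉₊)) * (‖y₀‖ * θ ^ (m + 1)) := by gcongr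
    _ = _ := by ring

variable [CompleteSpace E]

/-- A linear differential equation whose coefficients are polynomial in `t` and entire in a
parameter `w` has a solution that is entire in both variables and bounded on bounded sets. -/
theorem exists_entire_solution (M : ℕ → ℂ → E →L[ℂ] E) (d : ℕ) (hd : ∀ i w, d ≤ i → M i w = 0)
    (hM : ∀ i, Differentiable ℂ (M i)) (y₀ : E) :
    ∃ Y : ℂ → ℂ → E, (∀ w, Y 0 w = y₀) ∧
      (∀ t w, HasDerivAt (fun t => Y t w) (∑ i ∈ Finset.range d, t ^ i • M i w (Y t w)) t) ∧
      (∀ t, Differentiable ℂ (Y t)) ∧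
      ∀ R : ℝ, ∃ C, ∀ t w, ‖t‖ ≤ R → ‖w‖ ≤ R → ‖Y t w‖ ≤ C := by
  set a : ℕ → ℂ → E := fun m w => taylorCoeff (fun i => M i w) y₀ m with ha
  have hadiff : ∀ m, Differentiable ℂ (a m) := by
    intro m
    induction m using Nat.strong_induction_on with
    | _ m ih =>
    rcases m with _ | m
    · simp only [ha, taylorCoeff]
      exact differentiable_const _
    · simp only [ha, taylorCoeff_succ]
      refine Differentiable.const_smul (Differentiable.fun_sum fun i hi => ?_) _
      exact (hM i).clm_apply (ih (m - i) (by omega))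
  -- the coefficients, bounded uniformly for `w` in a disc
  have hbound : ∀ R : ℝ, 1 ≤ R → ∃ C : ℝ, 0 ≤ C ∧ ∀ (m : ℕ) (w : ℂ), ‖w‖ ≤ R →
      ‖a m w‖ ≤ C * ((2 * R)⁻¹) ^ m := by
    intro R hR
    have h1 : ∀ i, ∃ b : ℝ, ∀ w, ‖w‖ ≤ R → ‖M i w‖ ≤ b := by
      intro i
      obtain ⟨b, hb⟩ := (isCompact_closedBall (0 : ℂ) R).exists_bound_of_continuousOn
        (hM i).continuous.continuousOn
      exact ⟨b, fun w hw => hb w (by simpa using hw)⟩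
    choose b hb using h1
    have hb0 : ∀ i, 0 ≤ b i := fun i => (norm_nonneg _).trans (hb i 0 (by simp; linarith))
    set B := ∑ i ∈ Finset.range d, b i
    have hB : ∀ w, ‖w‖ ≤ R → ∀ i, ‖M i w‖ ≤ B := by
      intro w hw i
      by_cases hi : i < d
      · exact (hb i w hw).trans
          (Finset.single_le_sum (fun i _ => hb0 i) (Finset.mem_range.2 hi))
      · rw [hd i w (by omega), norm_zero]
        exact Finset.sum_nonneg fun i _ => hb0 i
    set L := max 1 (d * B / ((2 * R)⁻¹) ^ d)
    have hL1 : 1 ≤ L := le_max_left _ _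
    refine ⟨‖y₀‖ * L ^ ⌈L⌉₊, by positivity, fun m w hw => ?_⟩
    refine (norm_taylorCoeff_le y₀ (fun i hi => hd i w hi) (by positivity : 0 < (2 * R)⁻¹)
      (inv_le_one_of_one_le₀ (by linarith)) (hB w hw) (le_max_right _ _) hL1 m).trans ?_
    have : L ^ (min m ⌈L⌉₊) ≤ L ^ ⌈L⌉₊ := pow_le_pow_right₀ hL1 (min_le_right _ _)
    gcongr
  have hterm : ∀ R : ℝ, 1 ≤ R → ∃ C : ℝ, ∀ (m : ℕ) (t w : ℂ), ‖t‖ ≤ R → ‖w‖ ≤ R →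
      ‖t ^ m • a m w‖ ≤ C * (2⁻¹ : ℝ) ^ m := by
    intro R hR
    obtain ⟨C, hC0, hC⟩ := hbound R hR
    refine ⟨C, fun m t w ht hw => ?_⟩
    rw [norm_smul, norm_pow]
    calc ‖t‖ ^ m * ‖a m w‖ ≤ R ^ m * (C * ((2 * R)⁻¹) ^ m) := by
          gcongr
          exact hC m w hw
      _ = C * (R * (2 * R)⁻¹) ^ m := by rw [mul_pow]; ring
      _ = C * (2⁻¹ : ℝ) ^ m := by
          congr 2
          field_simp
  have hgeom : ∀ C : ℝ, Summable fun m : ℕ => C * (2⁻¹ : ℝ) ^ m := fun C =>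
    (summable_geometric_of_lt_one (by norm_num) (by norm_num)).mul_left C
  set Y : ℂ → ℂ → E := fun t w => ∑' m, t ^ m • a m w with hY
  have hsumm : ∀ t w, HasSum (fun m => t ^ m • a m w) (Y t w) := by
    intro t w
    obtain ⟨C, hC⟩ := hterm (max 1 (max ‖t‖ ‖w‖)) (le_max_left _ _)
    refine (Summable.of_norm_bounded (hgeom C) fun m => hC m t w ?_ ?_).hasSum
    · exact (le_max_left _ _).trans (le_max_right _ _)
    · exact (le_max_right _ _).trans (le_max_right _ _)
  refine ⟨Y, ?_, ?_, ?_, ?_⟩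
  · intro w
    have h := hsumm 0 w
    have h' : HasSum (fun m => (0 : ℂ) ^ m • a m w) ((0 : ℂ) ^ 0 • a 0 w) :=
      hasSum_single 0 fun m hm => by simp [hm]
    rw [h.unique h']
    simp [ha, taylorCoeff]
  · intro t w
    obtain ⟨C, hC⟩ := hterm (max 1 (max (‖t‖ + 1) ‖w‖)) (le_max_left _ _)
    have hball : ∀ m, ∀ z ∈ Metric.ball (0 : ℂ) (‖t‖ + 1),
        ‖z ^ m • a m w‖ ≤ C * (2⁻¹ : ℝ) ^ m := by
      intro m z hz
      refine hC m z w ?_ ((le_max_right _ _).trans (le_max_right _ _))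
      rw [mem_ball_zero_iff] at hz
      exact hz.le.trans ((le_max_left _ _).trans (le_max_right _ _))
    have hdm : ∀ (m : ℕ) (z : ℂ), HasDerivAt (fun z : ℂ => z ^ m • a m w)
        (((m : ℂ) * z ^ (m - 1)) • a m w) z :=
      fun m z => (hasDerivAt_pow m z).smul_const (a m w)
    have hdiffm : ∀ m, DifferentiableOn ℂ (fun z : ℂ => z ^ m • a m w)
        (Metric.ball (0 : ℂ) (‖t‖ + 1)) := fun m z _ =>
      (hdm m z).differentiableAt.differentiableWithinAt
    have ht : t ∈ Metric.ball (0 : ℂ) (‖t‖ + 1) := by simp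
    have hder := Complex.hasSum_deriv_of_summable_norm (hgeom C) hdiffm Metric.isOpen_ball hball ht
    have hdiffY := (Complex.differentiableOn_tsum_of_summable_norm (hgeom C) hdiffm
      Metric.isOpen_ball hball).differentiableAt (Metric.isOpen_ball.mem_nhds ht)
    simp only [fun m => (hdm m t).deriv] at hder
    have hder' := (hasSum_nat_add_iff' 1).2 hder
    simp only [Finset.range_one, Finset.sum_singleton, Nat.cast_zero, zero_mul, zero_smul,
      sub_zero, Nat.add_sub_cancel] at hder'
    -- the Cauchy product of the coefficients with the solution
    have hprod : HasSum (fun m => ∑ i ∈ Finset.range d,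
        if i ≤ m then t ^ m • M i w (a (m - i) w) else 0)
        (∑ i ∈ Finset.range d, t ^ i • M i w (Y t w)) := by
      refine hasSum_sum fun i _ => ?_
      have h1 : HasSum (fun m => t ^ i • M i w (t ^ m • a m w)) (t ^ i • M i w (Y t w)) :=
        ((M i w).hasSum (hsumm t w)).const_smul _
      rw [← (add_left_injective i).hasSum_iff]
      · convert h1 using 2 with m
        simp only [Function.comp_apply, le_add_iff_nonneg_left, zero_le, if_true,
          Nat.add_sub_cancel, map_smul, smul_smul]
        rw [pow_add, mul_comm]
      · intro m hm
        rw [if_neg]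
        intro him
        exact hm ⟨m - i, by simp; omega⟩
    have heq : ∀ m, (((m + 1 : ℕ) : ℂ) * t ^ m) • a (m + 1) w = ∑ i ∈ Finset.range d,
        if i ≤ m then t ^ m • M i w (a (m - i) w) else 0 := by
      intro m
      have hm : ((m : ℂ) + 1) ≠ 0 := Nat.cast_add_one_ne_zero m
      simp only [ha, taylorCoeff_succ, smul_smul]
      rw [Nat.cast_succ, mul_right_comm, mul_inv_cancel₀ hm, one_mul, Finset.smul_sum,
        ← Finset.sum_filter]
      refine (Finset.sum_subset_zero_on_sdiff (s₁ := (Finset.range d).filter (· ≤ m))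
        ?_ ?_ ?_).symm
      · intro i hi
        simp only [Finset.mem_filter] at hi
        exact Finset.mem_range.2 (by omega)
      · intro i hi
        simp only [Finset.mem_sdiff, Finset.mem_range, Finset.mem_filter] at hi
        rw [hd i w (by omega)]
        simp
      · intro i _
        rfl
    simp only [heq] at hder'
    rw [hprod.unique hder']
    exact hdiffY.hasDerivAt
  · intro t w
    obtain ⟨C, hC⟩ := hterm (max 1 (max ‖t‖ (‖w‖ + 1))) (le_max_left _ _)
    refine (Complex.differentiableOn_tsum_of_summable_norm (U := Metric.ball (0 : ℂ) (‖w‖ + 1))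
      (hgeom C) (fun m => ((hadiff m).const_smul (t ^ m)).differentiableOn) Metric.isOpen_ball
      fun m z hz => hC m t z ?_ ?_).differentiableAt (Metric.isOpen_ball.mem_nhds (by simp))
    · exact (le_max_left _ _).trans (le_max_right _ _)
    · rw [mem_ball_zero_iff] at hz
      exact hz.le.trans ((le_max_right _ _).trans (le_max_right _ _))
  · intro R
    obtain ⟨C, hC⟩ := hterm (max 1 R) (le_max_left _ _)
    refine ⟨∑' m : ℕ, C * (2⁻¹ : ℝ) ^ m, fun t w ht hw => ?_⟩
    refine tsum_of_norm_bounded (hgeom C).hasSum fun m => ?_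
    exact hC m t w (ht.trans (le_max_right _ _)) (hw.trans (le_max_right _ _))

end EntireODE

/-! ### Integral equations along half-lines -/

section HalfLines

open MeasureTheory Set Filter Topology

/-- An integral depending on a complex parameter is holomorphic as soon as the integrand is
holomorphic and locally dominated; the derivative of the integrand is controlled by Cauchy's
estimate. -/
theorem differentiableOn_integral_of_locally_dominated {α : Type*} [MeasurableSpace α]
    {μ : Measure α} {U : Set ℂ} (hU : IsOpen U) {F : ℂ → α → ℂ}
    (hmeas : ∀ u ∈ U, AEStronglyMeasurable (F u) μ)
    (hdiff : ∀ᵐ a ∂μ, DifferentiableOn ℂ (fun u => F u a) U)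
    (hdom : ∀ u₀ ∈ U, ∃ ρ > 0, ∃ G : α → ℝ, Integrable G μ ∧
      ∀ᵐ a ∂μ, ∀ u ∈ Metric.ball u₀ ρ, u ∈ U → ‖F u a‖ ≤ G a) :
    DifferentiableOn ℂ (fun u => ∫ a, F u a ∂μ) U := by
  intro u₀ hu₀
  obtain ⟨ρ₁, hρ₁, G, hG, hFG⟩ := hdom u₀ hu₀
  obtain ⟨ρ₂, hρ₂, hball⟩ := Metric.isOpen_iff.1 hU u₀ hu₀
  set ρ := min ρ₁ ρ₂ with hρdef
  have hρ : 0 < ρ := lt_min hρ₁ hρ₂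
  have hsub : Metric.ball u₀ ρ ⊆ U := (Metric.ball_subset_ball (min_le_right _ _)).trans hball
  have hsub1 : Metric.ball u₀ ρ ⊆ Metric.ball u₀ ρ₁ := Metric.ball_subset_ball (min_le_left _ _)
  have hdiffAt : ∀ᵐ a ∂μ, ∀ u ∈ Metric.ball u₀ (ρ / 2), DifferentiableAt ℂ (fun u => F u a) u := by
    filter_upwards [hdiff] with a ha u hu
    exact ha.differentiableAt (hU.mem_nhds (hsub (Metric.ball_subset_ball (by linarith) hu)))
  have hu₀' : u₀ ∈ Metric.ball u₀ (ρ / 2) := Metric.mem_ball_self (by positivity)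
  -- the derivative is a limit of difference quotients along a sequence
  have hmeas' : AEStronglyMeasurable (fun a => deriv (fun u => F u a) u₀) μ := by
    set h : ℕ → ℂ := fun m => ((ρ / 2 / ((m : ℝ) + 2) : ℝ) : ℂ) with hh
    have hpos : ∀ m : ℕ, 0 < ρ / 2 / ((m : ℝ) + 2) := fun m => by positivity
    have hh0 : Tendsto h atTop (𝓝[≠] 0) := by
      rw [tendsto_nhdsWithin_iff]
      refine ⟨?_, Eventually.of_forall fun m => ?_⟩
      · rw [← Complex.ofReal_zero]
        refine (Complex.continuous_ofReal.tendsto 0).comp ?_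
        exact Tendsto.const_div_atTop (tendsto_natCast_atTop_atTop.atTop_add tendsto_const_nhds) _
      · exact Complex.ofReal_ne_zero.2 (hpos m).ne'
    have hmem : ∀ m, u₀ + h m ∈ U := by
      intro m
      apply hsub
      rw [mem_ball_iff_norm, add_sub_cancel_left, hh, Complex.norm_real,
        Real.norm_of_nonneg (hpos m).le, div_lt_iff₀ (by positivity)]
      nlinarith [(Nat.cast_nonneg m : (0 : ℝ) ≤ m)]
    refine aestronglyMeasurable_of_tendsto_ae atTop
      (f := fun m a => (h m)⁻¹ • (F (u₀ + h m) a - F u₀ a)) (fun m => ?_) ?_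
    · exact ((hmeas _ (hmem m)).sub (hmeas _ hu₀)).const_smul ((h m)⁻¹)
    · filter_upwards [hdiffAt] with a ha
      exact ((ha u₀ hu₀').hasDerivAt.tendsto_slope_zero).comp hh0
  refine (hasDerivAt_integral_of_dominated_loc_of_deriv_le (s := Metric.ball u₀ (ρ / 2))
    (F' := fun u a => deriv (fun u => F u a) u) (bound := fun a => G a / (ρ / 4))
    (Metric.ball_mem_nhds _ (by positivity)) ?_ ?_ hmeas' ?_ (hG.div_const _) ?_
    ).2.differentiableAt.differentiableWithinAt
  · filter_upwards [hU.mem_nhds hu₀] with u hu using hmeas u hu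
  · refine hG.mono' (hmeas u₀ hu₀) ?_
    filter_upwards [hFG] with a ha
    exact ha u₀ (Metric.mem_ball_self hρ₁) hu₀
  · filter_upwards [hdiff, hFG] with a ha hga u hu
    have hcl : ∀ z, dist z u ≤ ρ / 4 → z ∈ Metric.ball u₀ ρ := by
      intro z hz
      have : dist u u₀ < ρ / 2 := hu
      have := dist_triangle z u u₀
      rw [Metric.mem_ball]
      linarith
    refine Complex.norm_deriv_le_of_forall_mem_sphere_norm_le (by positivity) ?_ ?_
    · refine DifferentiableOn.diffContOnCl ?_
      rw [closure_ball _ (by positivity)]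
      exact ha.mono fun z hz => hsub (hcl z hz)
    · intro z hz
      have := hcl z (Metric.mem_sphere.1 hz).le
      exact hga z (hsub1 this) (hsub this)
  · filter_upwards [hdiffAt] with a ha u hu
    exact (ha u hu).hasDerivAt

/-- The derivative of `v ↦ ∫₀^∞ e^{-c d r} g (v + r d) dr`, computed in the direction `d` by the
fundamental theorem of calculus. -/
theorem hasDerivAt_integral_halfLine {U : Set ℂ} (hU : IsOpen U) {g : ℂ → ℂ}
    (hg : DifferentiableOn ℂ g U) {c d : ℂ} (hd0 : d ≠ 0)
    (hint : ∀ v ∈ U, IntegrableOn (fun r : ℝ => Complex.exp (-(c * d * r)) * g (v + r * d)) (Ioi 0))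
    {v : ℂ} (hv : v ∈ U)
    (hJ : DifferentiableAt ℂ
      (fun v => ∫ r in Ioi (0 : ℝ), Complex.exp (-(c * d * r)) * g (v + r * d)) v) :
    HasDerivAt (fun v => ∫ r in Ioi (0 : ℝ), Complex.exp (-(c * d * r)) * g (v + r * d))
      (c * (∫ r in Ioi (0 : ℝ), Complex.exp (-(c * d * r)) * g (v + r * d)) - g v / d) v := by
  set J : ℂ → ℂ := fun v => ∫ r in Ioi (0 : ℝ), Complex.exp (-(c * d * r)) * g (v + r * d)
    with hJdef
  set φ : ℝ → ℂ := fun r => Complex.exp (-(c * d * r)) * g (v + r * d) with hφ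
  set V : Set ℝ := {r : ℝ | v + r * d ∈ U}
  have hlc : Continuous fun r : ℝ => v + (r : ℂ) * d := by fun_prop
  have hV : IsOpen V := hU.preimage hlc
  have hV0 : (0 : ℝ) ∈ V := by simpa [V] using hv
  have hφc : ContinuousOn φ V := by
    refine ContinuousOn.mul (by fun_prop) ?_
    exact hg.continuousOn.comp hlc.continuousOn fun r hr => hr
  -- translating the base point along the half-line
  have hshift : ∀ y : ℝ, v + y * d ∈ U → IntegrableOn φ (Ioi y) ∧
      J (v + y * d) = Complex.exp (c * d * y) * ∫ r in Ioi y, φ r := by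
    intro y hy
    have hpre : (fun x : ℝ => x + y) ⁻¹' (Ioi y) = Ioi 0 := by simp
    have hemb : MeasurableEmbedding (fun x : ℝ => x + y) :=
      (Homeomorph.addRight y).measurableEmbedding
    have hmp : MeasurePreserving (fun x : ℝ => x + y) volume volume :=
      measurePreserving_add_right volume y
    have heq : ∀ r : ℝ, Complex.exp (-(c * d * r)) * g (v + y * d + r * d) =
        Complex.exp (c * d * y) * φ (r + y) := by
      intro r
      simp only [hφ]
      rw [← mul_assoc, ← Complex.exp_add]
      push_cast
      congr 2 <;> ring_nf
    have h1 := hint _ hy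
    simp only [heq] at h1
    have h2 : IntegrableOn (fun r : ℝ => φ (r + y)) (Ioi 0) := by
      have := h1.const_mul (Complex.exp (-(c * d * y)))
      simp only [← mul_assoc, ← Complex.exp_add, neg_add_cancel, Complex.exp_zero, one_mul] at this
      exact this
    constructor
    · have := (hmp.integrableOn_comp_preimage hemb (f := φ) (s := Ioi y)).1
      rw [hpre] at this
      exact this h2
    · simp only [hJdef, heq]
      rw [integral_const_mul]
      congr 1
      have := hmp.setIntegral_preimage_emb hemb φ (Ioi y)
      rw [hpre] at this
      exact this
  have hint0 : IntegrableOn φ (Ioi 0) := hint v hv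
  have hev : (fun y : ℝ => J (v + y * d)) =ᶠ[𝓝 0] fun y => Complex.exp (c * d * y) *
      ((∫ r in Ioi (0 : ℝ), φ r) - ∫ r in (0 : ℝ)..y, φ r) := by
    filter_upwards [hV.mem_nhds hV0] with y hy
    obtain ⟨h1, h2⟩ := hshift y hy
    rw [h2, ← intervalIntegral.integral_interval_add_Ioi hint0 h1, add_sub_cancel_left]
  have hprim : HasDerivAt (fun y : ℝ => ∫ r in (0 : ℝ)..y, φ r) (φ 0) 0 :=
    intervalIntegral.integral_hasDerivAt_right IntervalIntegrable.refl
      (hφc.stronglyMeasurableAtFilter hV 0 hV0) (hφc.continuousAt (hV.mem_nhds hV0))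
  have hexp : HasDerivAt (fun y : ℝ => Complex.exp (c * d * y)) (c * d) 0 := by
    have h1 : HasDerivAt (fun y : ℝ => c * d * (y : ℂ)) (c * d) 0 := by
      simpa using (Complex.ofRealCLM.hasDerivAt (x := (0 : ℝ))).const_mul (c * d)
    simpa using h1.cexp
  have hder1 : HasDerivAt (fun y : ℝ => J (v + y * d)) (c * d * J v - g v) 0 := by
    refine HasDerivAt.congr_of_eventuallyEq ?_ hev
    have := hexp.mul (hprim.const_sub (∫ r in Ioi (0 : ℝ), φ r))
    refine this.congr_deriv ?_
    simp [hφ, hJdef]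
    ring
  have hder2 : HasDerivAt (fun y : ℝ => J (v + y * d)) (deriv J v * d) 0 := by
    have h1 : HasDerivAt (fun y : ℝ => v + (y : ℂ) * d) d 0 := by
      simpa using ((Complex.ofRealCLM.hasDerivAt (x := (0 : ℝ))).mul_const d).const_add v
    have h2 : HasDerivAt J (deriv J v) (v + ((0 : ℝ) : ℂ) * d) := by
      simpa using hJ.hasDerivAt
    exact h2.comp (0 : ℝ) h1
  have huniq := hder2.unique hder1
  refine hJ.hasDerivAt.congr_deriv ?_
  change deriv J v = c * J v - g v / d
  field_simp
  linear_combination huniq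

variable {ι : Type*} [Fintype ι] [DecidableEq ι]

/-- The integrand of the integral equation along the half-line from `v` in the direction `d j`. -/
def halfLineIntegrand (c d : ι → ℂ) (p : ι → ι → ℂ → ℂ → ℂ) (x : ι → ℂ → ℂ → ℂ) (j : ι)
    (v w : ℂ) (r : ℝ) : ℂ :=
  Complex.exp (-(c j * d j * r)) * ∑ m, p j m (v + r * d j) w * x m (v + r * d j) w

/-- The terms of the Neumann series of the integral equation, starting from the `k`-th unit
vector. -/
def neumannTerm (k : ι) (c d : ι → ℂ) (p : ι → ι → ℂ → ℂ → ℂ) : ℕ → ι → ℂ → ℂ → ℂ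
  | 0 => fun j _ _ => if j = k then 1 else 0
  | N + 1 => fun j v w =>
      -(d j * ∫ r in Ioi (0 : ℝ), halfLineIntegrand c d p (neumannTerm k c d p N) j v w r)

/-- A system `x' j = c j * x j + ∑ m, p j m * x m` with a small perturbation `p` has a solution
close to the `k`-th unit vector when `c k = 0`. Each component is integrated from infinity along a
half-line on which its exponential decays, so that no initial point has to be chosen; the
solution is thereby holomorphic in the parameter `w` over all of `Ω`. -/
theorem exists_solution_near_unit_vector {Ω : Set (ℂ × ℂ)} (hΩ : IsOpen Ω) (k : ι) (c d : ι → ℂ)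
    (hd0 : ∀ j, d j ≠ 0) (hck : c k = 0)
    (hd : ∀ j v w, (v, w) ∈ Ω → ∀ r : ℝ, 0 ≤ r → (v + r * d j, w) ∈ Ω)
    (p : ι → ι → ℂ → ℂ → ℂ)
    (hpv : ∀ j m w, DifferentiableOn ℂ (fun v => p j m v w) {v | (v, w) ∈ Ω})
    (hpw : ∀ j m v, DifferentiableOn ℂ (fun w => p j m v w) {w | (v, w) ∈ Ω})
    (hdom : ∀ v₀ w₀, (v₀, w₀) ∈ Ω → ∀ j, ∃ ρ > 0, ∃ G : ℝ → ℝ, IntegrableOn G (Ioi 0) ∧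
      ∀ v w, v ∈ Metric.ball v₀ ρ → w ∈ Metric.ball w₀ ρ → (v, w) ∈ Ω → ∀ r > (0 : ℝ),
        ‖Complex.exp (-(c j * d j * r))‖ * ∑ m, ‖p j m (v + r * d j) w‖ ≤ G r)
    (q : ℝ) (hq : q ≤ 1 / 2)
    (hsmall : ∀ v w, (v, w) ∈ Ω → ∀ j, ∃ G : ℝ → ℝ, IntegrableOn G (Ioi 0) ∧
      (∀ r > (0 : ℝ), ‖Complex.exp (-(c j * d j * r))‖ * ∑ m, ‖p j m (v + r * d j) w‖ ≤ G r) ∧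
      ‖d j‖ * ∫ r in Ioi 0, G r ≤ q) :
    ∃ x : ι → ℂ → ℂ → ℂ,
      (∀ j w, DifferentiableOn ℂ (fun v => x j v w) {v | (v, w) ∈ Ω}) ∧
      (∀ j v, DifferentiableOn ℂ (fun w => x j v w) {w | (v, w) ∈ Ω}) ∧
      (∀ j v w, (v, w) ∈ Ω → ‖x j v w - if j = k then 1 else 0‖ ≤ 2 * q) ∧
      ∀ j v w, (v, w) ∈ Ω →
        HasDerivAt (fun v => x j v w) (c j * x j v w + ∑ m, p j m v w * x m v w) v := by
  have hΩv : ∀ w, IsOpen {v | (v, w) ∈ Ω} := fun w => hΩ.preimage (by fun_prop)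
  have hΩw : ∀ v, IsOpen {w | (v, w) ∈ Ω} := fun v => hΩ.preimage (by fun_prop)
  -- measurability and bounds of the integrand
  have hcont : ∀ x : ι → ℂ → ℂ → ℂ,
      (∀ j w, DifferentiableOn ℂ (fun v => x j v w) {v | (v, w) ∈ Ω}) → ∀ j v w, (v, w) ∈ Ω →
      AEStronglyMeasurable (halfLineIntegrand c d p x j v w) (volume.restrict (Ioi 0)) := by
    intro x hx j v w hvw
    refine ContinuousOn.aestronglyMeasurable ?_ measurableSet_Ioi
    have hmaps : MapsTo (fun r : ℝ => v + r * d j) (Ioi 0) {v | (v, w) ∈ Ω} :=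
      fun r hr => hd j v w hvw r (le_of_lt hr)
    have hl : ContinuousOn (fun r : ℝ => v + r * d j) (Ioi 0) := by fun_prop
    refine ContinuousOn.mul (by fun_prop) (continuousOn_finsetSum _ fun m _ => ?_)
    exact ((hpv j m w).continuousOn.comp hl hmaps).mul ((hx m w).continuousOn.comp hl hmaps)
  have hle : ∀ (x : ι → ℂ → ℂ → ℂ) (B : ℝ), (∀ j v w, (v, w) ∈ Ω → ‖x j v w‖ ≤ B) →
      ∀ j v w, (v, w) ∈ Ω → ∀ r > (0 : ℝ), ‖halfLineIntegrand c d p x j v w r‖ ≤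
        ‖Complex.exp (-(c j * d j * r))‖ * (∑ m, ‖p j m (v + r * d j) w‖) * B := by
    intro x B hB j v w hvw r hr
    rw [halfLineIntegrand, norm_mul, mul_assoc ‖_‖ _ B, Finset.sum_mul]
    refine mul_le_mul_of_nonneg_left (norm_sum_le_of_le _ fun m _ => ?_) (norm_nonneg _)
    rw [norm_mul]
    exact mul_le_mul_of_nonneg_left (hB m _ _ (hd j v w hvw r hr.le)) (norm_nonneg _)
  have hintegrable : ∀ (x : ι → ℂ → ℂ → ℂ) (B : ℝ), 0 ≤ B →
      (∀ j w, DifferentiableOn ℂ (fun v => x j v w) {v | (v, w) ∈ Ω}) →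
      (∀ j v w, (v, w) ∈ Ω → ‖x j v w‖ ≤ B) → ∀ j v w, (v, w) ∈ Ω →
      IntegrableOn (halfLineIntegrand c d p x j v w) (Ioi 0) ∧
      ‖d j‖ * ∫ r in Ioi (0 : ℝ), ‖halfLineIntegrand c d p x j v w r‖ ≤ q * B := by
    intro x B hB0 hx hB j v w hvw
    obtain ⟨G, hG, hGle, hGq⟩ := hsmall v w hvw j
    have hae : ∀ᵐ r ∂(volume.restrict (Ioi (0 : ℝ))),
        ‖halfLineIntegrand c d p x j v w r‖ ≤ G r * B := by
      filter_upwards [ae_restrict_mem measurableSet_Ioi] with r hr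
      exact (hle x B hB j v w hvw r hr).trans
        (mul_le_mul_of_nonneg_right (hGle r hr) hB0)
    have hI : IntegrableOn (halfLineIntegrand c d p x j v w) (Ioi 0) :=
      (hG.mul_const B).mono' (hcont x hx j v w hvw) hae
    refine ⟨hI, ?_⟩
    calc ‖d j‖ * ∫ r in Ioi (0 : ℝ), ‖halfLineIntegrand c d p x j v w r‖
        ≤ ‖d j‖ * ∫ r in Ioi (0 : ℝ), G r * B := by
          refine mul_le_mul_of_nonneg_left ?_ (norm_nonneg _)
          exact integral_mono_ae hI.norm (hG.mul_const B) hae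
      _ = (‖d j‖ * ∫ r in Ioi (0 : ℝ), G r) * B := by rw [integral_mul_const]; ring
      _ ≤ q * B := by gcongr
  have hopv : ∀ (x : ι → ℂ → ℂ → ℂ) (B : ℝ), 0 ≤ B →
      (∀ j w, DifferentiableOn ℂ (fun v => x j v w) {v | (v, w) ∈ Ω}) →
      (∀ j v w, (v, w) ∈ Ω → ‖x j v w‖ ≤ B) → ∀ j w, DifferentiableOn ℂ
      (fun v => ∫ r in Ioi (0 : ℝ), halfLineIntegrand c d p x j v w r) {v | (v, w) ∈ Ω} := by
    intro x B hB0 hx hB j w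
    refine differentiableOn_integral_of_locally_dominated (hΩv w)
      (fun v hv => hcont x hx j v w hv) ?_ ?_
    · filter_upwards [ae_restrict_mem measurableSet_Ioi] with r hr
      have hmaps : MapsTo (fun v : ℂ => v + r * d j) {v | (v, w) ∈ Ω} {v | (v, w) ∈ Ω} :=
        fun v hv => hd j v w hv r (le_of_lt hr)
      have hl : DifferentiableOn ℂ (fun v : ℂ => v + r * d j) {v | (v, w) ∈ Ω} := by fun_prop
      refine DifferentiableOn.const_mul (DifferentiableOn.fun_sum fun m _ => ?_) _
      exact ((hpv j m w).comp hl hmaps).mul ((hx m w).comp hl hmaps)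
    · intro v₀ hv₀
      obtain ⟨ρ, hρ, G, hG, hGle⟩ := hdom v₀ w hv₀ j
      refine ⟨ρ, hρ, fun r => G r * B, hG.mul_const B, ?_⟩
      filter_upwards [ae_restrict_mem measurableSet_Ioi] with r hr v hv hvΩ
      exact (hle x B hB j v w hvΩ r hr).trans (mul_le_mul_of_nonneg_right
        (hGle v w hv (Metric.mem_ball_self hρ) hvΩ r hr) hB0)
  have hopw : ∀ (x : ι → ℂ → ℂ → ℂ) (B : ℝ), 0 ≤ B →
      (∀ j w, DifferentiableOn ℂ (fun v => x j v w) {v | (v, w) ∈ Ω}) →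
      (∀ j v, DifferentiableOn ℂ (fun w => x j v w) {w | (v, w) ∈ Ω}) →
      (∀ j v w, (v, w) ∈ Ω → ‖x j v w‖ ≤ B) → ∀ j v, DifferentiableOn ℂ
      (fun w => ∫ r in Ioi (0 : ℝ), halfLineIntegrand c d p x j v w r) {w | (v, w) ∈ Ω} := by
    intro x B hB0 hx hx' hB j v
    refine differentiableOn_integral_of_locally_dominated (hΩw v)
      (fun w hw => hcont x hx j v w hw) ?_ ?_
    · filter_upwards [ae_restrict_mem measurableSet_Ioi] with r hr
      have hsub : {w | (v, w) ∈ Ω} ⊆ {w | (v + r * d j, w) ∈ Ω} :=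
        fun w hw => hd j v w hw r (le_of_lt hr)
      refine DifferentiableOn.const_mul (DifferentiableOn.fun_sum fun m _ => ?_) _
      exact ((hpw j m _).mono hsub).mul ((hx' m _).mono hsub)
    · intro w₀ hw₀
      obtain ⟨ρ, hρ, G, hG, hGle⟩ := hdom v w₀ hw₀ j
      refine ⟨ρ, hρ, fun r => G r * B, hG.mul_const B, ?_⟩
      filter_upwards [ae_restrict_mem measurableSet_Ioi] with r hr w hw hwΩ
      exact (hle x B hB j v w hwΩ r hr).trans (mul_le_mul_of_nonneg_right
        (hGle v w (Metric.mem_ball_self hρ) hw hwΩ r hr) hB0)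
  rcases Ω.eq_empty_or_nonempty with hempty | ⟨⟨v₁, w₁⟩, hv₁⟩
  · exact ⟨fun _ _ _ => 0, by simp [hempty], by simp [hempty], by simp [hempty], by simp [hempty]⟩
  have hq0 : 0 ≤ q := by
    obtain ⟨G, hG, hGle, hGq⟩ := hsmall v₁ w₁ hv₁ k
    refine le_trans (mul_nonneg (norm_nonneg _) ?_) hGq
    refine setIntegral_nonneg measurableSet_Ioi fun r hr => le_trans ?_ (hGle r hr)
    exact mul_nonneg (norm_nonneg _) (Finset.sum_nonneg fun _ _ => norm_nonneg _)
  have hq1 : q < 1 := by linarith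
  set y := neumannTerm k c d p with hy
  have hyprop : ∀ N, (∀ j w, DifferentiableOn ℂ (fun v => y N j v w) {v | (v, w) ∈ Ω}) ∧
      (∀ j v, DifferentiableOn ℂ (fun w => y N j v w) {w | (v, w) ∈ Ω}) ∧
      ∀ j v w, (v, w) ∈ Ω → ‖y N j v w‖ ≤ q ^ N := by
    intro N
    induction N with
    | zero =>
      refine ⟨fun j w => differentiableOn_const _, fun j v => differentiableOn_const _, ?_⟩
      intro j v w _
      simp only [hy, neumannTerm, pow_zero]
      split_ifs <;> simp
    | succ N ih =>
      obtain ⟨h1, h2, h3⟩ := ih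
      have hqN : 0 ≤ q ^ N := pow_nonneg hq0 N
      refine ⟨fun j w => ?_, fun j v => ?_, fun j v w hvw => ?_⟩
      · exact ((hopv _ _ hqN h1 h3 j w).const_mul _).neg
      · exact ((hopw _ _ hqN h1 h2 h3 j v).const_mul _).neg
      · simp only [hy, neumannTerm, norm_neg, norm_mul]
        rw [pow_succ']
        refine le_trans ?_ (hintegrable _ _ hqN h1 h3 j v w hvw).2
        exact mul_le_mul_of_nonneg_left (norm_integral_le_integral_norm _) (norm_nonneg _)
  have hgeom : Summable fun N : ℕ => q ^ N := summable_geometric_of_lt_one hq0 hq1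
  set x : ι → ℂ → ℂ → ℂ := fun j v w => ∑' N, y N j v w with hx
  have hsum : ∀ j v w, (v, w) ∈ Ω → HasSum (fun N => y N j v w) (x j v w) := fun j v w hvw =>
    (Summable.of_norm_bounded hgeom fun N => (hyprop N).2.2 j v w hvw).hasSum
  have hxv : ∀ j w, DifferentiableOn ℂ (fun v => x j v w) {v | (v, w) ∈ Ω} := fun j w =>
    Complex.differentiableOn_tsum_of_summable_norm hgeom (fun N => (hyprop N).1 j w) (hΩv w)
      fun N v hv => (hyprop N).2.2 j v w hv
  have hxw : ∀ j v, DifferentiableOn ℂ (fun w => x j v w) {w | (v, w) ∈ Ω} := fun j v =>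
    Complex.differentiableOn_tsum_of_summable_norm hgeom (fun N => (hyprop N).2.1 j v) (hΩw v)
      fun N w hw => (hyprop N).2.2 j v w hw
  have hxB : ∀ j v w, (v, w) ∈ Ω → ‖x j v w‖ ≤ 2 := by
    intro j v w hvw
    refine (tsum_of_norm_bounded hgeom.hasSum fun N => (hyprop N).2.2 j v w hvw).trans ?_
    rw [tsum_geometric_of_lt_one hq0 hq1]
    rw [inv_le_comm₀ (by linarith) (by norm_num)]
    linarith
  have hfix : ∀ j v w, (v, w) ∈ Ω → x j v w = (if j = k then 1 else 0) -
      d j * ∫ r in Ioi (0 : ℝ), halfLineIntegrand c d p x j v w r := by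
    intro j v w hvw
    have h1 := (hasSum_nat_add_iff' 1).2 (hsum j v w hvw)
    have hint : ∀ N, IntegrableOn (halfLineIntegrand c d p (y N) j v w) (Ioi 0) ∧
        ‖d j‖ * ∫ r in Ioi (0 : ℝ), ‖halfLineIntegrand c d p (y N) j v w r‖ ≤ q * q ^ N := fun N =>
      hintegrable (y N) (q ^ N) (pow_nonneg hq0 N) (hyprop N).1 (hyprop N).2.2 j v w hvw
    have hsI : Summable fun N => ∫ r in Ioi (0 : ℝ), ‖halfLineIntegrand c d p (y N) j v w r‖ := by
      refine Summable.of_nonneg_of_le (fun N => integral_nonneg fun r => norm_nonneg _)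
        (fun N => ?_) ((hgeom.mul_left q).mul_left (‖d j‖⁻¹))
      rw [inv_mul_eq_div, le_div_iff₀ (norm_pos_iff.2 (hd0 j)), mul_comm]
      exact (hint N).2
    have h2 := MeasureTheory.hasSum_integral_of_summable_integral_norm (fun N => (hint N).1) hsI
    have h3 : ∫ r in Ioi (0 : ℝ), ∑' N, halfLineIntegrand c d p (y N) j v w r =
        ∫ r in Ioi (0 : ℝ), halfLineIntegrand c d p x j v w r := by
      refine setIntegral_congr_fun measurableSet_Ioi fun r hr => ?_
      refine HasSum.tsum_eq ?_
      simp only [halfLineIntegrand]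
      refine HasSum.mul_left _ (hasSum_sum fun m _ => HasSum.mul_left _ ?_)
      exact hsum m _ w (hd j v w hvw r (le_of_lt hr))
    rw [h3] at h2
    have h4 := (h2.mul_left (d j)).neg
    have h5 := h1.unique h4
    simp only [Finset.range_one, Finset.sum_singleton] at h5
    have h6 : y 0 j v w = if j = k then 1 else 0 := rfl
    rw [h6] at h5
    linear_combination h5
  refine ⟨x, hxv, hxw, ?_, ?_⟩
  · intro j v w hvw
    rw [hfix j v w hvw, sub_sub_cancel_left, norm_neg, norm_mul, mul_comm 2 q]
    refine le_trans ?_ (hintegrable x 2 (by norm_num) hxv hxB j v w hvw).2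
    exact mul_le_mul_of_nonneg_left (norm_integral_le_integral_norm _) (norm_nonneg _)
  · intro j v w hvw
    have hg : DifferentiableOn ℂ (fun v => ∑ m, p j m v w * x m v w) {v | (v, w) ∈ Ω} :=
      DifferentiableOn.fun_sum fun m _ => (hpv j m w).mul (hxv m w)
    have hJ := hasDerivAt_integral_halfLine (hΩv w) hg (c := c j) (hd0 j)
      (fun v hv => (hintegrable x 2 (by norm_num) hxv hxB j v w hv).1) hvw
      ((hopv x 2 (by norm_num) hxv hxB j w).differentiableAt ((hΩv w).mem_nhds hvw))
    have hev : (fun v => x j v w) =ᶠ[𝓝 v] fun v => (if j = k then 1 else 0) -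
        d j * ∫ r in Ioi (0 : ℝ), halfLineIntegrand c d p x j v w r := by
      filter_upwards [(hΩv w).mem_nhds hvw] with v hv using hfix j v w hv
    refine HasDerivAt.congr_of_eventuallyEq ?_ hev
    refine ((hJ.const_mul (d j)).const_sub _).congr_deriv ?_
    have hz : c j * (if j = k then 1 else 0) = 0 := by
      split_ifs with h
      · rw [h, hck, zero_mul]
      · rw [mul_zero]
    rw [hfix j v w hvw]
    change -(d j * (c j * (∫ r in Ioi (0 : ℝ), halfLineIntegrand c d p x j v w r) -
      (∑ m, p j m v w * x m v w) / d j)) = _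
    rw [mul_sub, mul_div_cancel₀ _ (hd0 j)]
    linear_combination -hz

end HalfLines

/-! ### Solutions in right half-planes -/

section HalfPlanes

open MeasureTheory Set Filter Topology

/-- The time `t = α √v` as a function of `v` in the right half-plane, so that `t² = α² v`. -/
def rootTime (α v : ℂ) : ℂ := α * v ^ (2⁻¹ : ℂ)

/-- Pairs `(v, w)` such that `v` lies to the right of a line whose position depends on the size of
the parameter `w`. -/
def halfPlanes (H : ℕ → ℝ) : Set (ℂ × ℂ) := {z | ∃ m : ℕ, ‖z.2‖ < m ∧ H m < z.1.re}

lemma mem_halfPlanes {H : ℕ → ℝ} {v w : ℂ} :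
    (v, w) ∈ halfPlanes H ↔ ∃ m : ℕ, ‖w‖ < m ∧ H m < v.re := Iff.rfl

lemma isOpen_halfPlanes (H : ℕ → ℝ) : IsOpen (halfPlanes H) := by
  have : halfPlanes H = ⋃ m : ℕ, {z : ℂ × ℂ | ‖z.2‖ < m ∧ H m < z.1.re} := by
    ext z
    simp [halfPlanes]
  rw [this]
  refine isOpen_iUnion fun m => IsOpen.inter ?_ ?_
  · exact isOpen_lt continuous_snd.norm continuous_const
  · exact isOpen_lt continuous_const (Complex.continuous_re.comp continuous_fst)

lemma cpow_half_sq (v : ℂ) : (v ^ (2⁻¹ : ℂ)) ^ 2 = v := by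
  simp

lemma rootTime_sq (α v : ℂ) : rootTime α v ^ 2 = α ^ 2 * v := by
  rw [rootTime, mul_pow, cpow_half_sq]

lemma rootTime_ne_zero {α v : ℂ} (hα : α ≠ 0) (hv : 0 < v.re) : rootTime α v ≠ 0 := by
  intro h
  have h1 := rootTime_sq α v
  rw [h] at h1
  have hv0 : v ≠ 0 := by
    rintro rfl
    simp at hv
  have : α ^ 2 * v ≠ 0 := mul_ne_zero (pow_ne_zero _ hα) hv0
  exact this (by rw [← h1]; norm_num)

lemma hasDerivAt_rootTime {α v : ℂ} (hα : α ≠ 0) (hv : 0 < v.re) :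
    HasDerivAt (rootTime α) (α ^ 2 / 2 * (rootTime α v)⁻¹) v := by
  have hsl : v ∈ Complex.slitPlane := Or.inl hv
  have hv0 : v ≠ 0 := Complex.slitPlane_ne_zero hsl
  have h1 : HasDerivAt (fun v : ℂ => v ^ (2⁻¹ : ℂ)) ((2⁻¹ : ℂ) * v ^ ((2⁻¹ : ℂ) - 1)) v :=
    (Complex.hasStrictDerivAt_cpow_const hsl).hasDerivAt
  refine (h1.const_mul α).congr_deriv ?_
  have hr : v ^ (2⁻¹ : ℂ) ≠ 0 := by
    intro h
    apply hv0
    rw [← cpow_half_sq v, h]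
    norm_num
  rw [Complex.cpow_sub _ _ hv0, Complex.cpow_one, rootTime]
  nth_rewrite 2 [← cpow_half_sq v]
  field_simp

lemma hasDerivAt_rootTime_inv {α v : ℂ} (hα : α ≠ 0) (hv : 0 < v.re) :
    HasDerivAt (fun v => (rootTime α v)⁻¹) (-(α ^ 2 / 2 * (rootTime α v)⁻¹ ^ 3)) v := by
  have h0 := rootTime_ne_zero hα hv
  refine ((hasDerivAt_rootTime hα hv).inv h0).congr_deriv ?_
  field_simp

lemma norm_rootTime_inv {α v : ℂ} :
    ‖(rootTime α v)⁻¹‖ = ‖α‖⁻¹ * ‖v‖ ^ (-(2⁻¹ : ℝ)) := by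
  have h1 : ‖v ^ (2⁻¹ : ℂ)‖ = ‖v‖ ^ (2⁻¹ : ℝ) := by
    refine (Real.rpow_left_injOn (x := 2) (by norm_num)).eq_iff (norm_nonneg _) (by
      change (0 : ℝ) ≤ _; positivity) |>.1 ?_
    simp only [Real.rpow_ofNat]
    rw [← norm_pow, cpow_half_sq, ← Real.rpow_natCast, ← Real.rpow_mul (norm_nonneg _)]
    norm_num
  rw [rootTime, norm_inv, norm_mul, h1, mul_inv, Real.rpow_neg (norm_nonneg _)]

/-- A uniform bound on discs for finitely many entire functions. -/
lemma exists_norm_le_of_differentiable {ι : Type*} [Finite ι] {f : ι → ℂ → ℂ}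
    (hf : ∀ i, Differentiable ℂ (f i)) (R : ℝ) :
    ∃ C : ℝ, 0 ≤ C ∧ ∀ i w, ‖w‖ ≤ R → ‖f i w‖ ≤ C := by
  have := Fintype.ofFinite ι
  have h1 : ∀ i, ∃ b : ℝ, ∀ w, ‖w‖ ≤ R → ‖f i w‖ ≤ b := by
    intro i
    obtain ⟨b, hb⟩ := (isCompact_closedBall (0 : ℂ) R).exists_bound_of_continuousOn
      (hf i).continuous.continuousOn
    exact ⟨b, fun w hw => hb w (by simpa using hw)⟩
  choose b hb using h1
  refine ⟨∑ i, |b i|, Finset.sum_nonneg fun i _ => abs_nonneg _, fun i w hw => ?_⟩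
  exact ((hb i w hw).trans (le_abs_self _)).trans
    (Finset.single_le_sum (f := fun i => |b i|) (fun i _ => abs_nonneg _) (Finset.mem_univ i))

/-- The perturbation in the `k`-th normalised system, that is, the system for
`x = exp (-Φ_k) • X`, where `X` solves the diagonalised system, in the variable `v`. It consists of
the lower order parts of `(Φ_j - Φ_k)'` on the diagonal and of the error `s³ Q`, `s = t⁻¹`; the
factor `α² / 2` is `t (dt / dv)`. -/
def halfPlanePerturbation {n : ℕ} (α : ℂ) (b ρ : Fin n → ℂ → ℂ)
    (Q : ℂ → ℂ → Matrix (Fin n) (Fin n) ℂ) (k j i : Fin n) (v w : ℂ) : ℂ :=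
  α ^ 2 / 2 * ((if j = i then (b j w - b k w) * (rootTime α v)⁻¹ +
    (ρ j w - ρ k w) * (rootTime α v)⁻¹ ^ 2 else 0) +
    (rootTime α v)⁻¹ ^ 3 * Q (rootTime α v)⁻¹ w j i)

/-- On the diagonal entry `j = k` the differences vanish, which leaves the order `s³` in row `k`. -/
lemma sum_norm_halfPlanePerturbation_le {n : ℕ} {α : ℂ} {b ρ : Fin n → ℂ → ℂ}
    {Q : ℂ → ℂ → Matrix (Fin n) (Fin n) ℂ} {v w : ℂ} {B K : ℝ}
    (hs : ‖(rootTime α v)⁻¹‖ ≤ 1) (hb : ∀ j, ‖b j w‖ ≤ B) (hρ : ∀ j, ‖ρ j w‖ ≤ B)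
    (hQ : ∀ i j, ‖Q (rootTime α v)⁻¹ w i j‖ ≤ K) (k j : Fin n) :
    ∑ i, ‖halfPlanePerturbation α b ρ Q k j i v w‖ ≤
      ‖α ^ 2 / 2‖ * (4 * B + n * K) * ‖(rootTime α v)⁻¹‖ ^ (if j = k then 3 else 1) := by
  set s := (rootTime α v)⁻¹ with hsdef
  have hB0 : 0 ≤ B := (norm_nonneg _).trans (hb j)
  have h3 : ‖s‖ ^ 3 ≤ ‖s‖ ^ (if j = k then 3 else 1) :=
    pow_le_pow_of_le_one (norm_nonneg _) hs (by split_ifs <;> norm_num)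
  have hterm : ∀ i, ‖halfPlanePerturbation α b ρ Q k j i v w‖ ≤ ‖α ^ 2 / 2‖ *
      ((if j = i then 4 * B * ‖s‖ ^ (if j = k then 3 else 1) else 0) +
        ‖s‖ ^ (if j = k then 3 else 1) * K) := by
    intro i
    rw [halfPlanePerturbation, norm_mul]
    refine mul_le_mul_of_nonneg_left ((norm_add_le _ _).trans (add_le_add ?_ ?_)) (norm_nonneg _)
    · split_ifs with hji hjk
      · rw [hjk]
        simp only [sub_self, zero_mul, add_zero, norm_zero]
        positivity
      · refine (norm_add_le _ _).trans ?_
        rw [norm_mul, norm_mul, norm_pow, pow_one]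
        have e1 : ‖b j w - b k w‖ ≤ 2 * B :=
          (norm_sub_le _ _).trans (by linarith [hb j, hb k])
        have e2 : ‖ρ j w - ρ k w‖ ≤ 2 * B :=
          (norm_sub_le _ _).trans (by linarith [hρ j, hρ k])
        have e3 : ‖s‖ ^ 2 ≤ ‖s‖ := by
          simpa using pow_le_pow_of_le_one (norm_nonneg _) hs (by norm_num : 1 ≤ 2)
        calc ‖b j w - b k w‖ * ‖s‖ + ‖ρ j w - ρ k w‖ * ‖s‖ ^ 2
            ≤ 2 * B * ‖s‖ + 2 * B * ‖s‖ := by gcongr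
          _ = 4 * B * ‖s‖ := by ring
      · simp
    · rw [norm_mul, norm_pow]
      exact mul_le_mul h3 (hQ j i) (norm_nonneg _) (by positivity)
  refine (Finset.sum_le_sum fun i _ => hterm i).trans (le_of_eq ?_)
  rw [← Finset.mul_sum, Finset.sum_add_distrib, Finset.sum_ite_eq]
  simp only [Finset.mem_univ, if_true, Finset.sum_const, Finset.card_univ, Fintype.card_fin,
    nsmul_eq_mul]
  ring

/-- The diagonalised system has, for each `k`, a solution close to the `k`-th unit vector in the
domain `halfPlanes H`. The vertical lines are preserved by integration in the directions `± i`;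
the genericity of `α` makes every exponential decay in one of the two. -/
theorem exists_halfPlane_solutions {n : ℕ} {α : ℂ} (hα : α ≠ 0) {lam : Fin n → ℂ}
    (hlam : ∀ j k, j ≠ k → (α ^ 2 / 2 * (lam j - lam k)).im ≠ 0) {b ρ : Fin n → ℂ → ℂ}
    (hb : ∀ j, Differentiable ℂ (b j)) (hρ : ∀ j, Differentiable ℂ (ρ j))
    {Q : ℂ → ℂ → Matrix (Fin n) (Fin n) ℂ} {δ K : ℕ → ℝ} (hδ : ∀ m, 0 < δ m) (hK : ∀ m, 0 ≤ K m)
    (hQK : ∀ (m : ℕ) (s w : ℂ), ‖w‖ < m → ‖s‖ < δ m → ∀ i j, ‖Q s w i j‖ ≤ K m)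
    (hQs : ∀ (m : ℕ) (s w : ℂ), ‖w‖ < m → ‖s‖ < δ m → ∀ i j,
      DifferentiableAt ℂ (fun s => Q s w i j) s)
    (hQw : ∀ (m : ℕ) (s w : ℂ), ‖w‖ < m → ‖s‖ < δ m → ∀ i j,
      DifferentiableAt ℂ (fun w => Q s w i j) w)
    {q : ℝ} (hq0 : 0 < q) (hq : q ≤ 1 / 2) :
    ∃ H : ℕ → ℝ, (∀ m, 1 ≤ H m) ∧
      (∀ (m : ℕ) (v : ℂ), H m < v.re → ‖(rootTime α v)⁻¹‖ < δ m ∧ ‖(rootTime α v)⁻¹‖ ≤ 1) ∧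
      ∀ k, ∃ x : Fin n → ℂ → ℂ → ℂ,
        (∀ j w, DifferentiableOn ℂ (fun v => x j v w) {v | (v, w) ∈ halfPlanes H}) ∧
        (∀ j v, DifferentiableOn ℂ (fun w => x j v w) {w | (v, w) ∈ halfPlanes H}) ∧
        (∀ j v w, (v, w) ∈ halfPlanes H → ‖x j v w - if j = k then 1 else 0‖ ≤ 2 * q) ∧
        ∀ j v w, (v, w) ∈ halfPlanes H → HasDerivAt (fun v => x j v w)
          (α ^ 2 / 2 * (lam j - lam k) * x j v w +
            ∑ i, halfPlanePerturbation α b ρ Q k j i v w * x i v w) v := by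
  set A₀ := ‖α‖⁻¹ with hA₀
  have hA₀pos : 0 < A₀ := inv_pos.2 (norm_pos_iff.2 hα)
  -- the majorant on vertical lines
  set f : ℝ → ℝ := fun y => (1 + ‖y‖ ^ 2) ^ (-(5 / 4 : ℝ) / 2) with hf
  have hfint : Integrable f := integrable_rpow_neg_one_add_norm_sq (by norm_num)
  have hf0 : ∀ y, 0 ≤ f y := fun y => by positivity
  set C₅ := ∫ y, f y with hC₅
  have hC₅0 : 0 ≤ C₅ := integral_nonneg hf0
  choose Bb hBb0 hBb using fun m : ℕ => exists_norm_le_of_differentiable hb m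
  choose Bρ hBρ0 hBρ using fun m : ℕ => exists_norm_le_of_differentiable hρ m
  set K₁ : ℕ → ℝ := fun m => ‖α ^ 2 / 2‖ * (4 * (Bb m + Bρ m) + n * K m) with hK₁
  have hK₁0 : ∀ m, 0 ≤ K₁ m := fun m => by
    have := hBb0 m
    have := hBρ0 m
    have := hK m
    positivity
  set κ : Fin n → Fin n → ℝ := fun j k => |(α ^ 2 / 2 * (lam j - lam k)).im| with hκ
  have hκpos : ∀ j k, j ≠ k → 0 < κ j k := fun j k hjk => abs_pos.2 (hlam j k hjk)
  have hrpow : ∀ a C : ℝ, 0 < a → Tendsto (fun h : ℝ => C * h ^ (-a)) atTop (𝓝 0) := by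
    intro a C ha
    simpa using (tendsto_rpow_neg_atTop ha).const_mul C
  have hchoice : ∀ m, ∃ h : ℝ, 1 ≤ h ∧ A₀ * h ^ (-(2⁻¹ : ℝ)) < δ m ∧
      A₀ * h ^ (-(2⁻¹ : ℝ)) < 1 ∧ K₁ m * A₀ ^ 3 * C₅ * h ^ (-(4⁻¹ : ℝ)) < q ∧
      ∀ j k, j ≠ k → K₁ m * A₀ / κ j k * h ^ (-(2⁻¹ : ℝ)) < q := by
    intro m
    refine ((eventually_ge_atTop 1).and (((hrpow 2⁻¹ _ (by norm_num)).eventually_lt_const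
      (hδ m)).and (((hrpow 2⁻¹ _ (by norm_num)).eventually_lt_const one_pos).and
      (((hrpow 4⁻¹ _ (by norm_num)).eventually_lt_const hq0).and ?_)))).exists
    refine eventually_all.2 fun j => eventually_all.2 fun k => ?_
    filter_upwards [(hrpow 2⁻¹ (K₁ m * A₀ / κ j k) (by norm_num)).eventually_lt_const hq0]
      with h hh _ using hh
  choose H hH1 hHδ hHone hHk hHjk using hchoice
  have hsle : ∀ (m : ℕ) (v : ℂ), H m < v.re →
      ‖(rootTime α v)⁻¹‖ ≤ A₀ * H m ^ (-(2⁻¹ : ℝ)) := by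
    intro m v hv
    rw [norm_rootTime_inv]
    refine mul_le_mul_of_nonneg_left ?_ hA₀pos.le
    refine Real.rpow_le_rpow_of_nonpos (by linarith [hH1 m]) ?_ (by norm_num)
    exact hv.le.trans ((le_abs_self _).trans (Complex.abs_re_le_norm v))
  have hsδ : ∀ (m : ℕ) (v : ℂ), H m < v.re →
      ‖(rootTime α v)⁻¹‖ < δ m ∧ ‖(rootTime α v)⁻¹‖ ≤ 1 := fun m v hv =>
    ⟨(hsle m v hv).trans_lt (hHδ m), (hsle m v hv).trans (hHone m).le⟩
  refine ⟨H, hH1, hsδ, fun k => ?_⟩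
  set c : Fin n → ℂ := fun j => α ^ 2 / 2 * (lam j - lam k) with hc
  -- the direction in which `Re (c j * d j) = |Im (c j)|`
  set d : Fin n → ℂ := fun j => if (c j).im < 0 then Complex.I else -Complex.I with hd
  have hdre : ∀ j, (d j).re = 0 := fun j => by simp only [hd]; split_ifs <;> simp
  have hdnorm : ∀ j, ‖d j‖ = 1 := fun j => by simp only [hd]; split_ifs <;> simp
  have hd0 : ∀ j, d j ≠ 0 := fun j => by
    rw [← norm_pos_iff, hdnorm]
    exact one_pos
  have hdk : d k = -Complex.I := by simp [hd, hc]
  have hexp : ∀ j (r : ℝ), ‖Complex.exp (-(c j * d j * r))‖ = Real.exp (-(κ j k) * r) := by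
    intro j r
    rw [Complex.norm_exp]
    congr 1
    have : (c j * d j).re = κ j k := by
      have h1 : κ j k = |(c j).im| := rfl
      rw [h1]
      simp only [hd]
      split_ifs with h
      · rw [abs_of_neg h]
        simp
      · rw [abs_of_nonneg (not_lt.1 h)]
        simp
    rw [Complex.neg_re, Complex.re_mul_ofReal, this, neg_mul]
  have hshift : ∀ j (v : ℂ) (r : ℝ), (v + r * d j).re = v.re := by
    intro j v r
    rw [Complex.add_re, Complex.re_ofReal_mul, hdre, mul_zero, add_zero]
  have hpsum : ∀ (m : ℕ) (v w : ℂ), ‖w‖ < m → H m < v.re → ∀ j,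
      ∑ i, ‖halfPlanePerturbation α b ρ Q k j i v w‖ ≤
        K₁ m * ‖(rootTime α v)⁻¹‖ ^ (if j = k then 3 else 1) := by
    intro m v w hw hv j
    refine sum_norm_halfPlanePerturbation_le (hsδ m v hv).2 (fun j => ?_) (fun j => ?_)
      (fun i j => hQK m _ w hw (hsδ m v hv).1 i j) k j
    · exact (hBb m j w hw.le).trans (by linarith [hBρ0 m])
    · exact (hBρ m j w hw.le).trans (by linarith [hBb0 m])
  -- majorants of the integrands for `j ≠ k` and `j = k`
  have hmajor_ne : ∀ (m : ℕ) (v w : ℂ), ‖w‖ < m → H m < v.re → ∀ j, j ≠ k → ∀ r : ℝ,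
      ‖Complex.exp (-(c j * d j * r))‖ *
        ∑ i, ‖halfPlanePerturbation α b ρ Q k j i (v + r * d j) w‖ ≤
      K₁ m * (A₀ * H m ^ (-(2⁻¹ : ℝ))) * Real.exp (-(κ j k) * r) := by
    intro m v w hw hv j hjk r
    have hv' : H m < (v + r * d j).re := by rwa [hshift]
    rw [hexp, mul_comm]
    refine mul_le_mul_of_nonneg_right ?_ (Real.exp_pos _).le
    refine (hpsum m _ w hw hv' j).trans ?_
    rw [if_neg hjk, pow_one]
    exact mul_le_mul_of_nonneg_left (hsle m _ hv') (hK₁0 m)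
  have hmajor_eq : ∀ (m : ℕ) (v w : ℂ), ‖w‖ < m → H m < v.re → ∀ r : ℝ,
      ‖Complex.exp (-(c k * d k * r))‖ *
        ∑ i, ‖halfPlanePerturbation α b ρ Q k k i (v + r * d k) w‖ ≤
      K₁ m * A₀ ^ 3 * H m ^ (-(4⁻¹ : ℝ)) * f (v.im - r) := by
    intro m v w hw hv r
    have hv' : H m < (v + r * d k).re := by rwa [hshift]
    have hκ0 : κ k k = 0 := by simp [hκ]
    rw [hexp, hκ0]
    simp only [neg_zero, zero_mul, Real.exp_zero, one_mul]
    refine (hpsum m _ w hw hv' k).trans ?_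
    rw [if_pos rfl, norm_rootTime_inv]
    set N := ‖v + r * d k‖ with hN
    have hHN : H m ≤ N := hv'.le.trans ((le_abs_self _).trans (Complex.abs_re_le_norm _))
    have hH1m := hH1 m
    have hN0 : 0 ≤ N := norm_nonneg _
    have hNsq : N ^ 2 = v.re ^ 2 + (v.im - r) ^ 2 := by
      rw [hN, Complex.sq_norm, Complex.normSq_apply, hshift, hdk]
      simp
      ring
    -- `N ^ (-3 / 2)` is split into a power that is small for large `H m` and an integrable one
    have e1 : (N ^ (-(2⁻¹ : ℝ))) ^ 3 = N ^ (-(4⁻¹ : ℝ)) * (N ^ 2) ^ (-(5 / 4 : ℝ) / 2) := by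
      rw [← Real.rpow_natCast, ← Real.rpow_natCast, ← Real.rpow_mul hN0, ← Real.rpow_mul hN0,
        ← Real.rpow_add (by linarith)]
      norm_num
    have hK₁m := hK₁0 m
    suffices e2 : N ^ (-(4⁻¹ : ℝ)) * (N ^ 2) ^ (-(5 / 4 : ℝ) / 2) ≤
        H m ^ (-(4⁻¹ : ℝ)) * f (v.im - r) by
      calc K₁ m * (A₀ * N ^ (-(2⁻¹ : ℝ))) ^ 3 = K₁ m * A₀ ^ 3 * (N ^ (-(2⁻¹ : ℝ))) ^ 3 := by ring
        _ ≤ K₁ m * A₀ ^ 3 * (H m ^ (-(4⁻¹ : ℝ)) * f (v.im - r)) := by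
            rw [e1]
            gcongr
        _ = _ := by ring
    refine mul_le_mul ?_ ?_ (by positivity) (by positivity)
    · exact Real.rpow_le_rpow_of_nonpos (by linarith) hHN (by norm_num)
    · refine Real.rpow_le_rpow_of_nonpos (by positivity) ?_ (by norm_num)
      rw [hNsq, Real.norm_eq_abs, sq_abs]
      nlinarith
  refine exists_solution_near_unit_vector (isOpen_halfPlanes H) k c d hd0 (by simp [hc]) ?_
    (halfPlanePerturbation α b ρ Q k) ?_ ?_ ?_ q hq ?_
  · rintro j v w ⟨m, hw, hv⟩ r -
    exact ⟨m, hw, by simpa only [hshift] using hv⟩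
  · rintro j i w v ⟨m, hw, hv⟩
    have hs : DifferentiableAt ℂ (fun v => (rootTime α v)⁻¹) v :=
      (hasDerivAt_rootTime_inv hα (by linarith [hH1 m, show H m < v.re from hv])).differentiableAt
    have hQ : DifferentiableAt ℂ (fun v => Q (rootTime α v)⁻¹ w j i) v :=
      DifferentiableAt.comp (g := fun s => Q s w j i) v (hQs m _ w hw (hsδ m v hv).1 j i) hs
    refine DifferentiableAt.differentiableWithinAt ?_
    refine DifferentiableAt.const_mul (DifferentiableAt.add ?_ ((hs.pow 3).mul hQ)) _
    split_ifs
    · exact (hs.const_mul _).add ((hs.pow 2).const_mul _)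
    · exact differentiableAt_const _
  · rintro j i v w ⟨m, hw, hv⟩
    refine DifferentiableAt.differentiableWithinAt ?_
    refine DifferentiableAt.const_mul (DifferentiableAt.add ?_
      ((hQw m _ w hw (hsδ m v hv).1 j i).const_mul _)) _
    split_ifs
    · exact (((hb j w).sub (hb k w)).mul_const _).add (((hρ j w).sub (hρ k w)).mul_const _)
    · exact differentiableAt_const _
  · rintro v₀ w₀ ⟨m, hw₀, hv₀⟩ j
    change ‖w₀‖ < m at hw₀
    change H m < v₀.re at hv₀
    set ε := min 1 (min (v₀.re - H m) (m - ‖w₀‖)) with hε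
    have hε0 : 0 < ε := lt_min one_pos (lt_min (by linarith) (by linarith))
    have hball : ∀ v w, v ∈ Metric.ball v₀ ε → w ∈ Metric.ball w₀ ε →
        ‖w‖ < m ∧ H m < v.re ∧ |v.im - v₀.im| ≤ 1 := by
      intro v w hv hw
      rw [mem_ball_iff_norm] at hv hw
      have e1 : ε ≤ v₀.re - H m := (min_le_right _ _).trans (min_le_left _ _)
      have e2 : ε ≤ m - ‖w₀‖ := (min_le_right _ _).trans (min_le_right _ _)
      have e3 : ε ≤ 1 := min_le_left _ _
      have e4 := abs_le.1 ((Complex.abs_re_le_norm (v - v₀)).trans hv.le)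
      have e5 := (Complex.abs_im_le_norm (v - v₀)).trans hv.le
      have e6 := norm_sub_norm_le w w₀
      rw [Complex.sub_re] at e4
      rw [Complex.sub_im] at e5
      refine ⟨by linarith, ?_, by linarith⟩
      have e7 := (abs_lt.1 ((Complex.abs_re_le_norm (v - v₀)).trans_lt hv)).1
      rw [Complex.sub_re] at e7
      linarith
    by_cases hjk : j = k
    · subst hjk
      refine ⟨ε, hε0, fun r => K₁ m * A₀ ^ 3 * H m ^ (-(4⁻¹ : ℝ)) *
        (3 ^ ((5 / 4 : ℝ) / 2) * f (v₀.im - r)), ?_, ?_⟩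
      · exact (((hfint.comp_sub_left v₀.im).const_mul _).const_mul _).integrableOn
      · intro v w hv hw _ r _
        obtain ⟨h1, h2, h3⟩ := hball v w hv hw
        refine (hmajor_eq m v w h1 h2 r).trans ?_
        have hH1m := hH1 m
        have hK₁m := hK₁0 m
        refine mul_le_mul_of_nonneg_left ?_ (by positivity)
        simp only [hf, Real.norm_eq_abs, sq_abs]
        have e1 : (1 + (v₀.im - r) ^ 2) / 3 ≤ 1 + (v.im - r) ^ 2 := by
          have := sq_abs (v.im - v₀.im)
          nlinarith [sq_nonneg (2 * (v.im - r) - (v₀.im - r)), abs_nonneg (v.im - v₀.im),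
            sq_nonneg (v.im - r - 2 * (v₀.im - r))]
        refine (Real.rpow_le_rpow_of_nonpos (by positivity) e1 (by norm_num)).trans (le_of_eq ?_)
        rw [Real.div_rpow (by positivity) (by norm_num), div_eq_mul_inv, mul_comm,
          ← Real.rpow_neg (by norm_num)]
        norm_num
    · refine ⟨ε, hε0, fun r => K₁ m * (A₀ * H m ^ (-(2⁻¹ : ℝ))) * Real.exp (-(κ j k) * r),
        (exp_neg_integrableOn_Ioi 0 (hκpos j k hjk)).const_mul _, ?_⟩
      intro v w hv hw _ r _
      obtain ⟨h1, h2, -⟩ := hball v w hv hw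
      exact hmajor_ne m v w h1 h2 j hjk r
  · rintro v w ⟨m, hw, hv⟩ j
    change ‖w‖ < m at hw
    change H m < v.re at hv
    have hH1m := hH1 m
    have hK₁m := hK₁0 m
    by_cases hjk : j = k
    · subst hjk
      have hfv := hfint.comp_sub_left v.im
      refine ⟨fun r => K₁ m * A₀ ^ 3 * H m ^ (-(4⁻¹ : ℝ)) * f (v.im - r),
        (hfv.const_mul _).integrableOn, fun r _ => hmajor_eq m v w hw hv r, ?_⟩
      rw [hdnorm, one_mul, integral_const_mul]
      have e1 : ∫ r in Ioi (0 : ℝ), f (v.im - r) ≤ C₅ := by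
        rw [hC₅, ← integral_sub_left_eq_self f volume v.im]
        exact setIntegral_le_integral hfv (Eventually.of_forall fun r => hf0 _)
      calc _ ≤ K₁ m * A₀ ^ 3 * H m ^ (-(4⁻¹ : ℝ)) * C₅ := by gcongr
        _ = K₁ m * A₀ ^ 3 * C₅ * H m ^ (-(4⁻¹ : ℝ)) := by ring
        _ ≤ q := (hHk m).le
    · refine ⟨fun r => K₁ m * (A₀ * H m ^ (-(2⁻¹ : ℝ))) * Real.exp (-(κ j k) * r),
        (exp_neg_integrableOn_Ioi 0 (hκpos j k hjk)).const_mul _,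
        fun r _ => hmajor_ne m v w hw hv j hjk r, ?_⟩
      rw [hdnorm, one_mul, integral_const_mul,
        integral_exp_mul_Ioi (by linarith [hκpos j k hjk]) 0]
      have hκ0 := (hκpos j k hjk).ne'
      calc _ = K₁ m * A₀ / κ j k * H m ^ (-(2⁻¹ : ℝ)) := by
            simp only [mul_zero, Real.exp_zero]
            field_simp
        _ ≤ q := (hHjk m j k hjk).le

end HalfPlanes

/-! ### The operator in normal order -/

/-- The operator `∂_t` on smooth functions. -/
def opT : Module.End ℂ Smooth := (-Complex.I) • opD

lemma opD_eq : opD = Complex.I • opT := by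
  rw [opT, smul_smul, mul_neg, Complex.I_mul_I, neg_neg, one_smul]

lemma opT_apply (f : Smooth) (t : ℝ) : (opT f).1 t = deriv f.1 t := by
  change -Complex.I * (Complex.I * deriv f.1 t) = _
  rw [← mul_assoc, neg_mul, Complex.I_mul_I, neg_neg, one_mul]

lemma opT_pow_apply (j : ℕ) (f : Smooth) : ((opT ^ j) f).1 = iteratedDeriv j f.1 := by
  induction j with
  | zero => simp
  | succ j ih =>
    rw [iteratedDeriv_succ, pow_succ', Module.End.mul_apply, ← ih]
    funext t
    exact opT_apply _ t

lemma opM_pow_apply (a : ℕ) (f : Smooth) (t : ℝ) : ((opM ^ a) f).1 t = (t : ℂ) ^ a * f.1 t := by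
  induction a with
  | zero => simp
  | succ a ih =>
    rw [pow_succ', Module.End.mul_apply]
    change (t : ℂ) * ((opM ^ a) f).1 t = _
    rw [ih]
    ring

lemma opT_mul_opM : opT * opM = opM * opT + 1 := by
  ext f t
  have hf : DifferentiableAt ℝ f.1 t := (contDiff_infty_iff_deriv.1 f.2).1 t
  change (opT (opM f)).1 t = (t : ℂ) * (opT f).1 t + f.1 t
  rw [opT_apply, opT_apply]
  have h1 : HasDerivAt (fun t : ℝ => (t : ℂ) * f.1 t) (1 * f.1 t + t * deriv f.1 t) t :=
    (Complex.ofRealCLM.hasDerivAt (x := t)).mul hf.hasDerivAt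
  refine h1.deriv.trans ?_
  ring

lemma opT_mul_opM_pow (a : ℕ) : opT * opM ^ a = opM ^ a * opT + (a : ℂ) • opM ^ (a - 1) := by
  induction a with
  | zero => simp
  | succ a ih =>
    rw [pow_succ, ← mul_assoc, ih, add_mul, mul_assoc, opT_mul_opM, mul_add, mul_one,
      Nat.add_sub_cancel]
    rcases a with _ | a
    · simp
    · rw [Nat.add_sub_cancel, smul_mul_assoc, ← pow_succ, ← mul_assoc]
      push_cast
      module

/-- The operator with full symbol `F`: the monomial `t ^ a ξ ^ j` is sent to `t ^ a ∂_t ^ j`. -/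
def symbolOp : MvPolynomial (Fin 2) ℂ →ₗ[ℂ] Module.End ℂ Smooth :=
  (MvPolynomial.basisMonomials (Fin 2) ℂ).constr ℂ fun s => opM ^ (s 0) * opT ^ (s 1)

lemma symbolOp_monomial (s : Fin 2 →₀ ℕ) :
    symbolOp (MvPolynomial.monomial s 1) = opM ^ (s 0) * opT ^ (s 1) := by
  have := (MvPolynomial.basisMonomials (Fin 2) ℂ).constr_basis ℂ
    (fun s => opM ^ (s 0) * opT ^ (s 1)) s
  rwa [MvPolynomial.coe_basisMonomials] at this

lemma symbolOp_one : symbolOp 1 = 1 := by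
  simpa using symbolOp_monomial 0

lemma symM_apply (F : MvPolynomial (Fin 2) ℂ) : symM F = MvPolynomial.X 0 * F := rfl

lemma symD_apply (F : MvPolynomial (Fin 2) ℂ) :
    symD F = Complex.I • (MvPolynomial.pderiv 0 F + MvPolynomial.X 1 * F) := rfl

lemma symbolOp_symM (F : MvPolynomial (Fin 2) ℂ) : symbolOp (symM F) = opM * symbolOp F := by
  have : symbolOp ∘ₗ symM = LinearMap.mulLeft ℂ opM ∘ₗ symbolOp := by
    refine (MvPolynomial.basisMonomials (Fin 2) ℂ).ext fun s => ?_
    rw [MvPolynomial.coe_basisMonomials, LinearMap.comp_apply, LinearMap.comp_apply, symM_apply,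
      LinearMap.mulLeft_apply]
    rw [MvPolynomial.X, MvPolynomial.monomial_mul, one_mul, symbolOp_monomial, symbolOp_monomial]
    simp only [Finsupp.add_apply, Finsupp.single_apply]
    simp [pow_add, mul_assoc]
  exact LinearMap.congr_fun this F

lemma symbolOp_symD (F : MvPolynomial (Fin 2) ℂ) : symbolOp (symD F) = opD * symbolOp F := by
  have : symbolOp ∘ₗ symD = LinearMap.mulLeft ℂ opD ∘ₗ symbolOp := by
    refine (MvPolynomial.basisMonomials (Fin 2) ℂ).ext fun s => ?_
    rw [MvPolynomial.coe_basisMonomials, LinearMap.comp_apply, LinearMap.comp_apply, symD_apply,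
      LinearMap.mulLeft_apply]
    rw [map_smul, opD_eq, smul_mul_assoc]
    congr 1
    rw [MvPolynomial.pderiv_monomial, one_mul, MvPolynomial.X, MvPolynomial.monomial_mul, one_mul,
      map_add, symbolOp_monomial, symbolOp_monomial, ← mul_assoc, opT_mul_opM_pow, add_mul,
      ← mul_one ((s 0 : ℂ)), ← smul_eq_mul, ← MvPolynomial.smul_monomial, map_smul,
      symbolOp_monomial, add_comm]
    simp only [Finsupp.add_apply, Finsupp.single_apply, Finsupp.tsub_apply]
    simp [pow_add, mul_assoc]
  exact LinearMap.congr_fun this F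

/-- Normal ordering: an operator is determined by its full symbol. -/
lemma quantize_eq_symbolOp (p : NCPoly) : quantize p = symbolOp (fullSymbol p) := by
  have key : ∀ F, symbolOp (FreeAlgebra.lift ℂ ![symD, symM] p F) = quantize p * symbolOp F := by
    induction p using FreeAlgebra.induction with
    | grade0 c =>
      intro F
      simp [quantize, Algebra.algebraMap_eq_smul_one]
    | grade1 i =>
      intro F
      rw [quantize, FreeAlgebra.lift_ι_apply, FreeAlgebra.lift_ι_apply]
      fin_cases i
      · exact symbolOp_symD F
      · exact symbolOp_symM F
    | mul a b ha hb =>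
      intro F
      rw [map_mul, Module.End.mul_apply, ha, hb, quantize, quantize, quantize, map_mul, mul_assoc]
    | add a b ha hb =>
      intro F
      rw [map_add, LinearMap.add_apply, map_add, ha, hb, quantize, quantize, quantize, map_add,
        add_mul]
  have := key 1
  rw [symbolOp_one, mul_one] at this
  exact this.symm

/-- The shape of the full symbol of a homogeneous `p` of degree `l`: its monomials have degrees
`l, l - 2, l - 4, …`, and the part of degree `l` is the commutative polynomial. -/
structure IsHomogSymbol (l : ℕ) (p : NCPoly) : Prop where
  degree_le : ∀ s, (fullSymbol p).coeff s ≠ 0 → s 0 + s 1 ≤ l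
  parity : ∀ s, (fullSymbol p).coeff s ≠ 0 → (s 0 + s 1) % 2 = l % 2
  top : ∀ s, s 0 + s 1 = l → (fullSymbol p).coeff s = (evalAtOne p).coeff (s 1)
  natDegree_le : (evalAtOne p).natDegree ≤ l
  evalAtZero_eq : evalAtZero p = Polynomial.C ((evalAtOne p).coeff l) * Polynomial.X ^ l

lemma fullSymbol_add (p q : NCPoly) : fullSymbol (p + q) = fullSymbol p + fullSymbol q := by
  simp [fullSymbol]

lemma evalAtOne_add (p q : NCPoly) : evalAtOne (p + q) = evalAtOne p + evalAtOne q := by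
  simp [evalAtOne]

lemma evalAtZero_add (p q : NCPoly) : evalAtZero (p + q) = evalAtZero p + evalAtZero q := by
  simp [evalAtZero]

lemma IsHomogSymbol.add {l : ℕ} {p q : NCPoly} (hp : IsHomogSymbol l p)
    (hq : IsHomogSymbol l q) : IsHomogSymbol l (p + q) := by
  have hne : ∀ s, (fullSymbol (p + q)).coeff s ≠ 0 →
      (fullSymbol p).coeff s ≠ 0 ∨ (fullSymbol q).coeff s ≠ 0 := by
    intro s hs
    by_contra! h
    rw [fullSymbol_add, MvPolynomial.coeff_add, h.1, h.2, add_zero] at hs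
    exact hs rfl
  refine ⟨fun s hs => ?_, fun s hs => ?_, fun s hs => ?_, ?_, ?_⟩
  · exact (hne s hs).elim (hp.degree_le s) (hq.degree_le s)
  · exact (hne s hs).elim (hp.parity s) (hq.parity s)
  · rw [fullSymbol_add, evalAtOne_add, MvPolynomial.coeff_add, Polynomial.coeff_add, hp.top s hs,
      hq.top s hs]
  · rw [evalAtOne_add]
    exact Polynomial.natDegree_add_le_of_degree_le hp.natDegree_le hq.natDegree_le
  · rw [evalAtOne_add, evalAtZero_add, hp.evalAtZero_eq, hq.evalAtZero_eq, Polynomial.coeff_add,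
      Polynomial.C_add, add_mul]

lemma fullSymbol_smul (c : ℂ) (p : NCPoly) : fullSymbol (c • p) = c • fullSymbol p := by
  simp [fullSymbol]

lemma evalAtOne_smul (c : ℂ) (p : NCPoly) : evalAtOne (c • p) = c • evalAtOne p := by
  simp [evalAtOne]

lemma evalAtZero_smul (c : ℂ) (p : NCPoly) : evalAtZero (c • p) = c • evalAtZero p := by
  simp [evalAtZero]

lemma IsHomogSymbol.smul {l : ℕ} {p : NCPoly} (hp : IsHomogSymbol l p) (c : ℂ) :
    IsHomogSymbol l (c • p) := by
  have hne : ∀ s, (fullSymbol (c • p)).coeff s ≠ 0 → (fullSymbol p).coeff s ≠ 0 := by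
    intro s hs h
    rw [fullSymbol_smul, MvPolynomial.coeff_smul, h, smul_zero] at hs
    exact hs rfl
  refine ⟨fun s hs => hp.degree_le s (hne s hs), fun s hs => hp.parity s (hne s hs),
    fun s hs => ?_, ?_, ?_⟩
  · rw [fullSymbol_smul, evalAtOne_smul, MvPolynomial.coeff_smul, Polynomial.coeff_smul,
      hp.top s hs]
  · rw [evalAtOne_smul]
    exact (Polynomial.natDegree_smul_le _ _).trans hp.natDegree_le
  · rw [evalAtOne_smul, evalAtZero_smul, hp.evalAtZero_eq, Polynomial.coeff_smul,
      Polynomial.smul_eq_C_mul, smul_eq_mul, Polynomial.C_mul, mul_assoc]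

lemma IsHomogSymbol.X_mul {l : ℕ} {p : NCPoly} (hp : IsHomogSymbol l p) :
    IsHomogSymbol (l + 1) (FreeAlgebra.ι ℂ 0 * p) := by
  have h1 : fullSymbol (FreeAlgebra.ι ℂ 0 * p) = symD (fullSymbol p) := by
    simp [fullSymbol]
  have h2 : evalAtOne (FreeAlgebra.ι ℂ 0 * p) =
      Polynomial.C Complex.I * Polynomial.X * evalAtOne p := by
    simp [evalAtOne]
  have h3 : evalAtZero (FreeAlgebra.ι ℂ 0 * p) =
      Polynomial.C Complex.I * Polynomial.X * evalAtZero p := by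
    simp [evalAtZero]
  have hcoeff : ∀ s, (fullSymbol (FreeAlgebra.ι ℂ 0 * p)).coeff s = Complex.I *
      ((fullSymbol p).coeff (s + Finsupp.single 0 1) * (s 0 + 1) +
        if 1 ∈ s.support then (fullSymbol p).coeff (s - Finsupp.single 1 1) else 0) := by
    intro s
    rw [h1, symD_apply, MvPolynomial.coeff_smul, MvPolynomial.coeff_add, MvPolynomial.coeff_pderiv,
      MvPolynomial.coeff_X_mul', smul_eq_mul]
  have hne : ∀ s, (fullSymbol (FreeAlgebra.ι ℂ 0 * p)).coeff s ≠ 0 →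
      (fullSymbol p).coeff (s + Finsupp.single 0 1) ≠ 0 ∨
        (1 ≤ s 1 ∧ (fullSymbol p).coeff (s - Finsupp.single 1 1) ≠ 0) := by
    intro s hs
    by_contra! h
    apply hs
    rw [hcoeff, h.1, zero_mul, zero_add]
    split_ifs with h0
    · rw [h.2 (Nat.one_le_iff_ne_zero.2 (Finsupp.mem_support_iff.1 h0)), mul_zero]
    · rw [mul_zero]
  refine ⟨fun s hs => ?_, fun s hs => ?_, fun s hs => ?_, ?_, ?_⟩
  · rcases hne s hs with h | ⟨h0, h⟩
    · have := hp.degree_le _ h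
      simp at this
      omega
    · have := hp.degree_le _ h
      simp at this
      omega
  · rcases hne s hs with h | ⟨h0, h⟩
    · have := hp.parity _ h
      simp at this
      omega
    · have := hp.parity _ h
      simp at this
      omega
  · have hz : (fullSymbol p).coeff (s + Finsupp.single 0 1) = 0 := by
      by_contra h
      have := hp.degree_le _ h
      simp at this
      omega
    rw [hcoeff, hz, zero_mul, zero_add, h2, mul_assoc, Polynomial.coeff_C_mul]
    congr 1
    rcases hs1 : s 1 with _ | j
    · rw [if_neg (by simp [hs1])]
      simp
    · rw [if_pos (by simp [hs1]), hp.top _ (by simp; omega), Polynomial.coeff_X_mul]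
      simp [hs1]
  · rw [h2, mul_assoc]
    refine (Polynomial.natDegree_C_mul_le _ _).trans ?_
    refine Polynomial.natDegree_mul_le.trans ?_
    rw [Polynomial.natDegree_X]
    linarith [hp.natDegree_le]
  · rw [h2, h3, hp.evalAtZero_eq, mul_assoc, mul_assoc, Polynomial.coeff_C_mul,
      Polynomial.coeff_X_mul, Polynomial.C_mul]
    ring

lemma IsHomogSymbol.Y_mul {l : ℕ} {p : NCPoly} (hp : IsHomogSymbol l p) :
    IsHomogSymbol (l + 1) (FreeAlgebra.ι ℂ 1 * p) := by
  have h1 : fullSymbol (FreeAlgebra.ι ℂ 1 * p) = symM (fullSymbol p) := by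
    simp [fullSymbol]
  have h2 : evalAtOne (FreeAlgebra.ι ℂ 1 * p) = evalAtOne p := by
    simp [evalAtOne]
  have h3 : evalAtZero (FreeAlgebra.ι ℂ 1 * p) = 0 := by
    simp [evalAtZero]
  have hcoeff : ∀ s, (fullSymbol (FreeAlgebra.ι ℂ 1 * p)).coeff s =
      if 0 ∈ s.support then (fullSymbol p).coeff (s - Finsupp.single 0 1) else 0 := by
    intro s
    rw [h1, symM_apply, MvPolynomial.coeff_X_mul']
  have hne : ∀ s, (fullSymbol (FreeAlgebra.ι ℂ 1 * p)).coeff s ≠ 0 →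
        1 ≤ s 0 ∧ (fullSymbol p).coeff (s - Finsupp.single 0 1) ≠ 0 := by
    intro s hs
    rw [hcoeff] at hs
    split_ifs at hs with h
    · exact ⟨Nat.one_le_iff_ne_zero.2 (Finsupp.mem_support_iff.1 h), hs⟩
    · exact absurd rfl hs
  have hlast : (evalAtOne p).coeff (l + 1) = 0 :=
    Polynomial.coeff_eq_zero_of_natDegree_lt (Nat.lt_succ_of_le hp.natDegree_le)
  refine ⟨fun s hs => ?_, fun s hs => ?_, fun s hs => ?_, ?_, ?_⟩
  · obtain ⟨h0, h⟩ := hne s hs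
    have := hp.degree_le _ h
    simp at this
    omega
  · obtain ⟨h0, h⟩ := hne s hs
    have := hp.parity _ h
    simp at this
    omega
  · rw [hcoeff, h2]
    split_ifs with h
    · have h0 : s 0 ≠ 0 := Finsupp.mem_support_iff.1 h
      rw [hp.top _ (by simp; omega)]
      simp
    · have h0 : s 0 = 0 := by simpa using h
      rw [h0, zero_add] at hs
      rw [hs, hlast]
  · rw [h2]
    exact hp.natDegree_le.trans (Nat.le_succ l)
  · rw [h2, h3, hlast, Polynomial.C_0, zero_mul]

lemma IsHomog.isHomogSymbol {l : ℕ} {p : NCPoly} (hp : IsHomog l p) : IsHomogSymbol l p := by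
  unfold IsHomog at hp
  induction hp using Submodule.pow_induction_on_left' with
  | algebraMap c =>
    rw [Algebra.algebraMap_eq_smul_one]
    refine IsHomogSymbol.smul ⟨fun s hs => ?_, fun s hs => ?_, fun s hs => ?_, ?_, ?_⟩ c
    · have hs0 : s = 0 := by
        by_contra h
        simp [fullSymbol, MvPolynomial.coeff_one, Ne.symm h] at hs
      simp [hs0]
    · have hs0 : s = 0 := by
        by_contra h
        simp [fullSymbol, MvPolynomial.coeff_one, Ne.symm h] at hs
      simp [hs0]
    · have hs0 : s = 0 := by
        ext i
        fin_cases i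
        · simp; omega
        · simp; omega
      simp [fullSymbol, evalAtOne, hs0]
    · simp [evalAtOne]
    · simp [evalAtOne, evalAtZero]
  | add x y i hx hy h1 h2 => exact h1.add h2
  | mem_mul m hm i x hx ih =>
    induction hm using Submodule.span_induction with
    | mem m hm =>
      obtain ⟨a, rfl⟩ := hm
      fin_cases a
      · exact ih.X_mul
      · exact ih.Y_mul
    | zero =>
      rw [zero_mul]
      simpa using ih.X_mul.smul 0
    | add a b _ _ ha hb =>
      rw [add_mul]
      exact ha.add hb
    | smul c a _ ha =>
      rw [smul_mul_assoc]
      exact ha.smul c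

lemma coefTD_ne_zero {l : ℕ} {p : NCPoly} (hp : IsHomog l p) {a j : ℕ} (h : coefTD p a j ≠ 0) :
    a + j ≤ l ∧ (a + j) % 2 = l % 2 := by
  have h1 := hp.isHomogSymbol.degree_le _ h
  have h2 := hp.isHomogSymbol.parity _ h
  simp at h1 h2
  exact ⟨h1, h2⟩

lemma coefTD_top {l : ℕ} {p : NCPoly} (hp : IsHomog l p) {a j : ℕ} (h : a + j = l) :
    coefTD p a j = (evalAtOne p).coeff j := by
  have := hp.isHomogSymbol.top (Finsupp.single 0 a + Finsupp.single 1 j) (by simpa using h)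
  rw [coefTD, this]
  simp

/-- A polynomial of bounded degree as a double sum over its monomials. -/
lemma eq_sum_monomial {F : MvPolynomial (Fin 2) ℂ} {n : ℕ}
    (hF : ∀ s, F.coeff s ≠ 0 → s 0 + s 1 ≤ n) :
    F = ∑ j ∈ Finset.range (n + 1), ∑ a ∈ Finset.range (n + 1),
      F.coeff (Finsupp.single 0 a + Finsupp.single 1 j) •
        MvPolynomial.monomial (Finsupp.single 0 a + Finsupp.single 1 j) 1 := by
  have hs : ∀ s : Fin 2 →₀ ℕ, s = Finsupp.single 0 (s 0) + Finsupp.single 1 (s 1) := by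
    intro s
    ext i
    fin_cases i <;> simp
  ext s
  simp only [MvPolynomial.coeff_sum, MvPolynomial.coeff_smul, MvPolynomial.coeff_monomial,
    smul_eq_mul, mul_ite, mul_one, mul_zero]
  have hiff : ∀ a j : ℕ, Finsupp.single 0 a + Finsupp.single 1 j = s ↔ s 0 = a ∧ s 1 = j := by
    intro a j
    constructor
    · rintro rfl
      simp
    · rintro ⟨rfl, rfl⟩
      exact (hs s).symm
  simp only [hiff, ite_and, Finset.sum_ite_eq, Finset.sum_ite_irrel, Finset.sum_const_zero,
    Finset.mem_range]
  by_cases h : F.coeff s = 0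
  · rw [← hs s, h]
    simp
  · have := hF s h
    rw [if_pos (by omega), if_pos (by omega), ← hs s]

/-- The coefficient of `∂_t ^ j` in `𝓛_γ`, as a function of `t` and `w = γ⁻¹`. -/
def odeCoef (n : ℕ) (P : ℕ → NCPoly) (j : ℕ) (t w : ℂ) : ℂ :=
  ∑ l ∈ Finset.range (n + 1), ∑ a ∈ Finset.range (n + 1), w ^ (n - l) * coefTD (P l) a j * t ^ a

lemma opL_apply {n : ℕ} {P : ℕ → NCPoly} (hP : ∀ l, l ≤ n → IsHomog l (P l)) (γ : ℂ)
    (f : Smooth) (t : ℝ) : (opL n P γ f).1 t =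
      ∑ j ∈ Finset.range (n + 1), odeCoef n P j t γ⁻¹ * iteratedDeriv j f.1 t := by
  have h1 : ∀ l ∈ Finset.range (n + 1), (quantize (P l) f).1 t = ∑ j ∈ Finset.range (n + 1),
      ∑ a ∈ Finset.range (n + 1), coefTD (P l) a j * t ^ a * iteratedDeriv j f.1 t := by
    intro l hl
    have hl' : l ≤ n := Nat.lt_succ_iff.1 (Finset.mem_range.1 hl)
    rw [quantize_eq_symbolOp, eq_sum_monomial (n := n) fun s hs =>
      ((hP l hl').isHomogSymbol.degree_le s hs).trans hl']
    simp only [map_sum, map_smul, symbolOp_monomial, LinearMap.sum_apply, LinearMap.smul_apply,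
      AddSubmonoidClass.coe_finsetSum, Finset.sum_apply, Submodule.coe_smul, Pi.smul_apply,
      smul_eq_mul, Module.End.mul_apply]
    refine Finset.sum_congr rfl fun j _ => Finset.sum_congr rfl fun a _ => ?_
    have h2 := opM_pow_apply a ((opT ^ j) f) t
    rw [opT_pow_apply] at h2
    simp only [Finsupp.add_apply, Finsupp.single_apply]
    simp only [Fin.isValue, ↓reduceIte, one_ne_zero, zero_ne_one, add_zero, zero_add]
    rw [h2, coefTD]
    ring
  simp only [opL, LinearMap.sum_apply, LinearMap.smul_apply, AddSubmonoidClass.coe_finsetSum,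
    Finset.sum_apply, Submodule.coe_smul, Pi.smul_apply, smul_eq_mul]
  rw [Finset.sum_congr rfl fun l hl => by rw [h1 l hl]]
  simp only [odeCoef, Finset.mul_sum, Finset.sum_mul]
  rw [Finset.sum_comm]
  refine Finset.sum_congr rfl fun j _ => Finset.sum_congr rfl fun l _ =>
    Finset.sum_congr rfl fun a _ => ?_
  rw [inv_pow]
  ring

lemma odeCoef_self {n : ℕ} {P : ℕ → NCPoly} (hP : ∀ l, l ≤ n → IsHomog l (P l))
    (hlead : evalAtZero (P n) = Polynomial.X ^ n) (t w : ℂ) : odeCoef n P n t w = 1 := by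
  have h1 : coefTD (P n) 0 n = 1 := by
    rw [coefTD_top (hP n le_rfl) (zero_add n)]
    have := (hP n le_rfl).isHomogSymbol.evalAtZero_eq
    rw [hlead] at this
    have := congrArg (fun q => Polynomial.coeff q n) this
    simpa using this.symm
  rw [odeCoef, Finset.sum_eq_single n, Finset.sum_eq_single 0]
  · simp [h1]
  · intro a _ ha
    by_cases h : coefTD (P n) a n = 0
    · simp [h]
    · have := (coefTD_ne_zero (hP n le_rfl) h).1
      omega
  · simp
  · intro l hl hln
    have hl' : l ≤ n := Nat.lt_succ_iff.1 (Finset.mem_range.1 hl)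
    refine Finset.sum_eq_zero fun a _ => ?_
    by_cases h : coefTD (P l) a n = 0
    · simp [h]
    · have := (coefTD_ne_zero (hP l hl') h).1
      omega
  · simp

lemma mem_ker_opL {n : ℕ} {P : ℕ → NCPoly} (hP : ∀ l, l ≤ n → IsHomog l (P l))
    (hlead : evalAtZero (P n) = Polynomial.X ^ n) (γ : ℂ) (f : Smooth) :
    f ∈ LinearMap.ker (opL n P γ) ↔ ∀ t : ℝ, iteratedDeriv n f.1 t =
      -∑ j ∈ Finset.range n, odeCoef n P j t γ⁻¹ * iteratedDeriv j f.1 t := by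
  rw [LinearMap.mem_ker, ← Subtype.coe_inj, funext_iff]
  refine forall_congr' fun t => ?_
  rw [opL_apply hP, Finset.sum_range_succ, odeCoef_self hP hlead, one_mul]
  change _ = (0 : ℂ) ↔ _
  rw [add_comm, add_eq_zero_iff_eq_neg]

/-! ### The scaled companion system -/

/-- The part of `t ^ (j - n) * odeCoef n P j t w` of order at least `3` in `s = t⁻¹`, divided
by `s ^ 3`. -/
def remCoef (n : ℕ) (P : ℕ → NCPoly) (j : ℕ) (s w : ℂ) : ℂ :=
  ∑ l ∈ Finset.range (n + 1), ∑ a ∈ Finset.range (n + 1),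
    if a + j + 3 ≤ n then w ^ (n - l) * coefTD (P l) a j * s ^ (n - j - a - 3) else 0

lemma sum_range_ite_and {n a₀ l₀ : ℕ} (ha : a₀ ≤ n) (hl : l₀ ≤ n) (g : ℕ → ℕ → ℂ) :
    (∑ l ∈ Finset.range (n + 1), ∑ a ∈ Finset.range (n + 1),
      if a = a₀ ∧ l = l₀ then g l a else 0) = g l₀ a₀ := by
  rw [Finset.sum_eq_single_of_mem l₀ (Finset.mem_range.2 (by omega)),
    Finset.sum_eq_single_of_mem a₀ (Finset.mem_range.2 (by omega))]
  · simp
  · intro a _ h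
    simp [h]
  · intro l _ h
    exact Finset.sum_eq_zero fun a _ => by simp [h]

/-- The expansion of the coefficients of `𝓛_γ` in powers of `t⁻¹`. By parity only `P_n` and
`P_{n-2}` contribute to the third term. -/
lemma odeCoef_expansion {n : ℕ} (hn : 2 ≤ n) {P : ℕ → NCPoly}
    (hP : ∀ l, l ≤ n → IsHomog l (P l)) {j : ℕ} (hj : j < n) {t : ℂ} (ht : t ≠ 0) (w : ℂ) :
    odeCoef n P j t w * t ^ j = t ^ n * ((evalAtOne (P n)).coeff j +
      t⁻¹ * (w * coefd P (n - 1) j) + t⁻¹ ^ 2 * (coefe P n j + w ^ 2 * coefd P (n - 2) j) +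
      t⁻¹ ^ 3 * remCoef n P j t⁻¹ w) := by
  have hterm : ∀ l ∈ Finset.range (n + 1), ∀ a ∈ Finset.range (n + 1),
      w ^ (n - l) * coefTD (P l) a j * t ^ a * t ^ j = t ^ n * (
        (if a = n - j ∧ l = n then coefTD (P l) a j else 0) +
        t⁻¹ * (w * if a = n - 1 - j ∧ l = n - 1 then coefTD (P l) a j else 0) +
        t⁻¹ ^ 2 * ((if a = n - j - 2 ∧ l = n then if j + 2 ≤ n then coefTD (P l) a j else 0 else 0)
          + w ^ 2 * if a = n - 2 - j ∧ l = n - 2 then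
            if j ≤ n - 2 then coefTD (P l) a j else 0 else 0) +
        t⁻¹ ^ 3 * if a + j + 3 ≤ n then
          w ^ (n - l) * coefTD (P l) a j * t⁻¹ ^ (n - j - a - 3) else 0) := by
    intro l hl a _
    have hl' : l ≤ n := Nat.lt_succ_iff.1 (Finset.mem_range.1 hl)
    by_cases h : coefTD (P l) a j = 0
    · simp [h]
    obtain ⟨h1, h2⟩ := coefTD_ne_zero (hP l hl') h
    obtain ⟨k, hk⟩ : ∃ k, n = a + j + k := ⟨n - (a + j), by omega⟩
    rcases k with _ | _ | _ | k
    · rw [if_pos (by omega), if_neg (by omega), if_neg (by omega), if_neg (by omega),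
        if_neg (by omega)]
      have : n - l = 0 := by omega
      rw [this, hk]
      ring
    · rw [if_neg (by omega), if_pos (by omega), if_neg (by omega), if_neg (by omega),
        if_neg (by omega)]
      have : n - l = 1 := by omega
      rw [this, hk]
      field_simp
      ring
    · rw [if_neg (by omega), if_neg (by omega)]
      by_cases hln : l = n
      · rw [if_pos (by omega), if_pos (by omega), if_neg (by omega), if_neg (by omega)]
        have : n - l = 0 := by omega
        rw [this, hk]
        field_simp
        ring
      · rw [if_neg (by omega), if_pos (by omega), if_pos (by omega), if_neg (by omega)]
        have : n - l = 2 := by omega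
        rw [this, hk]
        field_simp
        ring
    · rw [if_neg (by omega), if_neg (by omega), if_neg (by omega), if_neg (by omega),
        if_pos (by omega)]
      have : n - j - a - 3 = k := by omega
      have e : (t⁻¹ * t) ^ (k + 3) = 1 := by rw [inv_mul_cancel₀ ht, one_pow]
      rw [mul_pow] at e
      rw [this]
      generalize w ^ (n - l) = W
      rw [hk]
      linear_combination -(W * coefTD (P l) a j * t ^ a * t ^ j) * e
  rw [odeCoef, Finset.sum_mul]
  simp only [Finset.sum_mul]
  rw [Finset.sum_congr rfl fun l hl => Finset.sum_congr rfl fun a ha => hterm l hl a ha]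
  simp only [← Finset.mul_sum, Finset.sum_add_distrib]
  rw [sum_range_ite_and (by omega) le_rfl, sum_range_ite_and (by omega) (by omega),
    sum_range_ite_and (by omega) le_rfl, sum_range_ite_and (by omega) (by omega),
    coefTD_top (hP n le_rfl) (by omega : n - j + j = n), remCoef, coefd, coefd, coefe,
    if_pos (by omega : j ≤ n - 1)]

/-- The companion matrix of `𝓛_γ`. -/
def compMat (n : ℕ) (P : ℕ → NCPoly) (t w : ℂ) : Matrix (Fin n) (Fin n) ℂ :=
  Matrix.of fun i j => if (i : ℕ) + 1 = n then -odeCoef n P j t w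
    else if (j : ℕ) = i + 1 then 1 else 0

/-- The companion matrix of the polynomial `P_n(i z, 1)`. -/
def compTop (n : ℕ) (P : ℕ → NCPoly) : Matrix (Fin n) (Fin n) ℂ :=
  Matrix.of fun i j => if (i : ℕ) + 1 = n then -(evalAtOne (P n)).coeff j
    else if (j : ℕ) = i + 1 then 1 else 0

/-- The matrix of the system for the scaled unknowns `t ^ (-i) ∂_t ^ i y`, divided by `t`, as a
function of `s = t⁻¹`. Here and below `γ` is written as `w⁻¹`; by the convention `x / 0 = 0` the
expressions have the correct values also at `w = 0`. -/
def scaledMat (n : ℕ) (P : ℕ → NCPoly) (s w : ℂ) : Matrix (Fin n) (Fin n) ℂ :=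
  compTop n P + s • lastRow n (fun j => -(coefd P (n - 1) j / w⁻¹)) +
    s ^ 2 • (lastRow n (fun j => -(coefe P n j + coefd P (n - 2) j / w⁻¹ ^ 2)) -
      Matrix.diagonal fun i : Fin n => ((i : ℕ) : ℂ)) +
    s ^ 3 • lastRow n (fun j => -remCoef n P j s w)

/-- The passage to the scaled unknowns; the last summand is the derivative of `t ^ i`. -/
lemma compMat_scaling {n : ℕ} (hn : 2 ≤ n) {P : ℕ → NCPoly}
    (hP : ∀ l, l ≤ n → IsHomog l (P l)) {t : ℂ} (ht : t ≠ 0) (w : ℂ) (i j : Fin n) :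
    compMat n P t w i j * t ^ (j : ℕ) = t ^ (i : ℕ) * t * scaledMat n P t⁻¹ w i j +
      if i = j then ((i : ℕ) : ℂ) * t ^ ((i : ℕ) - 1) else 0 := by
  have hdiag : (if i = j then ((i : ℕ) : ℂ) * t ^ ((i : ℕ) - 1) else 0) =
      t ^ (i : ℕ) * t * (t⁻¹ ^ 2 * if i = j then ((i : ℕ) : ℂ) else 0) := by
    split_ifs with h
    · rcases hi : (i : ℕ) with _ | m
      · simp
      · rw [Nat.add_sub_cancel]
        field_simp
        ring
    · simp
  rw [hdiag]
  simp only [scaledMat, compMat, compTop, lastRow, Matrix.add_apply, Matrix.smul_apply,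
    Matrix.sub_apply, Matrix.of_apply, Matrix.diagonal_apply, smul_eq_mul]
  by_cases hi : (i : ℕ) + 1 = n
  · simp only [if_pos hi]
    rw [neg_mul, odeCoef_expansion hn hP j.2 ht w]
    have : t ^ n = t ^ (i : ℕ) * t := by rw [← pow_succ, hi]
    rw [this, inv_pow w, div_inv_eq_mul, div_inv_eq_mul]
    ring
  · simp only [if_neg hi]
    by_cases hj : (j : ℕ) = i + 1
    · simp only [if_pos hj]
      rw [hj, pow_succ]
      ring
    · simp only [if_neg hj]
      ring

/-! ### Diagonalisation up to order two -/

/-- The correction `D₂ - U` of the scaled system in the eigenbasis. -/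
def matG (n : ℕ) (P : ℕ → NCPoly) (r : Fin n → ℂ) (w : ℂ) : Matrix (Fin n) (Fin n) ℂ :=
  matD2 n P r w⁻¹ - matU n r

/-- The remainder of the scaled system in the eigenbasis. -/
def matR (n : ℕ) (P : ℕ → NCPoly) (r : Fin n → ℂ) (s w : ℂ) : Matrix (Fin n) (Fin n) ℂ :=
  (matS n r)⁻¹ * lastRow n (fun j => -remCoef n P j s w) * matS n r

/-- The matrix of the scaled system in the eigenbasis. -/
def matN (n : ℕ) (P : ℕ → NCPoly) (r : Fin n → ℂ) (s w : ℂ) : Matrix (Fin n) (Fin n) ℂ :=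
  matLam n r + s • matD1 n P r w⁻¹ + s ^ 2 • matG n P r w + s ^ 3 • matR n P r s w

lemma isUnit_det_matS {n : ℕ} {r : Fin n → ℂ} (hr : Function.Injective r) :
    IsUnit (matS n r).det := by
  rw [matS, Matrix.det_transpose, isUnit_iff_ne_zero, Matrix.det_vandermonde_ne_zero_iff]
  exact hr

lemma compTop_mul_matS {n : ℕ} {P : ℕ → NCPoly}
    (hP : ∀ l, l ≤ n → IsHomog l (P l)) (hlead : evalAtZero (P n) = Polynomial.X ^ n)
    {r : Fin n → ℂ} (hroot : ∀ k, (evalAtOne (P n)).IsRoot (r k)) :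
    compTop n P * matS n r = matS n r * matLam n r := by
  have hsym := (hP n le_rfl).isHomogSymbol
  have htop : (evalAtOne (P n)).coeff n = 1 := by
    have := hsym.evalAtZero_eq
    rw [hlead] at this
    simpa using (congrArg (fun q => Polynomial.coeff q n) this).symm
  ext i k
  rw [matLam, Matrix.mul_diagonal, Matrix.mul_apply]
  simp only [compTop, matS, Matrix.of_apply, Matrix.transpose_apply, Matrix.vandermonde_apply]
  by_cases hi : (i : ℕ) + 1 = n
  · simp only [if_pos hi, neg_mul, Finset.sum_neg_distrib]
    have h := hroot k
    rw [Polynomial.IsRoot, Polynomial.eval_eq_sum_range' (Nat.lt_succ_of_le hsym.natDegree_le),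
      Finset.sum_range_succ, htop, one_mul] at h
    rw [Fin.sum_univ_eq_sum_range (fun j => (evalAtOne (P n)).coeff j * r k ^ j), ← pow_succ, hi]
    linear_combination -h
  · simp only [if_neg hi]
    rw [Finset.sum_eq_single (⟨i + 1, by omega⟩ : Fin n)]
    · simp [pow_succ]
    · intro j _ hj
      rw [if_neg, zero_mul]
      intro h
      exact hj (Fin.ext h)
    · simp

lemma scaledMat_mul_matS {n : ℕ} {P : ℕ → NCPoly}
    (hP : ∀ l, l ≤ n → IsHomog l (P l)) (hlead : evalAtZero (P n) = Polynomial.X ^ n)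
    {r : Fin n → ℂ} (hr : Function.Injective r)
    (hroot : ∀ k, (evalAtOne (P n)).IsRoot (r k)) (s w : ℂ) :
    scaledMat n P s w * matS n r = matS n r * matN n P r s w := by
  have hc := compTop_mul_matS hP hlead hroot
  have hcancel : ∀ X : Matrix (Fin n) (Fin n) ℂ, matS n r * ((matS n r)⁻¹ * X) = X := fun X =>
    Matrix.mul_nonsing_inv_cancel_left _ X (isUnit_det_matS hr)
  have hU : matS n r * matU n r =
      (Matrix.diagonal fun i : Fin n => ((i : ℕ) : ℂ)) * matS n r := by
    rw [matU, hcancel]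
    ext i j
    simp [matS]
  simp only [scaledMat, matN, matG, matD1, matD2, matR, mul_add, add_mul, Matrix.mul_smul,
    Matrix.smul_mul, sub_mul, mul_sub, hc, hU, mul_assoc, hcancel]

/-- The diagonal matrix of the `β_{γ,k}`. -/
def matBeta (n : ℕ) (P : ℕ → NCPoly) (r : Fin n → ℂ) (w : ℂ) : Matrix (Fin n) (Fin n) ℂ :=
  Matrix.diagonal (betaCoef n P r w⁻¹)

/-- The diagonal matrix of the `ρ_{γ,k}`. -/
def matRho (n : ℕ) (P : ℕ → NCPoly) (r : Fin n → ℂ) (w : ℂ) : Matrix (Fin n) (Fin n) ℂ :=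
  Matrix.diagonal (rhoCoef n P r w⁻¹)

/-- The second coefficient of the diagonalising transformation, determined off the diagonal by
`matB_mul_matLam`. -/
def matB (n : ℕ) (P : ℕ → NCPoly) (r : Fin n → ℂ) (w : ℂ) : Matrix (Fin n) (Fin n) ℂ :=
  Matrix.of fun i j => if i = j then 0 else
    (matD1 n P r w⁻¹ * matA n P r w⁻¹ + matG n P r w -
      matA n P r w⁻¹ * matBeta n P r w) i j / (r j - r i)

/-- The terms of first order in the diagonalisation. -/
lemma matA_mul_matLam {n : ℕ} (P : ℕ → NCPoly) {r : Fin n → ℂ} (hr : Function.Injective r)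
    (w : ℂ) : matA n P r w⁻¹ * matLam n r + matBeta n P r w =
      matLam n r * matA n P r w⁻¹ + matD1 n P r w⁻¹ := by
  ext i j
  rw [matLam, Matrix.add_apply, Matrix.add_apply, Matrix.mul_diagonal, Matrix.diagonal_mul,
    matBeta, Matrix.diagonal_apply]
  by_cases h : i = j
  · subst h
    simp [matA, betaCoef]
  · have hne : r j - r i ≠ 0 := sub_ne_zero.2 fun e => h (hr e).symm
    simp only [matA, Matrix.of_apply, if_neg h]
    field_simp
    ring

/-- The terms of second order in the diagonalisation. On the diagonal the relation holds by the
formula for `ρ_{γ,k}`, because `[A, Λ₀] = D₁ - β`. -/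
lemma matB_mul_matLam {n : ℕ} (P : ℕ → NCPoly) {r : Fin n → ℂ} (hr : Function.Injective r)
    (w : ℂ) : matB n P r w * matLam n r + matA n P r w⁻¹ * matBeta n P r w + matRho n P r w =
      matLam n r * matB n P r w + matD1 n P r w⁻¹ * matA n P r w⁻¹ + matG n P r w := by
  ext i j
  rw [matLam, Matrix.add_apply, Matrix.add_apply, Matrix.add_apply, Matrix.add_apply,
    Matrix.mul_diagonal, Matrix.diagonal_mul, matRho, Matrix.diagonal_apply]
  by_cases h : i = j
  · subst h
    have hA : matA n P r w⁻¹ i i = 0 := by simp [matA]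
    have hAβ : (matA n P r w⁻¹ * matBeta n P r w) i i = 0 := by
      rw [matBeta, Matrix.mul_diagonal, hA, zero_mul]
    have hcomm : matA n P r w⁻¹ * matLam n r - matLam n r * matA n P r w⁻¹ =
        matD1 n P r w⁻¹ - matBeta n P r w := by
      rw [sub_eq_sub_iff_add_eq_add, matA_mul_matLam P hr]
      abel
    have hB : matB n P r w i i = 0 := by simp [matB]
    rw [if_pos rfl, hAβ, hB, rhoCoef, hcomm, mul_sub, matG]
    simp only [Matrix.add_apply, Matrix.sub_apply, hAβ]
    ring
  · have hne : r j - r i ≠ 0 := sub_ne_zero.2 fun e => h (hr e).symm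
    rw [if_neg h, matB, Matrix.of_apply, if_neg h]
    simp only [Matrix.add_apply, Matrix.sub_apply]
    field_simp
    ring

/-- The diagonalising transformation. -/
def matT (n : ℕ) (P : ℕ → NCPoly) (r : Fin n → ℂ) (s w : ℂ) : Matrix (Fin n) (Fin n) ℂ :=
  1 + s • matA n P r w⁻¹ + s ^ 2 • matB n P r w

/-- The error of the diagonalisation, before multiplication by the inverse of `matT`. -/
def matErr (n : ℕ) (P : ℕ → NCPoly) (r : Fin n → ℂ) (s w : ℂ) : Matrix (Fin n) (Fin n) ℂ :=
  matD1 n P r w⁻¹ * matB n P r w + matG n P r w * matA n P r w⁻¹ +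
    s • (matG n P r w * matB n P r w) + matR n P r s w * matT n P r s w +
    matA n P r w⁻¹ + (2 * s) • matB n P r w - matB n P r w * matBeta n P r w -
    matA n P r w⁻¹ * matRho n P r w - s • (matB n P r w * matRho n P r w)

/-- The diagonalisation up to order two. The term with `A + 2 s B` stems from the derivative of
`matT`, as `s' = -s²`. -/
lemma matN_mul_matT {n : ℕ} (P : ℕ → NCPoly) {r : Fin n → ℂ} (hr : Function.Injective r)
    (s w : ℂ) : matN n P r s w * matT n P r s w +
      s ^ 3 • (matA n P r w⁻¹ + (2 * s) • matB n P r w) =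
    matT n P r s w * (matLam n r + s • matBeta n P r w + s ^ 2 • matRho n P r w) +
      s ^ 3 • matErr n P r s w := by
  have h1 := matA_mul_matLam P hr w
  have h2 := matB_mul_matLam P hr w
  have h3 : matLam n r * matB n P r w = matB n P r w * matLam n r +
      matA n P r w⁻¹ * matBeta n P r w + matRho n P r w - matD1 n P r w⁻¹ * matA n P r w⁻¹ -
      matG n P r w := by rw [h2]; abel
  have h4 : matLam n r * matA n P r w⁻¹ = matA n P r w⁻¹ * matLam n r + matBeta n P r w -
      matD1 n P r w⁻¹ := by rw [h1]; abel
  simp only [matErr, matN, add_mul _ _ (matT n P r s w), Matrix.smul_mul]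
  simp only [matT, mul_add, add_mul, mul_one, one_mul, Matrix.smul_mul, Matrix.mul_smul,
    h3, h4]
  module

/-! ### Regularity of the diagonalisation -/

section Regularity

open scoped Matrix.Norms.Operator

variable {n : ℕ} (P : ℕ → NCPoly) (r : Fin n → ℂ)

lemma differentiable_matrix {E : Type*} [NormedAddCommGroup E] [NormedSpace ℂ E]
    {f : E → Matrix (Fin n) (Fin n) ℂ} (hf : ∀ i j, Differentiable ℂ fun z => f z i j) :
    Differentiable ℂ f := by
  have : f = fun z => ∑ i, ∑ j, f z i j • Matrix.single i j (1 : ℂ) := by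
    funext z
    conv_lhs => rw [Matrix.matrix_eq_sum_single (f z)]
    simp [Matrix.smul_single]
  rw [this]
  exact Differentiable.fun_sum fun i _ => Differentiable.fun_sum fun j _ =>
    (hf i j).smul_const _

lemma differentiable_matrix_entry (i j : Fin n) :
    Differentiable ℂ fun M : Matrix (Fin n) (Fin n) ℂ => M i j :=
  (LinearMap.toContinuousLinearMap (Matrix.entryLinearMap ℂ ℂ i j)).differentiable

lemma differentiable_lastRow {E : Type*} [NormedAddCommGroup E] [NormedSpace ℂ E]
    {c : E → Fin n → ℂ} (hc : ∀ j, Differentiable ℂ fun z => c z j) :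
    Differentiable ℂ fun z => lastRow n (c z) := by
  refine differentiable_matrix fun i j => ?_
  simp only [lastRow, Matrix.of_apply]
  split_ifs
  · exact hc j
  · exact differentiable_const _

/-- The coefficients are polynomial in `w`, so that their expressions in `γ = w⁻¹` extend
holomorphically to `w = 0`. -/
lemma differentiable_matD1 : Differentiable ℂ fun z : ℂ × ℂ => matD1 n P r z.2⁻¹ := by
  simp only [matD1, div_inv_eq_mul]
  exact ((differentiable_lastRow fun j => by fun_prop).const_mul _).mul_const _

lemma differentiable_matG : Differentiable ℂ fun z : ℂ × ℂ => matG n P r z.2 := by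
  simp only [matG, matD2, inv_pow, div_inv_eq_mul]
  exact (((differentiable_lastRow fun j => by fun_prop).const_mul _).mul_const _).sub_const _

lemma differentiable_matR : Differentiable ℂ fun z : ℂ × ℂ => matR n P r z.1 z.2 := by
  simp only [matR, remCoef]
  refine ((differentiable_lastRow fun j => Differentiable.neg ?_).const_mul _).mul_const _
  refine Differentiable.fun_sum fun l _ => Differentiable.fun_sum fun a _ => ?_
  split_ifs <;> fun_prop

lemma differentiable_matA : Differentiable ℂ fun z : ℂ × ℂ => matA n P r z.2⁻¹ := by
  refine differentiable_matrix fun i j => ?_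
  simp only [matA, Matrix.of_apply]
  split_ifs
  · exact differentiable_const _
  · have h : Differentiable ℂ fun z : ℂ × ℂ => matD1 n P r z.2⁻¹ i j :=
      (differentiable_matrix_entry i j).comp (differentiable_matD1 P r)
    simpa only [div_eq_mul_inv] using h.mul_const (r j - r i)⁻¹

lemma differentiable_betaCoef (k : Fin n) :
    Differentiable ℂ fun z : ℂ × ℂ => betaCoef n P r z.2⁻¹ k :=
  (differentiable_matrix_entry k k).comp (differentiable_matD1 P r)

lemma differentiable_rhoCoef (k : Fin n) :
    Differentiable ℂ fun z : ℂ × ℂ => rhoCoef n P r z.2⁻¹ k := by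
  have h : ∀ z : ℂ × ℂ, rhoCoef n P r z.2⁻¹ k =
      (matG n P r z.2 + (matD1 n P r z.2⁻¹ * matA n P r z.2⁻¹ -
        matA n P r z.2⁻¹ * matD1 n P r z.2⁻¹) + matA n P r z.2⁻¹ *
        (matA n P r z.2⁻¹ * matLam n r - matLam n r * matA n P r z.2⁻¹)) k k := by
    intro z
    rw [rhoCoef, matG]
    simp only [Matrix.add_apply, Matrix.sub_apply]
    ring
  simp only [h]
  have hD := differentiable_matD1 P r
  have hA := differentiable_matA P r
  have hG := differentiable_matG P r
  refine (differentiable_matrix_entry k k).comp (g := fun M : Matrix (Fin n) (Fin n) ℂ => M k k) ?_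
  exact (hG.add ((hD.mul hA).sub (hA.mul hD))).add (hA.mul ((hA.mul_const _).sub (hA.const_mul _)))

lemma differentiable_matBeta : Differentiable ℂ fun z : ℂ × ℂ => matBeta n P r z.2 := by
  refine differentiable_matrix fun i j => ?_
  simp only [matBeta, Matrix.diagonal_apply]
  split_ifs
  · exact differentiable_betaCoef P r i
  · exact differentiable_const _

lemma differentiable_matRho : Differentiable ℂ fun z : ℂ × ℂ => matRho n P r z.2 := by
  refine differentiable_matrix fun i j => ?_
  simp only [matRho, Matrix.diagonal_apply]
  split_ifs
  · exact differentiable_rhoCoef P r i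
  · exact differentiable_const _

lemma differentiable_matB : Differentiable ℂ fun z : ℂ × ℂ => matB n P r z.2 := by
  have hM := (((differentiable_matD1 P r).mul (differentiable_matA P r)).add
    (differentiable_matG P r)).sub ((differentiable_matA P r).mul (differentiable_matBeta P r))
  refine differentiable_matrix fun i j => ?_
  simp only [matB, Matrix.of_apply]
  split_ifs
  · exact differentiable_const _
  · have h : Differentiable ℂ fun z : ℂ × ℂ => (matD1 n P r z.2⁻¹ * matA n P r z.2⁻¹ +
        matG n P r z.2 - matA n P r z.2⁻¹ * matBeta n P r z.2) i j :=
      (differentiable_matrix_entry i j).comp hM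
    simpa only [div_eq_mul_inv] using h.mul_const (r j - r i)⁻¹

lemma differentiable_matT : Differentiable ℂ fun z : ℂ × ℂ => matT n P r z.1 z.2 := by
  have hA := differentiable_matA P r
  have hB := differentiable_matB P r
  exact ((differentiable_const _).add (differentiable_fst.smul hA)).add
    ((differentiable_fst.pow 2).smul hB)

lemma differentiable_matErr : Differentiable ℂ fun z : ℂ × ℂ => matErr n P r z.1 z.2 := by
  have hA := differentiable_matA P r
  have hB := differentiable_matB P r
  have hD := differentiable_matD1 P r
  have hG := differentiable_matG P r
  have hR := differentiable_matR P r
  have hT := differentiable_matT P r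
  have hβ := differentiable_matBeta P r
  have hρ := differentiable_matRho P r
  have h1 : Differentiable ℂ fun z : ℂ × ℂ => z.1 := differentiable_fst
  exact ((((((((hD.mul hB).add (hG.mul hA)).add (h1.smul (hG.mul hB))).add (hR.mul hT)).add
    hA).add ((h1.const_mul 2).smul hB)).sub (hB.mul hβ)).sub (hA.mul hρ)).sub
    (h1.smul (hB.mul hρ))

/-- The perturbation of the diagonalised system. -/
def matQ (s w : ℂ) : Matrix (Fin n) (Fin n) ℂ := (matT n P r s w)⁻¹ * matErr n P r s w

lemma differentiableAt_matQ {s w : ℂ} (h : IsUnit (matT n P r s w)) :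
    DifferentiableAt ℂ (fun z : ℂ × ℂ => matQ P r z.1 z.2) (s, w) := by
  simp only [matQ, Matrix.nonsing_inv_eq_ringInverse]
  refine DifferentiableAt.mul ?_ (differentiable_matErr P r _)
  exact DifferentiableAt.comp (s, w) (differentiableAt_inverse (𝕜 := ℂ) h)
    (differentiable_matT P r (s, w))

lemma differentiableAt_matQ_apply {s w : ℂ} (h : IsUnit (matT n P r s w)) (i j : Fin n) :
    DifferentiableAt ℂ (fun z : ℂ × ℂ => matQ P r z.1 z.2 i j) (s, w) :=
  DifferentiableAt.comp (g := fun M : Matrix (Fin n) (Fin n) ℂ => M i j) (s, w)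
    (differentiable_matrix_entry i j).differentiableAt (differentiableAt_matQ P r h)

lemma differentiableAt_matQ_left {s w : ℂ} (h : IsUnit (matT n P r s w)) (i j : Fin n) :
    DifferentiableAt ℂ (fun s => matQ P r s w i j) s := by
  have h2 : DifferentiableAt ℂ (fun s : ℂ => (s, w)) s := by fun_prop
  have h3 := DifferentiableAt.comp (g := fun z : ℂ × ℂ => matQ P r z.1 z.2 i j) s
    (differentiableAt_matQ_apply P r h i j) h2
  simpa only [Function.comp_def] using h3

lemma differentiableAt_matQ_right {s w : ℂ} (h : IsUnit (matT n P r s w)) (i j : Fin n) :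
    DifferentiableAt ℂ (fun w => matQ P r s w i j) w := by
  have h2 : DifferentiableAt ℂ (fun w : ℂ => (s, w)) w := by fun_prop
  have h3 := DifferentiableAt.comp (g := fun z : ℂ × ℂ => matQ P r z.1 z.2 i j) w
    (differentiableAt_matQ_apply P r h i j) h2
  simpa only [Function.comp_def] using h3

lemma differentiable_matS_mul_matT_apply (s : ℂ) (i j : Fin n) :
    Differentiable ℂ fun w => (matS n r * matT n P r s w) i j := by
  have h2 : Differentiable ℂ (fun w : ℂ => (s, w)) := by fun_prop
  have h3 := ((differentiable_matT P r).const_mul (matS n r)).comp h2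
  simpa only [Function.comp_def] using (differentiable_matrix_entry i j).comp h3

lemma differentiable_betaCoef_inv (k : Fin n) :
    Differentiable ℂ fun w : ℂ => betaCoef n P r w⁻¹ k := by
  have h2 : Differentiable ℂ (fun w : ℂ => ((0 : ℂ), w)) := by fun_prop
  simpa only [Function.comp_def] using (differentiable_betaCoef P r k).comp h2

lemma differentiable_rhoCoef_inv (k : Fin n) :
    Differentiable ℂ fun w : ℂ => rhoCoef n P r w⁻¹ k := by
  have h2 : Differentiable ℂ (fun w : ℂ => ((0 : ℂ), w)) := by fun_prop
  simpa only [Function.comp_def] using (differentiable_rhoCoef P r k).comp h2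

lemma exists_bound_of_continuousOn_entries {X : Type*} [TopologicalSpace X] {C : Set X}
    (hC : IsCompact C) {f : X → Matrix (Fin n) (Fin n) ℂ} (hf : ContinuousOn f C) :
    ∃ K, 0 ≤ K ∧ ∀ z ∈ C, ∀ i j, ‖f z i j‖ ≤ K := by
  have hc : ContinuousOn (fun z => ∑ i, ∑ j, ‖f z i j‖) C :=
    continuousOn_finsetSum _ fun i _ => continuousOn_finsetSum _ fun j _ =>
      ((differentiable_matrix_entry i j).continuous.comp_continuousOn hf).norm
  obtain ⟨K, hK⟩ := hC.exists_bound_of_continuousOn hc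
  refine ⟨|K|, abs_nonneg K, fun z hz i j => ?_⟩
  refine le_trans ?_ (((le_abs_self _).trans (hK z hz)).trans (le_abs_self K))
  refine le_trans ?_ (Finset.single_le_sum (f := fun i => ∑ j, ‖f z i j‖)
    (fun i _ => Finset.sum_nonneg fun j _ => norm_nonneg _) (Finset.mem_univ i))
  exact Finset.single_le_sum (f := fun j => ‖f z i j‖) (fun j _ => norm_nonneg _)
    (Finset.mem_univ j)

lemma exists_isUnit_matT (m : ℕ) : ∃ δ > 0, δ ≤ 1 ∧ ∀ s w : ℂ, ‖s‖ ≤ δ → ‖w‖ ≤ m →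
    IsUnit (matT n P r s w) := by
  have hcont : Continuous fun w : ℂ => ‖matA n P r w⁻¹‖ + ‖matB n P r w‖ :=
    ((differentiable_matA P r).continuous.comp (continuous_const.prodMk continuous_id)
      (f := fun w : ℂ => ((0 : ℂ), w))).norm.add
    ((differentiable_matB P r).continuous.comp (continuous_const.prodMk continuous_id)
      (f := fun w : ℂ => ((0 : ℂ), w))).norm
  obtain ⟨C, hC⟩ := (isCompact_closedBall (0 : ℂ) m).exists_bound_of_continuousOn
    hcont.continuousOn
  have hC' : ∀ w : ℂ, ‖w‖ ≤ m → ‖matA n P r w⁻¹‖ + ‖matB n P r w‖ ≤ |C| := fun w hw =>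
    ((le_abs_self _).trans (hC w (by simpa using hw))).trans (le_abs_self C)
  have hpos : (0 : ℝ) < |C| + 1 := by positivity
  refine ⟨1 / (2 * (|C| + 1)), by positivity, ?_, fun s w hs hw => ?_⟩
  · rw [div_le_one (by positivity)]
    linarith [abs_nonneg C]
  have hs1 : ‖s‖ ≤ 1 := by
    refine hs.trans ?_
    rw [div_le_one (by positivity)]
    linarith [abs_nonneg C]
  have hT : matT n P r s w = 1 - (-(s • matA n P r w⁻¹ + s ^ 2 • matB n P r w)) := by
    rw [matT]
    abel
  rw [hT]
  refine isUnit_one_sub_of_norm_lt_one ?_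
  rw [norm_neg]
  have hs2 : ‖s‖ ^ 2 ≤ ‖s‖ := by
    simpa using pow_le_pow_of_le_one (norm_nonneg _) hs1 (by norm_num : 1 ≤ 2)
  calc ‖s • matA n P r w⁻¹ + s ^ 2 • matB n P r w‖
      ≤ ‖s‖ * ‖matA n P r w⁻¹‖ + ‖s‖ ^ 2 * ‖matB n P r w‖ := by
        refine (norm_add_le _ _).trans ?_
        rw [norm_smul, norm_smul, norm_pow]
    _ ≤ ‖s‖ * ‖matA n P r w⁻¹‖ + ‖s‖ * ‖matB n P r w‖ := by gcongr
    _ = ‖s‖ * (‖matA n P r w⁻¹‖ + ‖matB n P r w‖) := by ring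
    _ ≤ 1 / (2 * (|C| + 1)) * |C| := by
        gcongr
        exact hC' w hw
    _ < 1 := by
        rw [div_mul_eq_mul_div, div_lt_one (by positivity)]
        linarith [abs_nonneg C]

lemma exists_bound_matQ (m : ℕ) : ∃ δ > 0, ∃ K, 0 ≤ K ∧ ∀ s w : ℂ, ‖w‖ < m → ‖s‖ < δ →
    IsUnit (matT n P r s w) ∧ ∀ i j, ‖matQ P r s w i j‖ ≤ K := by
  obtain ⟨δ, hδ, -, hT⟩ := exists_isUnit_matT P r m
  have hmem : ∀ z ∈ Metric.closedBall (0 : ℂ) δ ×ˢ Metric.closedBall (0 : ℂ) (m : ℝ),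
      IsUnit (matT n P r z.1 z.2) := fun z hz =>
    hT z.1 z.2 (by simpa using hz.1) (by simpa using hz.2)
  obtain ⟨K, hK0, hK⟩ := exists_bound_of_continuousOn_entries
    (((isCompact_closedBall (0 : ℂ) δ).prod (isCompact_closedBall (0 : ℂ) (m : ℝ))))
    (f := fun z : ℂ × ℂ => matQ P r z.1 z.2) fun z hz =>
      (differentiableAt_matQ P r (hmem z hz)).continuousAt.continuousWithinAt
  exact ⟨δ, hδ, K, hK0, fun s w hw hs => ⟨hT s w hs.le hw.le,
    hK (s, w) ⟨by simpa using hs.le, by simpa using hw.le⟩⟩⟩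

lemma exists_bound_matS_mul_matT (m : ℕ) : ∃ K, 0 ≤ K ∧ ∀ s w : ℂ, ‖s‖ ≤ 1 → ‖w‖ ≤ m →
    ∀ i j, ‖(matS n r * matT n P r s w) i j‖ ≤ K := by
  obtain ⟨K, hK0, hK⟩ := exists_bound_of_continuousOn_entries
    (((isCompact_closedBall (0 : ℂ) 1).prod (isCompact_closedBall (0 : ℂ) (m : ℝ))))
    (f := fun z : ℂ × ℂ => matS n r * matT n P r z.1 z.2)
    ((differentiable_matT P r).const_mul _).continuous.continuousOn
  exact ⟨K, hK0, fun s w hs hw => hK (s, w) ⟨by simpa using hs, by simpa using hw⟩⟩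

end Regularity

/-! ### Solutions with prescribed asymptotics -/

section SystemSolutions

open Matrix

lemma hasDerivAt_mulVec {n : ℕ} {M : ℂ → Matrix (Fin n) (Fin n) ℂ} {M' : Matrix (Fin n) (Fin n) ℂ}
    {x : ℂ → Fin n → ℂ} {x' : Fin n → ℂ} {v : ℂ}
    (hM : ∀ i j, HasDerivAt (fun v => M v i j) (M' i j) v)
    (hx : ∀ j, HasDerivAt (fun v => x v j) (x' j) v) (i : Fin n) :
    HasDerivAt (fun v => (M v *ᵥ x v) i) ((M' *ᵥ x v + M v *ᵥ x') i) v := by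
  simp only [Matrix.mulVec, dotProduct, Pi.add_apply]
  refine (HasDerivAt.fun_sum fun j _ => (hM i j).mul (hx j)).congr_deriv ?_
  rw [← Finset.sum_add_distrib]

/-- The phase `Φ_k` as a function of `v`, where `t² = α² v`; the logarithm is `log t` up to a
constant. -/
def halfPlanePhase (n : ℕ) (P : ℕ → NCPoly) (r : Fin n → ℂ) (α : ℂ) (k : Fin n) (v w : ℂ) : ℂ :=
  r k * (α ^ 2 / 2) * v + betaCoef n P r w⁻¹ k * rootTime α v +
    rhoCoef n P r w⁻¹ k / 2 * Complex.log v

lemma hasDerivAt_halfPlanePhase {n : ℕ} (P : ℕ → NCPoly) (r : Fin n → ℂ) {α : ℂ} (hα : α ≠ 0)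
    (k : Fin n) {v : ℂ} (hv : 0 < v.re) (w : ℂ) :
    HasDerivAt (fun v => halfPlanePhase n P r α k v w)
      (α ^ 2 / 2 * (r k + betaCoef n P r w⁻¹ k * (rootTime α v)⁻¹ +
        rhoCoef n P r w⁻¹ k * (rootTime α v)⁻¹ ^ 2)) v := by
  have h1 := (hasDerivAt_id v).const_mul (r k * (α ^ 2 / 2))
  have h2 := (hasDerivAt_rootTime hα hv).const_mul (betaCoef n P r w⁻¹ k)
  have h3 := (Complex.hasDerivAt_log (Or.inl hv)).const_mul (rhoCoef n P r w⁻¹ k / 2)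
  refine ((h1.add h2).add h3).congr_deriv ?_
  have hv0 : v ≠ 0 := Complex.slitPlane_ne_zero (Or.inl hv)
  rw [inv_pow, rootTime_sq]
  field_simp

/-- The solution of the companion system obtained from a solution `x` of the `k`-th normalised
system. -/
def systemSolution (n : ℕ) (P : ℕ → NCPoly) (r : Fin n → ℂ) (α : ℂ) (k : Fin n)
    (x : Fin n → ℂ → ℂ → ℂ) (i : Fin n) (v w : ℂ) : ℂ :=
  rootTime α v ^ (i : ℕ) * ((matS n r * matT n P r (rootTime α v)⁻¹ w) *ᵥ
    fun j => x j v w * Complex.exp (halfPlanePhase n P r α k v w)) i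

/-- Undoing the normalisation, the diagonalisation and the scaling gives solutions of the companion
system, with time replaced by `v`. -/
lemma hasDerivAt_systemSolution {n : ℕ} (hn : 2 ≤ n) {P : ℕ → NCPoly}
    (hP : ∀ l, l ≤ n → IsHomog l (P l)) (hlead : evalAtZero (P n) = Polynomial.X ^ n)
    {r : Fin n → ℂ} (hr : Function.Injective r) (hroot : ∀ k, (evalAtOne (P n)).IsRoot (r k))
    {α : ℂ} (hα : α ≠ 0) {k : Fin n} {x : Fin n → ℂ → ℂ → ℂ} {v w : ℂ} (hv : 0 < v.re)
    (hT : IsUnit (matT n P r (rootTime α v)⁻¹ w))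
    (hx : ∀ j, HasDerivAt (fun v => x j v w) (α ^ 2 / 2 * (r j - r k) * x j v w +
      ∑ i, halfPlanePerturbation α (fun j w => betaCoef n P r w⁻¹ j)
        (fun j w => rhoCoef n P r w⁻¹ j) (matQ P r) k j i v w * x i v w) v) (i : Fin n) :
    HasDerivAt (fun v => systemSolution n P r α k x i v w)
      (α ^ 2 / 2 * (rootTime α v)⁻¹ * ∑ j, compMat n P (rootTime α v) w i j *
        systemSolution n P r α k x j v w) v := by
  set ν := α ^ 2 / 2 with hν
  set t := rootTime α v with ht
  have ht0 : t ≠ 0 := rootTime_ne_zero hα hv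
  set s := t⁻¹ with hs
  set X : ℂ → Fin n → ℂ := fun v j =>
    x j v w * Complex.exp (halfPlanePhase n P r α k v w) with hXdef
  set M₁ := matLam n r + s • matBeta n P r w + s ^ 2 • matRho n P r w + s ^ 3 • matQ P r s w
    with hM₁
  have hX : ∀ j, HasDerivAt (fun v => X v j) ((ν • (M₁ *ᵥ X v)) j) v := by
    intro j
    refine ((hx j).mul (hasDerivAt_halfPlanePhase P r hα k hv w).cexp).congr_deriv ?_
    have e1 : (M₁ *ᵥ X v) j = (r j + s * betaCoef n P r w⁻¹ j + s ^ 2 * rhoCoef n P r w⁻¹ j) * X v j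
        + s ^ 3 * ∑ i, matQ P r s w j i * X v i := by
      simp only [hM₁, Matrix.add_mulVec, Matrix.smul_mulVec, matLam, matBeta, matRho, Pi.add_apply,
        Pi.smul_apply, Matrix.mulVec_diagonal, smul_eq_mul]
      rw [Matrix.mulVec, dotProduct]
      ring
    have e2 : ∑ i, halfPlanePerturbation α (fun j w => betaCoef n P r w⁻¹ j)
        (fun j w => rhoCoef n P r w⁻¹ j) (matQ P r) k j i v w * x i v w =
        ν * ((betaCoef n P r w⁻¹ j - betaCoef n P r w⁻¹ k) * s +
          (rhoCoef n P r w⁻¹ j - rhoCoef n P r w⁻¹ k) * s ^ 2) * x j v w +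
        ν * s ^ 3 * ∑ i, matQ P r s w j i * x i v w := by
      simp only [halfPlanePerturbation, mul_add, add_mul, Finset.sum_add_distrib]
      rw [Finset.mul_sum]
      congr 1
      · rw [Finset.sum_eq_single j]
        · simp only [if_true, ← hν, ← ht, ← hs]
          ring
        · intro i _ hi
          rw [if_neg (Ne.symm hi)]
          ring
        · simp
      · refine Finset.sum_congr rfl fun i _ => ?_
        ring
    rw [e2, Pi.smul_apply, smul_eq_mul, e1]
    have e3 : ∑ i, matQ P r s w j i * X v i = (∑ i, matQ P r s w j i * x i v w) *
        Complex.exp (halfPlanePhase n P r α k v w) := by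
      rw [Finset.sum_mul]
      exact Finset.sum_congr rfl fun i _ => (mul_assoc _ _ _).symm
    rw [e3]
    simp only [hXdef]
    ring
  have hTd : ∀ i j, HasDerivAt (fun v => matT n P r (rootTime α v)⁻¹ w i j)
      ((-(ν * s ^ 3) • (matA n P r w⁻¹ + (2 * s) • matB n P r w)) i j) v := by
    intro i j
    simp only [matT, Matrix.add_apply, Matrix.smul_apply, smul_eq_mul]
    have h1 := hasDerivAt_rootTime_inv hα hv
    refine (((hasDerivAt_const v _).add (h1.mul_const _)).add
      ((h1.pow 2).mul_const _)).congr_deriv ?_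
    simp only [← hν, ← ht, ← hs]
    push_cast
    ring
  have hTT : matT n P r s w * matQ P r s w = matErr n P r s w := by
    rw [matQ, Matrix.mul_nonsing_inv_cancel_left]
    exact (Matrix.isUnit_iff_isUnit_det _).1 hT
  have hmat : -(ν * s ^ 3) • (matA n P r w⁻¹ + (2 * s) • matB n P r w) +
      matT n P r s w * (ν • M₁) = ν • (matN n P r s w * matT n P r s w) := by
    have h1 := matN_mul_matT P hr s w
    have h2 : matT n P r s w * M₁ =
        matT n P r s w * (matLam n r + s • matBeta n P r w + s ^ 2 • matRho n P r w) +
        s ^ 3 • matErr n P r s w := by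
      rw [hM₁, mul_add, Matrix.mul_smul _ (s ^ 3), hTT]
    rw [Matrix.mul_smul, h2, ← h1]
    module
  have hY : ∀ i, HasDerivAt (fun v => ((matS n r * matT n P r (rootTime α v)⁻¹ w) *ᵥ X v) i)
      ((ν • (scaledMat n P s w *ᵥ ((matS n r * matT n P r s w) *ᵥ X v))) i) v := by
    intro i
    have hZ := hasDerivAt_mulVec hTd hX
    have hY := hasDerivAt_mulVec (M := fun _ => matS n r) (M' := 0)
      (fun i j => hasDerivAt_const v _) hZ i
    simp only [← Matrix.mulVec_mulVec] at hY ⊢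
    refine hY.congr_deriv ?_
    have e : (-(ν * s ^ 3) • (matA n P r w⁻¹ + (2 * s) • matB n P r w)) *ᵥ X v +
        matT n P r s w *ᵥ (ν • M₁ *ᵥ X v) = ν • (matN n P r s w *ᵥ (matT n P r s w *ᵥ X v)) := by
      rw [← Matrix.smul_mulVec, Matrix.mulVec_mulVec, ← Matrix.add_mulVec, hmat,
        Matrix.smul_mulVec, Matrix.mulVec_mulVec]
    have e' : matS n r *ᵥ (matN n P r s w *ᵥ (matT n P r s w *ᵥ X v)) =
        scaledMat n P s w *ᵥ (matS n r *ᵥ (matT n P r s w *ᵥ X v)) := by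
      rw [Matrix.mulVec_mulVec, ← scaledMat_mul_matS hP hlead hr hroot, ← Matrix.mulVec_mulVec]
    change ((0 : Matrix (Fin n) (Fin n) ℂ) *ᵥ _ + matS n r *ᵥ
      ((-(ν * s ^ 3) • (matA n P r w⁻¹ + (2 * s) • matB n P r w)) *ᵥ X v +
        matT n P r s w *ᵥ (ν • M₁ *ᵥ X v))) i = _
    rw [Matrix.zero_mulVec, zero_add, e, Matrix.mulVec_smul, e']
  have hF := ((hasDerivAt_rootTime hα hv).pow (i : ℕ)).mul (hY i)
  refine hF.congr_deriv ?_
  set Y := (matS n r * matT n P r s w) *ᵥ X v with hYdef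
  simp only [Pi.pow_apply, ← hν, ← ht, ← hs]
  have e4 : ∀ j, compMat n P t w i j * systemSolution n P r α k x j v w =
      t ^ (i : ℕ) * t * (scaledMat n P s w i j * Y j) +
        (if i = j then ((i : ℕ) : ℂ) * t ^ ((i : ℕ) - 1) else 0) * Y j := by
    intro j
    have : systemSolution n P r α k x j v w = t ^ (j : ℕ) * Y j := rfl
    rw [this, ← mul_assoc, compMat_scaling hn hP ht0]
    ring
  simp only [e4, Finset.sum_add_distrib, ← Finset.mul_sum, ite_mul, zero_mul,
    Finset.sum_ite_eq, Finset.mem_univ, if_true, Pi.smul_apply, smul_eq_mul]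
  have e5 : (scaledMat n P s w *ᵥ Y) i = ∑ j, scaledMat n P s w i j * Y j := rfl
  rw [← e5]
  have e6 : s * t = 1 := inv_mul_cancel₀ ht0
  linear_combination (-(ν * t ^ (i : ℕ) * (scaledMat n P s w *ᵥ Y) i)) * e6

/-- Solutions close to the unit vectors are linearly independent, because their matrix is strictly
diagonally dominant. -/
lemma linearIndependent_systemSolution {n : ℕ} (hn : 2 ≤ n) {P : ℕ → NCPoly} {r : Fin n → ℂ}
    (hr : Function.Injective r) {α : ℂ} (hα : α ≠ 0) {x : Fin n → Fin n → ℂ → ℂ → ℂ} {v w : ℂ}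
    (hv : 0 < v.re) (hT : IsUnit (matT n P r (rootTime α v)⁻¹ w))
    (hx : ∀ k j, ‖x k j v w - if j = k then 1 else 0‖ ≤ 1 / (2 * n)) :
    LinearIndependent ℂ fun k i => systemSolution n P r α k (x k) i v w := by
  have hn0 : (0 : ℝ) < n := by exact_mod_cast (by omega : 0 < n)
  have hxdet : IsUnit (Matrix.of fun j k => x k j v w : Matrix (Fin n) (Fin n) ℂ) := by
    rw [Matrix.isUnit_iff_isUnit_det, isUnit_iff_ne_zero]
    refine det_ne_zero_of_sum_row_lt_diag fun j => ?_
    have h1 : ∀ k ∈ Finset.univ.erase j, ‖x k j v w‖ ≤ 1 / (2 * n) := by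
      intro k hk
      have := hx k j
      rwa [if_neg (Finset.ne_of_mem_erase hk).symm, sub_zero] at this
    have h2 : 1 - 1 / (2 * n) ≤ ‖x j j v w‖ := by
      have := hx j j
      rw [if_pos rfl, norm_sub_rev] at this
      have h3 := norm_sub_norm_le (1 : ℂ) (x j j v w)
      rw [norm_one] at h3
      linarith
    simp only [Matrix.of_apply]
    refine lt_of_le_of_lt (Finset.sum_le_card_nsmul _ _ _ h1) (lt_of_lt_of_le ?_ h2)
    rw [Finset.card_erase_of_mem (Finset.mem_univ j), Finset.card_univ, Fintype.card_fin,
      nsmul_eq_mul, Nat.cast_sub (by omega), Nat.cast_one, mul_one_div,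
      div_lt_iff₀ (by positivity), sub_mul, div_mul_cancel₀ _ (by positivity)]
    linarith
  set M : Matrix (Fin n) (Fin n) ℂ := (Matrix.diagonal fun i : Fin n => rootTime α v ^ (i : ℕ)) *
    (matS n r * matT n P r (rootTime α v)⁻¹ w) * (Matrix.of fun j k => x k j v w) *
    Matrix.diagonal fun k => Complex.exp (halfPlanePhase n P r α k v w) with hM
  have hMu : IsUnit M := by
    refine IsUnit.mul (IsUnit.mul (IsUnit.mul ?_ (IsUnit.mul ?_ hT)) hxdet) ?_
    · rw [Matrix.isUnit_iff_isUnit_det, Matrix.det_diagonal, isUnit_iff_ne_zero]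
      exact Finset.prod_ne_zero_iff.2 fun i _ => pow_ne_zero _ (rootTime_ne_zero hα hv)
    · exact (Matrix.isUnit_iff_isUnit_det _).2 (isUnit_det_matS hr)
    · rw [Matrix.isUnit_iff_isUnit_det, Matrix.det_diagonal, isUnit_iff_ne_zero]
      exact Finset.prod_ne_zero_iff.2 fun i _ => Complex.exp_ne_zero _
  have hcols : M.col = fun k i => systemSolution n P r α k (x k) i v w := by
    funext k i
    simp only [Matrix.col_apply, hM, Matrix.mul_diagonal]
    rw [mul_assoc (Matrix.diagonal _), Matrix.diagonal_mul, systemSolution, Matrix.mul_apply,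
      Matrix.mulVec, dotProduct, mul_assoc, Finset.sum_mul]
    simp only [Matrix.of_apply, mul_assoc]
  rw [← hcols]
  exact Matrix.linearIndependent_cols_iff_isUnit.2 hMu

/-- For every parameter the companion system has a basis of solutions on a right half-plane in the
variable `v = t² / α²`, of the size prescribed by the phases and holomorphic in the parameter. -/
theorem exists_systemSolutions {n : ℕ} (hn : 2 ≤ n) {P : ℕ → NCPoly}
    (hP : ∀ l, l ≤ n → IsHomog l (P l)) (hlead : evalAtZero (P n) = Polynomial.X ^ n)
    {r : Fin n → ℂ} (hr : Function.Injective r) (hroot : ∀ k, (evalAtOne (P n)).IsRoot (r k))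
    {α : ℂ} (hα : α ≠ 0) (hgen : ∀ j k, j ≠ k → (α ^ 2 / 2 * (r j - r k)).im ≠ 0) :
    ∃ (H : ℕ → ℝ) (F : Fin n → Fin n → ℂ → ℂ → ℂ), (∀ m, 1 ≤ H m) ∧
      (∀ k i v, DifferentiableOn ℂ (fun w => F k i v w) {w | (v, w) ∈ halfPlanes H}) ∧
      (∀ k i v w, (v, w) ∈ halfPlanes H → HasDerivAt (fun v => F k i v w)
        (α ^ 2 / 2 * (rootTime α v)⁻¹ * ∑ j, compMat n P (rootTime α v) w i j * F k j v w) v) ∧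
      (∀ m : ℕ, ∃ C, 0 ≤ C ∧ ∀ v w : ℂ, ‖w‖ < m → H m < v.re → ∀ k (i : Fin n), (i : ℕ) = 0 →
        ‖F k i v w‖ ≤ C * ‖Complex.exp (halfPlanePhase n P r α k v w)‖) ∧
      ∀ v w, (v, w) ∈ halfPlanes H → LinearIndependent ℂ fun k i => F k i v w := by
  have hn0 : (0 : ℝ) < n := by exact_mod_cast (by omega : 0 < n)
  have hn1 : (1 : ℝ) ≤ n := by exact_mod_cast (by omega : 1 ≤ n)
  have hβ := fun j => differentiable_betaCoef_inv P r j
  have hρ := fun j => differentiable_rhoCoef_inv P r j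
  choose δ hδ K hK0 hK using fun m : ℕ => exists_bound_matQ P r m
  obtain ⟨H, hH1, hHs, hsol⟩ := exists_halfPlane_solutions hα hgen hβ hρ hδ hK0
    (fun m s w hw hs i j => (hK m s w hw hs).2 i j)
    (fun m s w hw hs => differentiableAt_matQ_left P r (hK m s w hw hs).1)
    (fun m s w hw hs => differentiableAt_matQ_right P r (hK m s w hw hs).1) (q := 1 / (4 * n))
    (by positivity)
    (by rw [div_le_div_iff₀ (by positivity) (by norm_num)]; linarith)
  choose x hxv hxw hxδ hxd using hsol
  have hq : 2 * (1 / (4 * (n : ℝ))) = 1 / (2 * n) := by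
    field_simp
    norm_num
  simp only [hq] at hxδ
  have hTunit : ∀ v w, (v, w) ∈ halfPlanes H → IsUnit (matT n P r (rootTime α v)⁻¹ w) := by
    rintro v w ⟨m, hw, hv⟩
    exact (hK m _ w hw (hHs m v hv).1).1
  have hre : ∀ v w, (v, w) ∈ halfPlanes H → 0 < v.re := by
    rintro v w ⟨m, hw, hv⟩
    have : H m < v.re := hv
    linarith [hH1 m]
  refine ⟨H, fun k i v w => systemSolution n P r α k (x k) i v w, hH1, ?_, ?_, ?_, ?_⟩
  · intro k i v
    simp only [systemSolution, Matrix.mulVec, dotProduct]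
    refine DifferentiableOn.const_mul (DifferentiableOn.fun_sum fun j _ =>
      DifferentiableOn.mul ?_ (DifferentiableOn.mul (hxw k j v) ?_)) _
    · exact (differentiable_matS_mul_matT_apply P r _ i j).differentiableOn
    · refine Differentiable.differentiableOn (Differentiable.cexp ?_)
      have h := ((differentiable_const (r k * (α ^ 2 / 2) * v)).add
        ((hβ k).mul_const (rootTime α v))).add (((hρ k).mul_const 2⁻¹).mul_const (Complex.log v))
      exact h
  · intro k i v w hvw
    exact hasDerivAt_systemSolution hn hP hlead hr hroot hα (hre v w hvw) (hTunit v w hvw)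
      (fun j => hxd k j v w hvw) i
  · intro m
    obtain ⟨C, hC0, hC⟩ := exists_bound_matS_mul_matT P r m
    refine ⟨n * (C * 2), by positivity, fun v w hw hv k i hi => ?_⟩
    have hvw : (v, w) ∈ halfPlanes H := ⟨m, hw, hv⟩
    simp only [systemSolution, hi, pow_zero, one_mul, Matrix.mulVec, dotProduct]
    have hterm : ∀ j ∈ Finset.univ, ‖(matS n r * matT n P r (rootTime α v)⁻¹ w) i j *
        (x k j v w * Complex.exp (halfPlanePhase n P r α k v w))‖ ≤
        C * 2 * ‖Complex.exp (halfPlanePhase n P r α k v w)‖ := by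
      intro j _
      rw [norm_mul, norm_mul, ← mul_assoc]
      have h2 : ‖x k j v w‖ ≤ 2 := by
        have h3 := hxδ k j v w hvw
        have h4 : ‖(if j = k then 1 else 0 : ℂ)‖ ≤ 1 := by split_ifs <;> simp
        have h5 := norm_sub_norm_le (x k j v w) (if j = k then 1 else 0)
        have h6 : 1 / (2 * (n : ℝ)) ≤ 1 := by
          rw [div_le_one (by positivity)]
          linarith
        linarith
      gcongr
      exact hC _ w (hHs m v hv).2 hw.le i j
    refine (norm_sum_le_of_le _ hterm).trans (le_of_eq ?_)
    rw [Finset.sum_const, Finset.card_univ, Fintype.card_fin, nsmul_eq_mul]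
    ring
  · intro v w hvw
    exact linearIndependent_systemSolution hn hr hα (hre v w hvw) (hTunit v w hvw)
      fun k j => hxδ k j v w hvw

end SystemSolutions

/-! ### The entire fundamental solution and the kernel -/

section Fundamental

open Matrix Filter Topology

/-- The coefficient of `t ^ a` in the companion matrix. -/
def compCoef (n : ℕ) (P : ℕ → NCPoly) (a : ℕ) (w : ℂ) : Matrix (Fin n) (Fin n) ℂ :=
  Matrix.of fun i j => if (i : ℕ) + 1 = n then
      -∑ l ∈ Finset.range (n + 1), w ^ (n - l) * coefTD (P l) a j
    else if (j : ℕ) = i + 1 ∧ a = 0 then 1 else 0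

lemma compMat_eq_sum (n : ℕ) (P : ℕ → NCPoly) (t w : ℂ) :
    compMat n P t w = ∑ a ∈ Finset.range (n + 1), t ^ a • compCoef n P a w := by
  ext i j
  simp only [compMat, compCoef, Matrix.sum_apply, Matrix.smul_apply, Matrix.of_apply, smul_eq_mul]
  split_ifs with h1 h2
  · rw [odeCoef, Finset.sum_comm, ← Finset.sum_neg_distrib]
    refine Finset.sum_congr rfl fun a _ => ?_
    rw [← Finset.sum_mul]
    ring
  · simp [h2]
  · simp [h2]

/-- Operators on `ℂⁿ`. -/
abbrev VecOp (n : ℕ) : Type := (Fin n → ℂ) →L[ℂ] (Fin n → ℂ)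

/-- The operator of multiplication by a matrix. -/
def mulVecOp (n : ℕ) : Matrix (Fin n) (Fin n) ℂ →ₗ[ℂ] VecOp n :=
  LinearMap.toContinuousLinearMap.toLinearMap ∘ₗ (Matrix.toLin' (R := ℂ)).toLinearMap

lemma differentiable_mulVecOp {n : ℕ} {f : ℂ → Matrix (Fin n) (Fin n) ℂ}
    (hf : ∀ i j, Differentiable ℂ fun z => f z i j) :
    Differentiable ℂ fun z => mulVecOp n (f z) := by
  have : (fun z => mulVecOp n (f z)) =
      fun z => ∑ i, ∑ j, f z i j • mulVecOp n (Matrix.single i j (1 : ℂ)) := by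
    funext z
    conv_lhs => rw [Matrix.matrix_eq_sum_single (f z)]
    simp only [map_sum, ← map_smul, Matrix.smul_single, smul_eq_mul, mul_one]
  rw [this]
  exact Differentiable.fun_sum fun i _ => Differentiable.fun_sum fun j _ =>
    (hf i j).smul_const _

/-- The companion system has a fundamental solution, which is invertible and entire in `t` and in
the parameter. The inverse is constructed as the solution of the adjoint system. -/
theorem exists_fundamental_solution (n : ℕ) (P : ℕ → NCPoly) :
    ∃ Ψ Θ : ℂ → ℂ → VecOp n, (∀ w, Ψ 0 w = 1) ∧
      (∀ t w, Θ t w * Ψ t w = 1) ∧ (∀ t w, Ψ t w * Θ t w = 1) ∧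
      (∀ t w, HasDerivAt (fun t => Ψ t w) (mulVecOp n (compMat n P t w) * Ψ t w) t) ∧
      (∀ t w, HasDerivAt (fun t => Θ t w) (-(Θ t w * mulVecOp n (compMat n P t w))) t) ∧
      (∀ t, Differentiable ℂ (Ψ t)) ∧ (∀ t, Differentiable ℂ (Θ t)) ∧
      ∀ R : ℝ, ∃ C, ∀ t w, ‖t‖ ≤ R → ‖w‖ ≤ R → ‖Ψ t w‖ ≤ C := by
  have hcoef : ∀ a, Differentiable ℂ fun w => mulVecOp n (compCoef n P a w) := by
    intro a
    refine differentiable_mulVecOp fun i j => ?_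
    simp only [compCoef, Matrix.of_apply]
    split_ifs <;> fun_prop
  have hsum : ∀ t w, mulVecOp n (compMat n P t w) =
      ∑ a ∈ Finset.range (n + 1), t ^ a • mulVecOp n (compCoef n P a w) := by
    intro t w
    rw [compMat_eq_sum]
    simp only [map_sum, map_smul]
  obtain ⟨Ψ, hΨ0, hΨd, hΨw, hΨb⟩ := exists_entire_solution
    (fun a w => if a ≤ n then ContinuousLinearMap.compL ℂ (Fin n → ℂ) (Fin n → ℂ) (Fin n → ℂ)
      (mulVecOp n (compCoef n P a w))
      else 0) (n + 1) (fun a w ha => if_neg (by omega)) (fun a => by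
        split_ifs
        · exact (ContinuousLinearMap.compL ℂ (Fin n → ℂ) (Fin n → ℂ)
            (Fin n → ℂ)).differentiable.comp (hcoef a)
        · exact differentiable_const _) (1 : VecOp n)
  obtain ⟨Θ, hΘ0, hΘd, hΘw, -⟩ := exists_entire_solution
    (fun a w => if a ≤ n then
      -((ContinuousLinearMap.compL ℂ (Fin n → ℂ) (Fin n → ℂ) (Fin n → ℂ)).flip
        (mulVecOp n (compCoef n P a w)))
      else 0) (n + 1) (fun a w ha => if_neg (by omega)) (fun a => by
        split_ifs
        · exact ((ContinuousLinearMap.compL ℂ (Fin n → ℂ) (Fin n → ℂ)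
            (Fin n → ℂ)).flip.differentiable.comp (hcoef a)).neg
        · exact differentiable_const _) (1 : VecOp n)
  have hΨd' : ∀ t w, HasDerivAt (fun t => Ψ t w) (mulVecOp n (compMat n P t w) * Ψ t w) t := by
    intro t w
    refine (hΨd t w).congr_deriv ?_
    rw [hsum, Finset.sum_mul]
    refine Finset.sum_congr rfl fun a ha => ?_
    rw [if_pos (Nat.lt_succ_iff.1 (Finset.mem_range.1 ha))]
    rfl
  have hΘd' : ∀ t w, HasDerivAt (fun t => Θ t w)
      (-(Θ t w * mulVecOp n (compMat n P t w))) t := by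
    intro t w
    refine (hΘd t w).congr_deriv ?_
    rw [hsum, Finset.mul_sum, ← Finset.sum_neg_distrib]
    refine Finset.sum_congr rfl fun a ha => ?_
    rw [if_pos (Nat.lt_succ_iff.1 (Finset.mem_range.1 ha))]
    ext1 y
    change t ^ a • -(Θ t w (mulVecOp n (compCoef n P a w) y)) =
      -(Θ t w (t ^ a • mulVecOp n (compCoef n P a w) y))
    rw [map_smul, smul_neg]
  have hleft : ∀ t w, Θ t w * Ψ t w = 1 := by
    intro t w
    have hd : ∀ t, HasDerivAt (fun t => Θ t w * Ψ t w) 0 t := by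
      intro t
      refine ((hΘd' t w).clm_comp (hΨd' t w)).congr_deriv ?_
      ext1 y
      exact neg_add_cancel (Θ t w (mulVecOp n (compMat n P t w) (Ψ t w y)))
    have := is_const_of_deriv_eq_zero (fun t => (hd t).differentiableAt)
      (fun t => (hd t).deriv) t 0
    rw [this, hΨ0, hΘ0, mul_one]
  -- in finite dimension a left inverse is a right inverse
  have hright : ∀ t w, Ψ t w * Θ t w = 1 := by
    intro t w
    have hinj : Function.Injective (Ψ t w : (Fin n → ℂ) →ₗ[ℂ] (Fin n → ℂ)) := by
      refine Function.LeftInverse.injective (g := Θ t w) fun y => ?_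
      exact ContinuousLinearMap.ext_iff.1 (hleft t w) y
    have hsurj := LinearMap.injective_iff_surjective.1 hinj
    ext1 y
    obtain ⟨z, rfl⟩ := hsurj y
    have := ContinuousLinearMap.ext_iff.1 (hleft t w) z
    change Ψ t w (Θ t w (Ψ t w z)) = Ψ t w z
    exact congrArg (Ψ t w) this
  exact ⟨Ψ, Θ, hΨ0, hleft, hright, hΨd', hΘd', hΨw, hΘw, hΨb⟩

/-- The derivatives of the restriction to `ℝ` of an entire function. -/
lemma iteratedDeriv_comp_ofReal {f : ℂ → ℂ} (hf : Differentiable ℂ f) (j : ℕ) :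
    iteratedDeriv j (fun t : ℝ => f t) = fun t : ℝ => iteratedDeriv j f t := by
  induction j with
  | zero => simp
  | succ j ih =>
    rw [iteratedDeriv_succ, ih, iteratedDeriv_succ]
    funext t
    have hd : Differentiable ℂ (iteratedDeriv j f) :=
      (hf.contDiff (n := ⊤)).differentiable_iteratedDeriv j (by exact_mod_cast WithTop.coe_lt_top _)
    exact (hd t).hasDerivAt.comp_ofReal.deriv

/-- The restriction of an entire function to `ℝ`. -/
def ofEntire (f : ℂ → ℂ) (hf : Differentiable ℂ f) : Smooth :=
  ⟨fun t => f t, by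
    have h : ContDiff ℝ ∞ (f ∘ Complex.ofRealCLM) :=
      (hf.contDiff.restrict_scalars ℝ).comp Complex.ofRealCLM.contDiff
    exact h⟩

/-- The Cauchy data at `0` of a smooth function. -/
def cauchyData (n : ℕ) : Smooth →ₗ[ℂ] (Fin n → ℂ) :=
  LinearMap.pi fun i => LinearMap.proj (0 : ℝ) ∘ₗ Smooth.subtype ∘ₗ (opT ^ (i : ℕ))

lemma cauchyData_apply {n : ℕ} (f : Smooth) (i : Fin n) :
    cauchyData n f i = iteratedDeriv i f.1 0 := by
  rw [← opT_pow_apply]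
  rfl

lemma compMat_mulVec_of_lt {n : ℕ} {P : ℕ → NCPoly} {t w : ℂ} {y : Fin n → ℂ} {i : Fin n}
    (hi : (i : ℕ) + 1 < n) : (compMat n P t w *ᵥ y) i = y ⟨i + 1, hi⟩ := by
  simp only [compMat, Matrix.mulVec, dotProduct, Matrix.of_apply, if_neg hi.ne]
  rw [Finset.sum_eq_single (⟨i + 1, hi⟩ : Fin n)]
  · simp
  · intro j _ hj
    rw [if_neg fun h => hj (Fin.ext h), zero_mul]
  · simp

lemma compMat_mulVec_of_eq {n : ℕ} {P : ℕ → NCPoly} {t w : ℂ} {y : Fin n → ℂ} {i : Fin n}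
    (hi : (i : ℕ) + 1 = n) : (compMat n P t w *ᵥ y) i = -∑ j : Fin n, odeCoef n P j t w * y j := by
  simp only [compMat, Matrix.mulVec, dotProduct, Matrix.of_apply, if_pos hi, neg_mul,
    Finset.sum_neg_distrib]

/-- The components of a solution of the companion system are the derivatives of the first one, and
this first component solves the scalar equation. -/
lemma companion_solution {n : ℕ} (hn : 2 ≤ n) {P : ℕ → NCPoly}
    (hP : ∀ l, l ≤ n → IsHomog l (P l)) (hlead : evalAtZero (P n) = Polynomial.X ^ n)
    {w : ℂ} {y : ℂ → Fin n → ℂ}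
    (hy : ∀ t, HasDerivAt y (mulVecOp n (compMat n P t w) (y t)) t)
    (hf : Differentiable ℂ fun t => y t ⟨0, by omega⟩) :
    (∀ (i : Fin n) (t : ℝ), iteratedDeriv i (ofEntire _ hf).1 t = y t i) ∧
      ofEntire _ hf ∈ LinearMap.ker (opL n P w⁻¹) := by
  have hyi : ∀ (i : Fin n) (t : ℝ), HasDerivAt (fun t : ℝ => y t i)
      ((compMat n P t w *ᵥ y t) i) t := fun i t => (hasDerivAt_pi.1 (hy t) i).comp_ofReal
  have hcomp : ∀ (i : ℕ) (hi : i < n),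
      iteratedDeriv i (ofEntire _ hf).1 = fun t : ℝ => y t ⟨i, hi⟩ := by
    intro i
    induction i with
    | zero =>
      intro hi
      rw [iteratedDeriv_zero]
      rfl
    | succ i ih =>
      intro hi
      rw [iteratedDeriv_succ, ih (by omega)]
      funext t
      rw [(hyi ⟨i, by omega⟩ t).deriv, compMat_mulVec_of_lt hi]
  refine ⟨fun i t => congrFun (hcomp i i.2) t, (mem_ker_opL hP hlead _ _).2 fun t => ?_⟩
  have hlast : iteratedDeriv n (ofEntire _ hf).1 t =
      (compMat n P t w *ᵥ y t) ⟨n - 1, by omega⟩ := by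
    rw [← congrArg (fun k => iteratedDeriv k (ofEntire _ hf).1 t)
      (show (n - 1) + 1 = n by omega)]
    simp only [iteratedDeriv_succ]
    rw [hcomp (n - 1) (by omega)]
    exact (hyi ⟨n - 1, by omega⟩ t).deriv
  rw [hlast, compMat_mulVec_of_eq (by simp; omega), inv_inv, ← Fin.sum_univ_eq_sum_range
    (fun j => odeCoef n P j t w * iteratedDeriv j (ofEntire _ hf).1 t)]
  refine congrArg Neg.neg (Finset.sum_congr rfl fun j _ => ?_)
  rw [hcomp j j.2]

/-- A solution of the scalar equation is determined by its Cauchy data through the fundamental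
solution. -/
lemma eq_fundamental_of_mem_ker {n : ℕ} (hn : 2 ≤ n) {P : ℕ → NCPoly}
    (hP : ∀ l, l ≤ n → IsHomog l (P l)) (hlead : evalAtZero (P n) = Polynomial.X ^ n)
    {w : ℂ} {Ψ Θ : ℂ → VecOp n} (hΨ0 : Ψ 0 = 1) (hleft : ∀ t, Θ t * Ψ t = 1)
    (hright : ∀ t, Ψ t * Θ t = 1)
    (hΘ : ∀ t, HasDerivAt Θ (-(Θ t * mulVecOp n (compMat n P t w))) t)
    {f : Smooth} (hf : f ∈ LinearMap.ker (opL n P w⁻¹)) (t : ℝ) :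
    f.1 t = Ψ t (cauchyData n f) ⟨0, by omega⟩ := by
  rw [mem_ker_opL hP hlead] at hf
  set V : ℝ → Fin n → ℂ := fun t i => iteratedDeriv i f.1 t with hV
  have hfs : ContDiff ℝ ∞ f.1 := f.2
  have hVd : ∀ t : ℝ, HasDerivAt V (compMat n P t w *ᵥ V t) t := by
    intro t
    refine hasDerivAt_pi.2 fun i => ?_
    have h1 : HasDerivAt (iteratedDeriv i f.1) (iteratedDeriv (i + 1) f.1 t) t := by
      rw [iteratedDeriv_succ]
      exact (hfs.differentiable_iteratedDeriv i
        (by exact_mod_cast WithTop.coe_lt_top _) t).hasDerivAt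
    refine h1.congr_deriv ?_
    rcases Nat.lt_or_ge ((i : ℕ) + 1) n with hi | hi
    · rw [compMat_mulVec_of_lt hi]
    · have hi' : (i : ℕ) + 1 = n := by omega
      rw [compMat_mulVec_of_eq hi', hi', hf t, inv_inv, ← Fin.sum_univ_eq_sum_range
        (fun j => odeCoef n P j t w * iteratedDeriv j f.1 t)]
  have hd : ∀ t : ℝ, HasDerivAt (fun t : ℝ => Θ t (V t)) 0 t := by
    intro t
    have h1 : HasDerivAt (fun t : ℝ => (Θ t).restrictScalars ℝ)
        ((-(Θ t * mulVecOp n (compMat n P t w))).restrictScalars ℝ) t :=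
      ((ContinuousLinearMap.restrictScalarsL ℂ (Fin n → ℂ) (Fin n → ℂ) ℝ ℝ).hasFDerivAt
        ).comp_hasDerivAt t ((hΘ t).scomp t Complex.ofRealCLM.hasDerivAt |>.congr_deriv
          (one_smul _ _))
    refine (h1.clm_apply (hVd t)).congr_deriv ?_
    change -(Θ t (compMat n P t w *ᵥ V t)) + Θ t (compMat n P t w *ᵥ V t) = 0
    exact neg_add_cancel _
  have hconst := is_const_of_deriv_eq_zero (fun t => (hd t).differentiableAt)
    (fun t => (hd t).deriv) t 0
  have hΘ0 : Θ 0 = 1 := by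
    have := hleft 0
    rwa [hΨ0, mul_one] at this
  have hV0 : V 0 = cauchyData n f := by
    funext i
    exact (cauchyData_apply f i).symm
  simp only [Complex.ofReal_zero, hΘ0, hV0] at hconst
  have h2 : V t = Ψ t (cauchyData n f) := by
    have := ContinuousLinearMap.ext_iff.1 (hright t) (V t)
    change Ψ t (Θ t (V t)) = V t at this
    rw [← this, hconst]
    rfl
  rw [← h2]
  simp [hV]

end Fundamental

/-! ### Cauchy data of the solutions with prescribed asymptotics -/

section CauchyData

open Matrix Filter Topology

/-- The square of `μ` is chosen on the line `1 + i ℝ`, outside the finitely many points at which one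
of the phase differences becomes real. -/
lemma exists_square_root_direction {n : ℕ} {r : Fin n → ℂ} (hr : Function.Injective r) :
    ∃ μ : ℂ, 0 < μ.re ∧ 0 < ((μ ^ 2)⁻¹).re ∧
      ∀ j k, j ≠ k → (μ ^ 2 / 2 * (r j - r k)).im ≠ 0 := by
  obtain ⟨ε, hε⟩ := Infinite.exists_notMem_finset
    (Finset.univ.image fun p : Fin n × Fin n => -((r p.1 - r p.2).im / (r p.1 - r p.2).re))
  obtain ⟨μ, hμ⟩ : ∃ μ : ℂ, μ ^ 2 = 1 + ε * Complex.I :=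
    ⟨(1 + ε * Complex.I) ^ (2⁻¹ : ℂ), cpow_half_sq _⟩
  have hre : (μ ^ 2).re = 1 := by simp [hμ]
  have him : (μ ^ 2).im = ε := by simp [hμ]
  have hgood : 0 < ((μ ^ 2)⁻¹).re ∧ ∀ j k, j ≠ k → (μ ^ 2 / 2 * (r j - r k)).im ≠ 0 := by
    constructor
    · rw [Complex.inv_re, hre, Complex.normSq_apply, hre]
      exact div_pos one_pos (by nlinarith [mul_self_nonneg (μ ^ 2).im])
    · intro j k hjk h0
      have hc : r j - r k ≠ 0 := sub_ne_zero.2 fun h => hjk (hr h)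
      have h1 : (μ ^ 2 / 2 * (r j - r k)).im =
          ((r j - r k).im + ε * (r j - r k).re) / 2 := by
        rw [hμ]
        simp [Complex.mul_im]
        ring
      have h2 : (r j - r k).im + ε * (r j - r k).re = 0 := by linarith [h1.symm.trans h0]
      have h3 : (r j - r k).re ≠ 0 := by
        intro h3
        rw [h3, mul_zero, add_zero] at h2
        exact hc (Complex.ext h3 h2)
      refine hε (Finset.mem_image.2 ⟨(j, k), Finset.mem_univ _, ?_⟩)
      change -((r j - r k).im / (r j - r k).re) = ε
      field_simp
      linarith
  have hre0 : μ.re ≠ 0 := by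
    intro h
    rw [sq, Complex.mul_re, h] at hre
    nlinarith [mul_self_nonneg μ.im]
  rcases lt_or_gt_of_ne hre0 with h | h
  · refine ⟨-μ, by simpa using h, ?_⟩
    simpa only [neg_sq] using hgood
  · exact ⟨μ, h, hgood⟩

/-- The sections of `halfPlanes H` at a fixed parameter are nested unions of half-planes, so that a
function whose derivative vanishes there is constant. -/
lemma eq_of_hasDerivAt_zero_halfPlanes {n : ℕ} {H : ℕ → ℝ} {w : ℂ} {f : ℂ → Fin n → ℂ}
    (hf : ∀ v, (v, w) ∈ halfPlanes H → HasDerivAt f 0 v) {v₁ v₂ : ℂ}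
    (h₁ : (v₁, w) ∈ halfPlanes H) (h₂ : (v₂, w) ∈ halfPlanes H) : f v₁ = f v₂ := by
  obtain ⟨m₁, hw₁, hv₁⟩ := mem_halfPlanes.1 h₁
  obtain ⟨m₂, hw₂, hv₂⟩ := mem_halfPlanes.1 h₂
  have key : ∀ m : ℕ, ‖w‖ < m → H m < v₁.re → H m < v₂.re → f v₁ = f v₂ := by
    intro m hm h1 h2
    have hd : ∀ v ∈ {v : ℂ | H m < v.re}, HasDerivAt f 0 v := fun v hv =>
      hf v (mem_halfPlanes.2 ⟨m, hm, hv⟩)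
    exact (isOpen_lt continuous_const Complex.continuous_re).is_const_of_deriv_eq_zero
      (convex_halfSpace_re_gt (H m)).isPreconnected
      (fun v hv => (hd v hv).differentiableAt.differentiableWithinAt)
      (fun v hv => (hd v hv).deriv) h1 h2
  rcases le_total (H m₁) (H m₂) with h | h
  · exact key m₁ hw₁ hv₁ (h.trans_lt hv₂)
  · exact key m₂ hw₂ (h.trans_lt hv₁) hv₂

/-- Solutions on `halfPlanes H`, written in the variable `v`, are continued to all times by the
fundamental solution; their Cauchy data at time `0` are entire functions of the parameter. -/
theorem exists_cauchyData {n : ℕ} {P : ℕ → NCPoly} {α : ℂ} (hα : α ≠ 0) {H : ℕ → ℝ}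
    (hH : ∀ m, 1 ≤ H m) {F : Fin n → Fin n → ℂ → ℂ → ℂ}
    (hFw : ∀ k i v, DifferentiableOn ℂ (fun w => F k i v w) {w | (v, w) ∈ halfPlanes H})
    (hFv : ∀ k i v w, (v, w) ∈ halfPlanes H → HasDerivAt (fun v => F k i v w)
      (α ^ 2 / 2 * (rootTime α v)⁻¹ * ∑ j, compMat n P (rootTime α v) w i j * F k j v w) v)
    (hF : ∀ v w, (v, w) ∈ halfPlanes H → LinearIndependent ℂ fun k i => F k i v w)
    {Ψ Θ : ℂ → ℂ → VecOp n} (hright : ∀ t w, Ψ t w * Θ t w = 1)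
    (hΘ : ∀ t w, HasDerivAt (fun t => Θ t w) (-(Θ t w * mulVecOp n (compMat n P t w))) t)
    (hΘw : ∀ t, Differentiable ℂ (Θ t)) :
    ∃ c : Fin n → ℂ → Fin n → ℂ, (∀ k, Differentiable ℂ (c k)) ∧
      (∀ w, LinearIndependent ℂ fun k => c k w) ∧
      ∀ k i v w, (v, w) ∈ halfPlanes H → F k i v w = Ψ (rootTime α v) w (c k w) i := by
  have hpos : ∀ {v w : ℂ}, (v, w) ∈ halfPlanes H → 0 < v.re := by
    intro v w h
    obtain ⟨m, -, hm⟩ := mem_halfPlanes.1 h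
    linarith [hH m]
  set y : Fin n → ℂ → ℂ → Fin n → ℂ := fun k v w i => F k i v w with hy
  set base : ℕ → ℂ := fun m => ((H m + 1 : ℝ) : ℂ) with hbase
  have hmem : ∀ {m : ℕ} {w : ℂ}, ‖w‖ < m → (base m, w) ∈ halfPlanes H := fun {m w} hw =>
    mem_halfPlanes.2 ⟨m, hw, by simp [hbase]⟩
  have hfloor : ∀ w : ℂ, ‖w‖ < (⌊‖w‖⌋₊ + 1 : ℕ) := fun w => by
    exact_mod_cast Nat.lt_floor_add_one ‖w‖
  set c : Fin n → ℂ → Fin n → ℂ := fun k w =>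
    Θ (rootTime α (base (⌊‖w‖⌋₊ + 1))) w (y k (base (⌊‖w‖⌋₊ + 1)) w) with hc
  -- the Cauchy data at time `0` of a solution do not depend on the time at which it is observed
  have hconst : ∀ k v w, (v, w) ∈ halfPlanes H → Θ (rootTime α v) w (y k v w) = c k w := by
    intro k v w hv
    refine eq_of_hasDerivAt_zero_halfPlanes (f := fun v => Θ (rootTime α v) w (y k v w))
      (fun v hv => ?_) hv (hmem (hfloor w))
    have h1 := (hΘ (rootTime α v) w).scomp v (hasDerivAt_rootTime hα (hpos hv))
    have h2 : HasDerivAt (fun v => y k v w) ((α ^ 2 / 2 * (rootTime α v)⁻¹) •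
        (compMat n P (rootTime α v) w *ᵥ y k v w)) v :=
      hasDerivAt_pi.2 fun i => hFv k i v w hv
    refine (h1.clm_apply h2).congr_deriv ?_
    change (α ^ 2 / 2 * (rootTime α v)⁻¹) •
      -(Θ (rootTime α v) w (compMat n P (rootTime α v) w *ᵥ y k v w)) +
      Θ (rootTime α v) w ((α ^ 2 / 2 * (rootTime α v)⁻¹) •
        (compMat n P (rootTime α v) w *ᵥ y k v w)) = 0
    rw [map_smul, smul_neg, neg_add_cancel]
  have hrep : ∀ k v w, (v, w) ∈ halfPlanes H → y k v w = Ψ (rootTime α v) w (c k w) := by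
    intro k v w hv
    rw [← hconst k v w hv]
    exact (ContinuousLinearMap.ext_iff.1 (hright (rootTime α v) w) (y k v w)).symm
  refine ⟨c, fun k w₀ => ?_, fun w => ?_, fun k i v w hv => congrFun (hrep k v w hv) i⟩
  · -- near `w₀` the base point in the definition of `c` can be kept fixed
    have hev : c k =ᶠ[𝓝 w₀] fun w => Θ (rootTime α (base (⌊‖w₀‖⌋₊ + 1))) w
        (y k (base (⌊‖w₀‖⌋₊ + 1)) w) := by
      filter_upwards [(isOpen_lt continuous_norm continuous_const).mem_nhds (hfloor w₀)] with w hw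
      exact (hconst k _ w (hmem hw)).symm
    refine DifferentiableAt.congr_of_eventuallyEq ?_ hev
    refine (hΘw _ w₀).clm_apply (differentiableAt_pi.2 fun i => ?_)
    refine (hFw k i (base (⌊‖w₀‖⌋₊ + 1))).differentiableAt ?_
    filter_upwards [(isOpen_lt continuous_norm continuous_const).mem_nhds (hfloor w₀)] with w hw
    exact hmem hw
  · refine LinearIndependent.of_comp (Ψ (rootTime α (base (⌊‖w‖⌋₊ + 1))) w : VecOp n).toLinearMap ?_
    have := hF _ _ (hmem (hfloor w))
    convert this using 1
    funext k
    exact (hrep k _ _ (hmem (hfloor w))).symm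

end CauchyData

/-! ### Estimates of derivatives by Cauchy's inequalities -/

section Estimates

/-- Derivatives on a disc are bounded by the bound of the function on a disc of larger radius. -/
lemma norm_iteratedDeriv_le_of_bounded {f : ℂ → ℂ} (hf : Differentiable ℂ f) {R C : ℝ}
    (hC : ∀ t, ‖t‖ ≤ R + 1 → ‖f t‖ ≤ C) (j : ℕ) {t : ℂ} (ht : ‖t‖ ≤ R) :
    ‖iteratedDeriv j f t‖ ≤ j.factorial * C := by
  have := Complex.norm_iteratedDeriv_le_of_forall_mem_sphere_norm_le j one_pos
    hf.diffContOnCl (c := t) (C := C) fun z hz => hC z (by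
      rw [mem_sphere_iff_norm] at hz
      calc ‖z‖ = ‖t + (z - t)‖ := by ring_nf
        _ ≤ ‖t‖ + ‖z - t‖ := norm_add_le _ _
        _ ≤ R + 1 := by rw [hz]; linarith)
  simpa using this

/-- The phase varies by a bounded amount when the real time `t` is replaced by a complex time
`t + ζ` with `‖ζ‖ ≤ (1 + |t|)⁻¹`, the corresponding `v` being `((t + ζ) / α) ^ 2`. -/
lemma halfPlane_shift {σ : ℝ} (hσ : σ = 1 ∨ σ = -1) {μ : ℂ} (hμ : 0 < μ.re)
    {t : ℝ} (ht1 : 1 ≤ σ * t) (htμ : ‖μ⁻¹‖ < (μ⁻¹).re * (σ * t)) {ζ : ℂ}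
    (hζ : ‖ζ‖ ≤ (1 + |t|)⁻¹) :
    ∃ v : ℂ, rootTime (σ * μ) v = t + ζ ∧
      (σ * t) ^ 2 * ((μ ^ 2)⁻¹).re - 3 * ‖(μ ^ 2)⁻¹‖ ≤ v.re ∧
      ‖(σ * μ) ^ 2 * v - (t : ℂ) ^ 2‖ ≤ 3 ∧
      ‖Complex.log v / 2 - (Real.log |t| : ℂ)‖ ≤ 4 * ‖μ ^ 2‖ + 4 * ‖(μ ^ 2)⁻¹‖ + Real.pi := by
  have hσσ : σ * σ = 1 := by rcases hσ with h | h <;> simp [h]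
  have hσc : (σ : ℂ) * σ = 1 := by exact_mod_cast hσσ
  have hσ0 : (σ : ℂ) ≠ 0 := left_ne_zero_of_mul_eq_one hσc
  have hμ0 : μ ≠ 0 := fun h => by simp [h] at hμ
  have hnσ : ‖(σ : ℂ)‖ = 1 := by rcases hσ with h | h <;> simp [h]
  set τ : ℝ := σ * t with hτ
  have habs : |t| = τ := by
    have : |τ| = |t| := by
      rw [hτ, abs_mul]
      rcases hσ with h | h <;> simp [h]
    rw [← this, abs_of_pos (by linarith)]
  rw [habs] at hζ
  have hτ0 : 0 < τ := by linarith
  have hζ1 : ‖ζ‖ ≤ 1 / 2 := hζ.trans (by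
    rw [inv_le_comm₀ (by linarith) (by norm_num)]
    linarith)
  have hζτ : ‖ζ‖ * τ ≤ 1 := by
    calc ‖ζ‖ * τ ≤ (1 + τ)⁻¹ * (1 + τ) :=
          mul_le_mul hζ (by linarith) hτ0.le (by positivity)
      _ = 1 := inv_mul_cancel₀ (by linarith)
  set x : ℂ := (τ + σ * ζ) * μ⁻¹ with hx
  have htx : (σ * μ) * x = t + ζ := by
    have : (τ : ℂ) = σ * t := by simp [hτ]
    rw [hx, this]
    field_simp
    linear_combination (t + ζ) * hσc
  have hxre : 0 < x.re := by
    have h1 : x.re = (μ⁻¹).re * τ + (σ * ζ * μ⁻¹).re := by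
      rw [hx, add_mul, Complex.add_re, Complex.re_ofReal_mul, mul_comm]
    have h2 : |(σ * ζ * μ⁻¹).re| ≤ ‖μ⁻¹‖ := by
      refine (Complex.abs_re_le_norm _).trans ?_
      rw [norm_mul, norm_mul, hnσ, one_mul]
      exact mul_le_of_le_one_left (norm_nonneg _) (by linarith)
    linarith [neg_le_of_abs_le h2]
  have hdiff : ‖2 * τ * (σ * ζ) + ζ ^ 2‖ ≤ 3 := by
    calc ‖2 * τ * (σ * ζ) + ζ ^ 2‖ ≤ ‖2 * τ * (σ * ζ)‖ + ‖ζ ^ 2‖ := norm_add_le _ _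
      _ = 2 * (‖ζ‖ * τ) + ‖ζ‖ ^ 2 := by
        simp only [norm_mul, norm_pow, hnσ, Complex.norm_real, Real.norm_eq_abs, abs_of_pos hτ0,
          Complex.norm_ofNat]
        ring
      _ ≤ 3 := by nlinarith [norm_nonneg ζ]
  have hsq : x ^ 2 = ((τ ^ 2 : ℝ) : ℂ) * (μ ^ 2)⁻¹ + (2 * τ * (σ * ζ) + ζ ^ 2) * (μ ^ 2)⁻¹ := by
    rw [hx, mul_pow, inv_pow]
    push_cast
    linear_combination ζ ^ 2 * (μ ^ 2)⁻¹ * hσc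
  refine ⟨x ^ 2, ?_, ?_, ?_, ?_⟩
  · rw [rootTime, Complex.sq_cpow_two_inv hxre, htx]
  · rw [hsq, Complex.add_re, Complex.re_ofReal_mul]
    have h := (Complex.abs_re_le_norm ((2 * τ * (σ * ζ) + ζ ^ 2) * (μ ^ 2)⁻¹))
    rw [norm_mul] at h
    have h' := h.trans (mul_le_mul_of_nonneg_right hdiff (norm_nonneg _))
    linarith [neg_le_of_abs_le h']
  · have : (σ * μ) ^ 2 * x ^ 2 - (t : ℂ) ^ 2 = 2 * τ * (σ * ζ) + ζ ^ 2 := by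
      have : (τ : ℂ) = σ * t := by simp [hτ]
      rw [← mul_pow, htx, this]
      linear_combination -2 * t * ζ * hσc
    rw [this]
    exact hdiff
  · set η : ℂ := σ * ζ / τ with hη
    have hτc : (τ : ℂ) ≠ 0 := by exact_mod_cast hτ0.ne'
    have hηn : ‖η‖ ≤ 1 / 2 := by
      rw [hη, norm_div, norm_mul, hnσ, one_mul, Complex.norm_real, Real.norm_eq_abs,
        abs_of_pos hτ0, div_le_iff₀ hτ0]
      nlinarith
    set z : ℂ := (1 + η) ^ 2 * (μ ^ 2)⁻¹ with hz
    have hlow : 1 / 2 ≤ ‖1 + η‖ := by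
      have := norm_sub_le_norm_add (1 : ℂ) η
      rw [norm_one] at this
      linarith
    have hupp : ‖1 + η‖ ≤ 2 := by
      have := norm_add_le (1 : ℂ) η
      rw [norm_one] at this
      linarith
    have hz0 : z ≠ 0 := mul_ne_zero (pow_ne_zero 2 (norm_pos_iff.1 (by linarith)))
      (inv_ne_zero (pow_ne_zero 2 hμ0))
    have hxz : x ^ 2 = ((τ ^ 2 : ℝ) : ℂ) * z := by
      rw [hx, hz, hη]
      push_cast
      field_simp
    have hlog : Complex.log (x ^ 2) = 2 * (Real.log |t| : ℂ) + Complex.log z := by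
      rw [hxz, Complex.log_ofReal_mul (by positivity) hz0, habs, Real.log_pow]
      push_cast
      ring
    have h1 : ‖z‖ ≤ 4 * ‖(μ ^ 2)⁻¹‖ := by
      rw [hz, norm_mul, norm_pow]
      exact mul_le_mul_of_nonneg_right (by nlinarith) (norm_nonneg _)
    have h2 : ‖z‖⁻¹ ≤ 4 * ‖μ ^ 2‖ := by
      rw [hz, norm_mul, norm_pow, norm_inv, mul_inv, inv_inv]
      refine mul_le_mul_of_nonneg_right ?_ (norm_nonneg _)
      rw [inv_le_comm₀ (by positivity) (by norm_num)]
      nlinarith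
    have hzp : 0 < ‖z‖ := norm_pos_iff.2 hz0
    have h3 : |Real.log ‖z‖| ≤ 4 * ‖μ ^ 2‖ + 4 * ‖(μ ^ 2)⁻¹‖ := by
      have a1 := Real.log_le_self hzp.le
      have a2 := Real.log_le_self (inv_pos.2 hzp).le
      rw [Real.log_inv] at a2
      have a3 := inv_pos.2 hzp
      exact abs_le.2 ⟨by linarith, by linarith⟩
    have h4 : ‖Complex.log z‖ ≤ |Real.log ‖z‖| + Real.pi := by
      have := Complex.norm_le_abs_re_add_abs_im (Complex.log z)
      rw [Complex.log_re, Complex.log_im] at this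
      linarith [Complex.abs_arg_le_pi z]
    have h5 : Complex.log (x ^ 2) / 2 - (Real.log |t| : ℂ) = Complex.log z / 2 := by
      rw [hlog]
      ring
    rw [h5, norm_div, Complex.norm_ofNat]
    linarith [norm_nonneg (Complex.log z)]

lemma norm_exp_le_norm_exp_mul (a b : ℂ) :
    ‖Complex.exp a‖ ≤ Real.exp ‖a - b‖ * ‖Complex.exp b‖ := by
  have : Complex.exp a = Complex.exp (a - b) * Complex.exp b := by
    rw [← Complex.exp_add, sub_add_cancel]
  rw [this, norm_mul]
  exact mul_le_mul_of_nonneg_right (Complex.norm_exp_le_exp_norm _) (norm_nonneg _)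

/-- A bound of an entire function by an exponential on the half-planes in the variable `v` implies
bounds of its derivatives along the real axis. The radius `(1 + |t|)⁻¹` in Cauchy's inequality
accounts for the power of `1 + |t|`. -/
theorem exists_iteratedDeriv_bound {σ : ℝ} (hσ : σ = 1 ∨ σ = -1) {μ : ℂ} (hμ : 0 < μ.re)
    (hμ2 : 0 < ((μ ^ 2)⁻¹).re) {H : ℕ → ℝ} {g : ℂ → ℂ → ℂ}
    (hg : ∀ w, Differentiable ℂ fun t => g t w)
    (hgb : ∀ R : ℝ, ∃ C, ∀ t w, ‖t‖ ≤ R → ‖w‖ ≤ R → ‖g t w‖ ≤ C)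
    {a : ℂ} {b ρ : ℂ → ℂ} (hb : Differentiable ℂ b) (hρ : Differentiable ℂ ρ)
    (hgH : ∀ m : ℕ, ∃ C, 0 ≤ C ∧ ∀ v w, ‖w‖ < m → H m < v.re →
      ‖g (rootTime (σ * μ) v) w‖ ≤ C * ‖Complex.exp (a * ((σ * μ) ^ 2 / 2) * v +
        b w * rootTime (σ * μ) v + ρ w / 2 * Complex.log v)‖)
    (R : ℝ) {t₀ : ℝ} (ht₀ : 0 < t₀) (j : ℕ) :
    ∃ C, 0 ≤ C ∧ ∀ w, ‖w‖ ≤ R → ∀ t : ℝ, t₀ ≤ σ * t →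
      ‖iteratedDeriv j (fun t => g t w) t‖ ≤ C * (1 + |t|) ^ j *
        ‖Complex.exp (a * (t : ℂ) ^ 2 / 2 + b w * t + ρ w * (Real.log |t| : ℂ))‖ := by
  have hμ0 : μ ≠ 0 := fun h => by simp [h] at hμ
  have hμi : 0 < (μ⁻¹).re := by
    rw [Complex.inv_re]
    exact div_pos hμ (Complex.normSq_pos.2 hμ0)
  have habs : ∀ {t : ℝ}, t₀ ≤ σ * t → |t| = σ * t := by
    intro t h
    have : |σ * t| = |t| := by
      rw [abs_mul]
      rcases hσ with h | h <;> simp [h]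
    rw [← this, abs_of_pos (by linarith)]
  obtain ⟨B, hB0, hB⟩ := exists_norm_le_of_differentiable (f := fun _ : Unit => b) (fun _ => hb) R
  obtain ⟨D, hD0, hD⟩ := exists_norm_le_of_differentiable (f := fun _ : Unit => ρ) (fun _ => hρ) R
  obtain ⟨m, hm⟩ := exists_nat_gt R
  obtain ⟨C₁, hC₁, hlarge⟩ := hgH m
  -- beyond `Y` all discs of radius at most one lie over the half-plane of index `m`
  set Y : ℝ := max 1 (max (‖μ⁻¹‖ / (μ⁻¹).re + 1)
    ((|H m| + 3 * ‖(μ ^ 2)⁻¹‖) / ((μ ^ 2)⁻¹).re + 1)) with hY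
  -- the variation of the phase on these discs
  set K : ℝ := ‖a‖ * (3 / 2) + B + D * (4 * ‖μ ^ 2‖ + 4 * ‖(μ ^ 2)⁻¹‖ + Real.pi) with hK
  obtain ⟨C₂, hsmall⟩ := hgb (max (Y + 1) R)
  -- the size of the phase for `t₀ ≤ σ t ≤ Y`
  set K' : ℝ := ‖a‖ * Y ^ 2 / 2 + B * Y + D * (Y + t₀⁻¹) with hK'
  refine ⟨j.factorial * (C₁ * Real.exp K) + j.factorial * |C₂| * Real.exp K', by positivity,
    fun w hw t ht => ?_⟩
  have hτ := habs ht
  set E : ℂ := a * (t : ℂ) ^ 2 / 2 + b w * t + ρ w * (Real.log |t| : ℂ) with hE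
  rcases le_or_gt (σ * t) Y with hle | hgt
  · have htn : ‖(t : ℂ)‖ = |t| := Complex.norm_real t
    have htY : ‖(t : ℂ)‖ ≤ Y := by rw [htn, hτ]; exact hle
    have h1 : ‖iteratedDeriv j (fun t => g t w) t‖ ≤ j.factorial * |C₂| :=
      norm_iteratedDeriv_le_of_bounded (hg w)
        (fun z hz => (hsmall z w (hz.trans (le_max_left _ _)) (hw.trans (le_max_right _ _))).trans
          (le_abs_self C₂)) j htY
    have htp : 0 < |t| := by rw [hτ]; linarith
    have hlog : |Real.log (|t|)| ≤ Y + t₀⁻¹ := by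
      have a1 := Real.log_le_self htp.le
      have a2 := Real.log_le_self (inv_pos.2 htp).le
      rw [Real.log_inv] at a2
      have a3 : |t|⁻¹ ≤ t₀⁻¹ := inv_anti₀ ht₀ (by rw [hτ]; exact ht)
      have a4 := inv_pos.2 ht₀
      rw [← htn] at a1
      have a5 : 0 ≤ Y := (norm_nonneg _).trans htY
      rw [htn] at a1
      rw [htn] at htY
      exact abs_le.2 ⟨by linarith, by linarith⟩
    have hEn : ‖E‖ ≤ K' := by
      have b1 : ‖a * (t : ℂ) ^ 2 / 2‖ ≤ ‖a‖ * Y ^ 2 / 2 := by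
        rw [norm_div, norm_mul, norm_pow, Complex.norm_ofNat]
        gcongr
      have b2 : ‖b w * t‖ ≤ B * Y := by
        rw [norm_mul]
        exact mul_le_mul (hB () w hw) htY (norm_nonneg _) hB0
      have b3 : ‖ρ w * (Real.log |t| : ℂ)‖ ≤ D * (Y + t₀⁻¹) := by
        rw [norm_mul, Complex.norm_real, Real.norm_eq_abs]
        exact mul_le_mul (hD () w hw) hlog (abs_nonneg _) hD0
      exact (norm_add₃_le).trans (by linarith)
    have h2 : 1 ≤ Real.exp K' * ‖Complex.exp E‖ := by
      have := norm_exp_le_norm_exp_mul 0 E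
      rw [Complex.exp_zero, norm_one, zero_sub, norm_neg] at this
      exact this.trans (mul_le_mul_of_nonneg_right (Real.exp_le_exp.2 hEn) (norm_nonneg _))
    have h3 : 1 ≤ (1 + |t|) ^ j := one_le_pow₀ (by linarith)
    calc ‖iteratedDeriv j (fun t => g t w) t‖ ≤ j.factorial * |C₂| * 1 * 1 := by simpa using h1
      _ ≤ j.factorial * |C₂| * (1 + |t|) ^ j * (Real.exp K' * ‖Complex.exp E‖) := by gcongr
      _ = j.factorial * |C₂| * Real.exp K' * (1 + |t|) ^ j * ‖Complex.exp E‖ := by ring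
      _ ≤ _ := by
        gcongr
        exact le_add_of_nonneg_left (by positivity)
  · have hY1 : 1 ≤ Y := le_max_left _ _
    have hY2 : ‖μ⁻¹‖ / (μ⁻¹).re + 1 ≤ Y := (le_max_left _ _).trans (le_max_right _ _)
    have hY3 : (|H m| + 3 * ‖(μ ^ 2)⁻¹‖) / ((μ ^ 2)⁻¹).re + 1 ≤ Y :=
      (le_max_right _ _).trans (le_max_right _ _)
    have h1 : 1 ≤ σ * t := by linarith
    have h2 : ‖μ⁻¹‖ < (μ⁻¹).re * (σ * t) := by
      rw [← div_lt_iff₀' hμi]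
      linarith
    have h3 : H m < (σ * t) ^ 2 * ((μ ^ 2)⁻¹).re - 3 * ‖(μ ^ 2)⁻¹‖ := by
      have : |H m| + 3 * ‖(μ ^ 2)⁻¹‖ < (σ * t) * ((μ ^ 2)⁻¹).re := by
        rw [← div_lt_iff₀ hμ2]
        linarith
      have h4 : (σ * t) * ((μ ^ 2)⁻¹).re ≤ (σ * t) ^ 2 * ((μ ^ 2)⁻¹).re :=
        mul_le_mul_of_nonneg_right (by nlinarith) hμ2.le
      linarith [le_abs_self (H m)]
    have hδ : 0 < (1 + |t|)⁻¹ := by positivity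
    have hbound : ∀ z ∈ Metric.sphere (t : ℂ) (1 + |t|)⁻¹,
        ‖g z w‖ ≤ C₁ * Real.exp K * ‖Complex.exp E‖ := by
      intro z hz
      rw [mem_sphere_iff_norm] at hz
      obtain ⟨v, hv1, hv2, hv3, hv4⟩ := halfPlane_shift hσ hμ h1 h2 (ζ := z - t) hz.le
      rw [add_sub_cancel] at hv1
      have h5 := hlarge v w (hw.trans_lt hm) (h3.trans_le hv2)
      rw [hv1] at h5
      refine h5.trans ?_
      rw [mul_assoc C₁]
      refine mul_le_mul_of_nonneg_left ((norm_exp_le_norm_exp_mul _ E).trans ?_) hC₁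
      refine mul_le_mul_of_nonneg_right (Real.exp_le_exp.2 ?_) (norm_nonneg _)
      have h6 : a * ((σ * μ) ^ 2 / 2) * v + b w * z + ρ w / 2 * Complex.log v - E =
          a * (((σ * μ) ^ 2 * v - (t : ℂ) ^ 2) / 2) + b w * (z - t) +
            ρ w * (Complex.log v / 2 - (Real.log |t| : ℂ)) := by
        rw [hE]
        ring
      rw [h6]
      refine norm_add₃_le.trans (add_le_add (add_le_add ?_ ?_) ?_)
      · rw [norm_mul, norm_div, Complex.norm_ofNat]
        gcongr
      · rw [norm_mul, hz]
        calc ‖b w‖ * (1 + |t|)⁻¹ ≤ B * 1 := by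
              refine mul_le_mul (hB () w hw) ?_ hδ.le hB0
              exact inv_le_one_of_one_le₀ (by linarith [abs_nonneg t])
          _ = B := mul_one B
      · rw [norm_mul]
        exact mul_le_mul (hD () w hw) hv4 (norm_nonneg _) hD0
    have h7 := Complex.norm_iteratedDeriv_le_of_forall_mem_sphere_norm_le j hδ
      (hg w).diffContOnCl hbound
    calc ‖iteratedDeriv j (fun t => g t w) t‖
        ≤ j.factorial * (C₁ * Real.exp K * ‖Complex.exp E‖) / ((1 + |t|)⁻¹) ^ j := h7
      _ = j.factorial * (C₁ * Real.exp K) * (1 + |t|) ^ j * ‖Complex.exp E‖ := by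
        rw [inv_pow, div_inv_eq_mul]
        ring
      _ ≤ _ := by
        gcongr
        exact le_add_of_nonneg_right (by positivity)

end Estimates

/-! ### A basis of the kernel -/

section KernelBasis

/-- Linearly independent Cauchy data give a basis of the kernel. -/
lemma kernel_basis_of_cauchyData {n : ℕ} (hn : 2 ≤ n) {P : ℕ → NCPoly}
    (hP : ∀ l, l ≤ n → IsHomog l (P l)) (hlead : evalAtZero (P n) = Polynomial.X ^ n)
    {w : ℂ} {Ψ Θ : ℂ → VecOp n} (hΨ0 : Ψ 0 = 1) (hleft : ∀ t, Θ t * Ψ t = 1)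
    (hright : ∀ t, Ψ t * Θ t = 1)
    (hΨ : ∀ t, HasDerivAt Ψ (mulVecOp n (compMat n P t w) * Ψ t) t)
    (hΘ : ∀ t, HasDerivAt Θ (-(Θ t * mulVecOp n (compMat n P t w))) t)
    {c : Fin n → Fin n → ℂ} (hc : LinearIndependent ℂ c)
    (hg : ∀ k, Differentiable ℂ fun t => Ψ t (c k) ⟨0, by omega⟩) :
    LinearIndependent ℂ (fun k => ofEntire _ (hg k)) ∧
      Submodule.span ℂ (Set.range fun k => ofEntire _ (hg k)) =
        LinearMap.ker (opL n P w⁻¹) := by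
  have hsol := fun k => companion_solution hn hP hlead (w := w) (y := fun t => Ψ t (c k))
    (fun t => (hΨ t).clm_apply (hasDerivAt_const t (c k)) |>.congr_deriv (by
      rw [map_zero, add_zero]
      rfl)) (hg k)
  have hdata : ∀ k, cauchyData n (ofEntire _ (hg k)) = c k := by
    intro k
    funext i
    rw [cauchyData_apply]
    refine ((hsol k).1 i 0).trans ?_
    rw [Complex.ofReal_zero, hΨ0]
    rfl
  refine ⟨LinearIndependent.of_comp (cauchyData n) ?_, le_antisymm ?_ fun f hf => ?_⟩
  · convert hc using 1
    funext k
    exact hdata k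
  · rw [Submodule.span_le]
    rintro _ ⟨k, rfl⟩
    exact (hsol k).2
  · have htop : Submodule.span ℂ (Set.range c) = ⊤ :=
      hc.span_eq_top_of_card_eq_finrank' (by simp)
    have hmem : cauchyData n f ∈ Submodule.span ℂ (Set.range c) := htop ▸ Submodule.mem_top
    obtain ⟨a, ha⟩ := (Submodule.mem_span_range_iff_exists_fun ℂ).1 hmem
    refine (Submodule.mem_span_range_iff_exists_fun ℂ).2 ⟨a, ?_⟩
    have hker : ∑ k, a k • ofEntire _ (hg k) ∈ LinearMap.ker (opL n P w⁻¹) :=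
      Submodule.sum_mem _ fun k _ => Submodule.smul_mem _ _ (hsol k).2
    ext t
    rw [eq_fundamental_of_mem_ker hn hP hlead hΨ0 hleft hright hΘ hf t,
      eq_fundamental_of_mem_ker hn hP hlead hΨ0 hleft hright hΘ hker t, map_sum]
    simp only [map_smul, hdata, ha]

/-- Solutions which are entire in `t` and in the parameter `w = γ⁻¹`, form a basis of the kernel,
and satisfy the phase bounds on half-planes of the variable `v = (t / α) ^ 2`. -/
theorem exists_entire_kernel_basis {n : ℕ} (hn : 2 ≤ n) {P : ℕ → NCPoly}
    (hP : ∀ l, l ≤ n → IsHomog l (P l)) (hlead : evalAtZero (P n) = Polynomial.X ^ n)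
    {r : Fin n → ℂ} (hr : Function.Injective r) (hroot : ∀ k, (evalAtOne (P n)).IsRoot (r k))
    {α : ℂ} (hα : α ≠ 0) (hgen : ∀ j k, j ≠ k → (α ^ 2 / 2 * (r j - r k)).im ≠ 0) :
    ∃ (g : Fin n → ℂ → ℂ → ℂ) (hg : ∀ k w, Differentiable ℂ fun t => g k t w) (H : ℕ → ℝ),
      (∀ k t, Differentiable ℂ (g k t)) ∧
      (∀ k, ∀ R : ℝ, ∃ C, ∀ t w, ‖t‖ ≤ R → ‖w‖ ≤ R → ‖g k t w‖ ≤ C) ∧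
      (∀ w, LinearIndependent ℂ (fun k => ofEntire _ (hg k w)) ∧
        Submodule.span ℂ (Set.range fun k => ofEntire _ (hg k w)) =
          LinearMap.ker (opL n P w⁻¹)) ∧
      ∀ k, ∀ m : ℕ, ∃ C, 0 ≤ C ∧ ∀ v w, ‖w‖ < m → H m < v.re →
        ‖g k (rootTime α v) w‖ ≤ C * ‖Complex.exp (halfPlanePhase n P r α k v w)‖ := by
  obtain ⟨H, F, hH, hFw, hFv, hFb, hF⟩ := exists_systemSolutions hn hP hlead hr hroot hα hgen
  obtain ⟨Ψ, Θ, hΨ0, hleft, hright, hΨ, hΘ, hΨw, hΘw, hΨb⟩ := exists_fundamental_solution n P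
  obtain ⟨c, hcw, hc, hFc⟩ := exists_cauchyData hα hH hFw hFv hF hright hΘ hΘw
  have hg : ∀ k w, Differentiable ℂ fun t => Ψ t w (c k w) ⟨0, by omega⟩ := fun k w t =>
    differentiableAt_pi.1 ((hΨ t w).differentiableAt.clm_apply (differentiableAt_const _)) _
  refine ⟨fun k t w => Ψ t w (c k w) ⟨0, by omega⟩, hg, H, fun k t w => ?_, fun k R => ?_,
    fun w => ?_, fun k m => ?_⟩
  · exact differentiableAt_pi.1 ((hΨw t w).clm_apply (hcw k w)) _
  · obtain ⟨C, hC⟩ := hΨb R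
    obtain ⟨D, -, hD⟩ := exists_norm_le_of_differentiable
      (fun i : Fin n => differentiable_pi.1 (hcw k) i) R
    refine ⟨|C| * |D|, fun t w ht hw => (norm_le_pi_norm _ _).trans
      (((Ψ t w).le_opNorm _).trans (mul_le_mul ((hC t w ht hw).trans (le_abs_self C)) ?_
        (norm_nonneg _) (abs_nonneg _)))⟩
    exact (pi_norm_le_iff_of_nonneg (abs_nonneg D)).2 fun i => (hD i w hw).trans (le_abs_self D)
  · exact kernel_basis_of_cauchyData hn hP hlead (hΨ0 w) (fun t => hleft t w)
      (fun t => hright t w) (fun t => hΨ t w) (fun t => hΘ t w) (hc w) fun k => hg k w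
  · obtain ⟨C, hC0, hC⟩ := hFb m
    refine ⟨C, hC0, fun v w hw hv => ?_⟩
    have := hC v w hw hv k ⟨0, by omega⟩ rfl
    rwa [hFc k _ v w (mem_halfPlanes.2 ⟨m, hw, hv⟩)] at this

end KernelBasis

end HeisenbergODE

end

theorem mainTheorem6
    (n : ℕ) (hn : 2 ≤ n)
    (P : ℕ → HeisenbergODE.NCPoly)
    (hP : ∀ l, l ≤ n → HeisenbergODE.IsHomog l (P l))
    (hlead : HeisenbergODE.evalAtZero (P n) = Polynomial.X ^ n)
    (r : Fin n → ℂ) (hr : Function.Injective r)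
    (hroot : ∀ k, (HeisenbergODE.evalAtOne (P n)).IsRoot (r k))
    (σ : ℝ) (hσ : σ = 1 ∨ σ = -1) :
    ∃ ψ : Fin n → ℂ → HeisenbergODE.Smooth,
      -- for every `γ` the functions `ψ k γ` are a basis of the kernel
      (∀ γ : ℂ, 0 < γ.re →
        LinearIndependent ℂ (fun k => ψ k γ) ∧
        Submodule.span ℂ (Set.range fun k => ψ k γ) =
          LinearMap.ker (HeisenbergODE.opL n P γ)) ∧
      -- they are holomorphic in `γ`
      (∀ (k : Fin n) (t : ℝ),
        DifferentiableOn ℂ (fun γ : ℂ => (ψ k γ : ℝ → ℂ) t) {γ : ℂ | 0 < γ.re}) ∧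
      -- the estimates for `σ t ≥ t₀`
      (∀ γ₀ : ℝ, 0 < γ₀ → ∀ t₀ : ℝ, 0 < t₀ → ∀ j : ℕ, ∃ C : ℝ, 0 < C ∧
        ∀ (k : Fin n) (γ : ℂ), 0 < γ.re → γ₀ ≤ ‖γ‖ → ∀ t : ℝ, t₀ ≤ σ * t →
          ‖iteratedDeriv j (ψ k γ : ℝ → ℂ) t‖ ≤
            C * (1 + |t|) ^ j * ‖Complex.exp (HeisenbergODE.phase n P r k t γ)‖) ∧
      -- uniform bounds for `t` in compact sets
      (∀ γ₀ : ℝ, 0 < γ₀ → ∀ t₀ : ℝ, 0 < t₀ → ∀ j : ℕ, ∃ C : ℝ, 0 < C ∧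
        ∀ (k : Fin n) (γ : ℂ), 0 < γ.re → γ₀ ≤ ‖γ‖ → ∀ t : ℝ, |t| ≤ t₀ →
          ‖iteratedDeriv j (ψ k γ : ℝ → ℂ) t‖ ≤ C) := by
  -- with `α = σ μ`, division by `α` maps the half-line `σ t > 0` to the ray through `μ⁻¹`
  obtain ⟨μ, hμ, hμ2, hgen⟩ := HeisenbergODE.exists_square_root_direction hr
  have hσ2 : (σ : ℂ) ^ 2 = 1 := by rcases hσ with h | h <;> simp [h]
  have hα2 : ((σ : ℂ) * μ) ^ 2 = μ ^ 2 := by rw [mul_pow, hσ2, one_mul]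
  have hα : (σ : ℂ) * μ ≠ 0 := by
    refine mul_ne_zero (fun h => ?_) (fun h => ?_)
    · simp [h] at hσ2
    · simp [h] at hμ
  obtain ⟨g, hg, H, hgw, hgb, hbasis, hgH⟩ := HeisenbergODE.exists_entire_kernel_basis hn hP hlead
    hr hroot hα (fun j k hjk => by rw [hα2]; exact hgen j k hjk)
  have hinv : ∀ {γ₀ : ℝ} {γ : ℂ}, 0 < γ₀ → γ₀ ≤ ‖γ‖ → ‖γ⁻¹‖ ≤ γ₀⁻¹ := fun h0 h => by
    rw [norm_inv]
    exact inv_anti₀ h0 h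
  have hderiv : ∀ (k : Fin n) (γ : ℂ) (j : ℕ) (t : ℝ),
      iteratedDeriv j (HeisenbergODE.ofEntire _ (hg k γ⁻¹) : ℝ → ℂ) t =
        iteratedDeriv j (fun t => g k t γ⁻¹) t := fun k γ j t =>
    congrFun (HeisenbergODE.iteratedDeriv_comp_ofReal (hg k γ⁻¹) j) t
  refine ⟨fun k γ => HeisenbergODE.ofEntire _ (hg k γ⁻¹), fun γ _ => ?_, fun k t γ hγ => ?_,
    fun γ₀ hγ₀ t₀ ht₀ j => ?_, fun γ₀ hγ₀ t₀ ht₀ j => ?_⟩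
  · have := hbasis γ⁻¹
    rwa [inv_inv] at this
  · have hγ0 : γ ≠ 0 := fun h => by simp [h] at hγ
    exact ((hgw k t γ⁻¹).comp γ (differentiableAt_inv hγ0)).differentiableWithinAt
  · have := fun k => HeisenbergODE.exists_iteratedDeriv_bound hσ hμ hμ2 (hg k) (hgb k)
      (HeisenbergODE.differentiable_betaCoef_inv P r k)
      (HeisenbergODE.differentiable_rhoCoef_inv P r k) (hgH k) γ₀⁻¹ ht₀ j
    choose C hC0 hC using this
    refine ⟨1 + ∑ k, C k, add_pos_of_pos_of_nonneg one_pos (Finset.sum_nonneg fun k _ => hC0 k),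
      fun k γ _ hγ t ht => ?_⟩
    have h1 := hC k γ⁻¹ (hinv hγ₀ hγ) t ht
    rw [inv_inv] at h1
    rw [hderiv]
    refine h1.trans ?_
    rw [HeisenbergODE.phase]
    gcongr
    exact (Finset.single_le_sum (fun k _ => hC0 k) (Finset.mem_univ k)).trans
      (le_add_of_nonneg_left zero_le_one)
  · choose C hC using fun k => hgb k (max (t₀ + 1) γ₀⁻¹)
    refine ⟨1 + ∑ k, j.factorial * |C k|, add_pos_of_pos_of_nonneg one_pos
      (Finset.sum_nonneg fun k _ => by positivity), fun k γ _ hγ t ht => ?_⟩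
    rw [hderiv]
    refine (HeisenbergODE.norm_iteratedDeriv_le_of_bounded (R := t₀) (C := |C k|) (hg k γ⁻¹)
      (fun z hz => (hC k z γ⁻¹ (hz.trans (le_max_left _ _))
        ((hinv hγ₀ hγ).trans (le_max_right _ _))).trans (le_abs_self _)) j
      (by rwa [Complex.norm_real])).trans ?_
    exact (Finset.single_le_sum (f := fun k => (j.factorial : ℝ) * |C k|)
      (fun k _ => by positivity) (Finset.mem_univ k)).trans (le_add_of_nonneg_left zero_le_one)
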